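/- A \emph{locally convex Lie group} is a Hausdorff group $K$ which is a $C^\infty$ manifold (with smooth multiplication and inversion) modelled on a complete Hausdorff locally convex real vector space; here a map between locally convex spaces is $C^\infty$ in the sense of Michal--Bastiani, i.e. it has iterated directional derivatives of all orders and these are jointly continuous in the point and the directions. It is a \emph{Fr\'echet--Lie group} if the model space is moreover metrizable, and it is \emph{regular} if for every smooth curve $\xi\colon[0,1]\to\mathfrak k$ in its Lie algebra $\mathfrak k=T_1K$ there is a smooth curve $\gamma_\xi\colon[0,1]\to K$ with $\gamma_\xi(0)=1$ and $\gamma_\xi(t)^{-1}\gamma_\xi'(t)=\xi(t)$ for all $t$, and the map $C^\infty([0,1],\mathfrak k)\to K$, $\xi\mapsto\gamma_\xi(1)$, is smooth, where $C^\infty([0,1],\mathfrak k)$ carries the topology of uniform convergence of all derivatives. Morphisms of all these groups are the smooth homomorphisms. \textbf{Theorem.} Let $G$ and $H$ be finite-dimensional (real) Lie groups, not necessarily connected or with a countable base, and let $f\colon G\to H$ be a smooth homomorphism. (1) If $f$ is an epimorphism in the category of locally convex Lie groups (that is, any two smooth homomorphisms $g_1,g_2$ from $H$ to a locally convex Lie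 group $K$ with $g_1\circ f=g_2\circ f$ are equal), then $f(G)$ is dense in $H$. (2) If $G$ has a countable base and $f$ is an epimorphism in the category of regular Fr\'echet--Lie groups (that is, any two smooth homomorphisms $g_1,g_2$ from $H$ to a regular Fr\'echet--Lie group $K$ with $g_1\circ f=g_2\circ f$ are equal), then $f(G)$ is dense in $H$. -/

import Mathlib

open Set Filter
open scoped Topology Manifold ContDiff

universe u v

/-- `LCContDiffOn n f U`: the map `f : E → F` between (locally convex) real topological vector
spaces is of class `C^n` on the open set `U ⊆ E`, in the sense of Bastiani (also known as
Michal–Bastiani, or Keller's `C^n_c`). `C^0` means continuous; `C^(n+1)` means continuous and such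
that all directional derivatives
`df(x)(h) = lim_{t → 0} t⁻¹ (f (x + t h) - f x)` exist for `x ∈ U`, `h ∈ E`, and the map
`(x, h) ↦ df(x)(h)` is of class `C^n` on `U × E`. -/
def LCContDiffOn {F : Type v} [AddCommGroup F] [Module ℝ F] [TopologicalSpace F] :
    ℕ → ∀ {E : Type u} [AddCommGroup E] [Module ℝ E] [TopologicalSpace E],
      (E → F) → Set E → Prop
  | 0, _, _, _, _, f, U => ContinuousOn f U
  | n + 1, E, _, _, _, f, U => ContinuousOn f U ∧ ∃ df : E × E → F,
      (∀ x ∈ U, ∀ h : E,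
        Tendsto (fun t : ℝ => t⁻¹ • (f (x + t • h) - f x)) (𝓝[≠] 0) (𝓝 (df (x, h)))) ∧
      LCContDiffOn n df (U ×ˢ (univ : Set E))

/-- Smoothness (class `C^∞`) on an open subset of a locally convex space. -/
def LCSmoothOn {E : Type u} [AddCommGroup E] [Module ℝ E] [TopologicalSpace E]
    {F : Type v} [AddCommGroup F] [Module ℝ F] [TopologicalSpace F]
    (f : E → F) (U : Set E) : Prop :=
  ∀ n : ℕ, LCContDiffOn n f U

/-- A smooth map `f : M → N` between manifolds modelled on the locally convex spaces `E` and `F`: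
it is continuous, and smooth when read in charts. -/
def LCSmooth (E : Type u) [AddCommGroup E] [Module ℝ E] [TopologicalSpace E]
    (F : Type v) [AddCommGroup F] [Module ℝ F] [TopologicalSpace F]
    {M : Type*} [TopologicalSpace M] [ChartedSpace E M]
    {N : Type*} [TopologicalSpace N] [ChartedSpace F N] (f : M → N) : Prop :=
  Continuous f ∧ ∀ e ∈ atlas E M, ∀ e' ∈ atlas F N,
    LCSmoothOn (fun x => e' (f (e.symm x))) (e.target ∩ e.symm ⁻¹' (f ⁻¹' e'.source))

/-- A Lie group modelled on the locally convex space `F`: a Hausdorff topological group which is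
a smooth manifold modelled on `F` (all chart changes are smooth), with smooth multiplication and
smooth inversion. -/
class LCLieGroup (F : Type u) [AddCommGroup F] [Module ℝ F] [TopologicalSpace F]
    (K : Type v) [Group K] [TopologicalSpace K] [ChartedSpace F K] : Prop
    extends IsTopologicalGroup K, T2Space K where
  /-- The chart changes are smooth. -/
  smooth_chart_change : ∀ e ∈ atlas F K, ∀ e' ∈ atlas F K,
    LCSmoothOn (fun x => e' (e.symm x)) (e.target ∩ e.symm ⁻¹' e'.source)
  /-- Multiplication `K × K → K` is smooth, read in the product charts of `K × K`. -/
  smooth_mul : ∀ e₁ ∈ atlas F K, ∀ e₂ ∈ atlas F K, ∀ e₃ ∈ atlas F K,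
    LCSmoothOn (fun p : F × F => e₃ (e₁.symm p.1 * e₂.symm p.2))
      {p : F × F | p.1 ∈ e₁.target ∧ p.2 ∈ e₂.target ∧ e₁.symm p.1 * e₂.symm p.2 ∈ e₃.source}
  /-- Inversion is smooth. -/
  smooth_inv : LCSmooth F F (fun x : K => x⁻¹)

/-- `HasCurveDerivAt c t v`: the curve `c : [0,1] → F` has derivative `v` at `t` (a one-sided
derivative if `t` is an end point). -/
def HasCurveDerivAt {F : Type u} [AddCommGroup F] [Module ℝ F] [TopologicalSpace F]
    (c : unitInterval → F) (t : unitInterval) (v : F) : Prop :=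
  Tendsto (fun s : unitInterval => ((s : ℝ) - (t : ℝ))⁻¹ • (c s - c t)) (𝓝[≠] t) (𝓝 v)

/-- The locally convex space `C^∞([0,1], F)`, with the topology of uniform convergence of all
derivatives. A smooth curve `c` is recorded as the sequence `n ↦ c⁽ⁿ⁾` of its derivatives (which is
determined by its zeroth term `c`); the topology is induced by the product, over the orders `n`, of
the topologies of uniform convergence on `C([0,1], F)`. -/
def SmoothCurve (F : Type u) [AddCommGroup F] [Module ℝ F] [TopologicalSpace F]
    [IsTopologicalAddGroup F] [ContinuousSMul ℝ F] : Submodule ℝ (ℕ → C(unitInterval, F)) where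
  carrier := {ξ | ∀ (n : ℕ) (t : unitInterval), HasCurveDerivAt (ξ n) t (ξ (n + 1) t)}
  zero_mem' := by
    intro n t
    simp [HasCurveDerivAt, tendsto_const_nhds]
  add_mem' := by
    intro a b ha hb n t
    have h := Tendsto.add (ha n t) (hb n t)
    refine h.congr fun s => ?_
    simp only [Pi.add_apply, ContinuousMap.add_apply, ← smul_add]
    congr 1
    abel
  smul_mem' := by
    intro r a ha n t
    have h := Tendsto.const_smul (ha n t) r
    refine h.congr fun s => ?_
    simp only [Pi.smul_apply, ContinuousMap.smul_apply, ← smul_sub]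
    rw [smul_comm]

/-- A curve `c : [0,1] → F` is smooth on the relatively open set `s ⊆ [0,1]`: derivatives of all
orders exist there and are continuous. -/
def SmoothCurveOn {F : Type u} [AddCommGroup F] [Module ℝ F] [TopologicalSpace F]
    (c : unitInterval → F) (s : Set unitInterval) : Prop :=
  ∃ D : ℕ → unitInterval → F, EqOn (D 0) c s ∧
    ∀ n : ℕ, ContinuousOn (D n) s ∧ ∀ t ∈ s, HasCurveDerivAt (D n) t (D (n + 1) t)

/-- A smooth curve `γ : [0,1] → K` in a manifold modelled on the locally convex space `F`. -/
def IsSmoothPath (F : Type u) [AddCommGroup F] [Module ℝ F] [TopologicalSpace F]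
    {K : Type v} [TopologicalSpace K] [ChartedSpace F K] (γ : unitInterval → K) : Prop :=
  Continuous γ ∧ ∀ e ∈ atlas F K, SmoothCurveOn (fun t => e (γ t)) (γ ⁻¹' e.source)

/-- `γ` has left logarithmic derivative `ξ : [0,1] → T₁K`, that is `γ(t)⁻¹ · γ'(t) = ξ(t)` for
all `t`. The Lie algebra `T₁K` is identified with the model space `F` by the preferred chart
at `1`; the tangent vector `γ(t)⁻¹ · γ'(t)` is the velocity at `s = t` of the curve
`s ↦ γ(t)⁻¹ γ(s)`, which passes through `1` at `s = t`. -/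
def HasLeftLogDeriv (F : Type u) [AddCommGroup F] [Module ℝ F] [TopologicalSpace F]
    {K : Type v} [Group K] [TopologicalSpace K] [ChartedSpace F K]
    (γ : unitInterval → K) (ξ : unitInterval → F) : Prop :=
  ∀ t : unitInterval,
    HasCurveDerivAt (fun s => chartAt F (1 : K) ((γ t)⁻¹ * γ s)) t (ξ t)

/-- Regularity of a Lie group `K` modelled on `F` (in the sense of Milnor): every smooth curve
`ξ : [0,1] → T₁K` is the left logarithmic derivative of a smooth curve `γ` in `K` with `γ(0) = 1`,
and the evolution map `C^∞([0,1], T₁K) → K`, `ξ ↦ γ(1)`, is smooth. -/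
def IsRegularLieGroup (F : Type u) [AddCommGroup F] [Module ℝ F] [TopologicalSpace F]
    [IsTopologicalAddGroup F] [ContinuousSMul ℝ F]
    (K : Type v) [Group K] [TopologicalSpace K] [ChartedSpace F K] : Prop :=
  ∃ evol : SmoothCurve F → K, LCSmooth (SmoothCurve F) F evol ∧
    ∀ ξ : SmoothCurve F, ∃ γ : unitInterval → K,
      IsSmoothPath F γ ∧ γ 0 = 1 ∧ HasLeftLogDeriv F γ ((ξ : ℕ → C(unitInterval, F)) 0) ∧
        γ 1 = evol ξ

/-- `f : G → H` is an epimorphism in the category of locally convex Lie groups: two smooth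
homomorphisms from `H` (modelled on `E`) to a Lie group `K` modelled on a complete Hausdorff locally
convex space `F` are equal as soon as they have the same composition with `f`. -/
def IsEpiLCLieGroup (E : Type u) [AddCommGroup E] [Module ℝ E] [TopologicalSpace E]
    {G H : Type u} [Group G] [Group H] [TopologicalSpace H] [ChartedSpace E H]
    (f : G →* H) : Prop :=
  ∀ (F : Type u) [AddCommGroup F] [Module ℝ F] [UniformSpace F] [IsUniformAddGroup F]
    [ContinuousSMul ℝ F] [LocallyConvexSpace ℝ F] [T2Space F] [CompleteSpace F]
    (K : Type u) [Group K] [TopologicalSpace K] [ChartedSpace F K] [LCLieGroup F K]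
    (g₁ g₂ : H →* K), LCSmooth E F g₁ → LCSmooth E F g₂ →
      g₁.comp f = g₂.comp f → g₁ = g₂

/-- `f : G → H` is an epimorphism in the category of regular Fréchet–Lie groups: as before, but
`K` is regular and its model space `F` is a Fréchet space, that is, a complete metrizable locally
convex space. -/
def IsEpiRegularFrechetLieGroup (E : Type u) [AddCommGroup E] [Module ℝ E] [TopologicalSpace E]
    {G H : Type u} [Group G] [Group H] [TopologicalSpace H] [ChartedSpace E H]
    (f : G →* H) : Prop :=
  ∀ (F : Type u) [AddCommGroup F] [Module ℝ F] [UniformSpace F] [IsUniformAddGroup F]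
    [ContinuousSMul ℝ F] [LocallyConvexSpace ℝ F] [TopologicalSpace.MetrizableSpace F]
    [CompleteSpace F]
    (K : Type u) [Group K] [TopologicalSpace K] [ChartedSpace F K] [LCLieGroup F K],
    IsRegularLieGroup F K → ∀ g₁ g₂ : H →* K, LCSmooth E F g₁ → LCSmooth E F g₂ →
      g₁.comp f = g₂.comp f → g₁ = g₂

/-!
If `f(G)` is not dense, its closure `L` is a proper closed subgroup of `H`, and two different
homomorphisms from `H` that agree on `L` have to be found. The group `H` acts by right translations
`(ρ(h) v)(x) = v(x h)` on the complete locally convex space `C^∞(H)`, and there is `v ∈ C^∞(H)` that is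
fixed by `L` but not by all of `H` (`SmoothFun.exists_invariant`): a convolution of a bump function
with the indicator function of a small neighbourhood of `L`. In the semidirect product `C^∞(H) ⋊ H`,
the inclusion `h ↦ (0, h)` and its conjugate `h ↦ (v - ρ(h) v, h)` agree exactly on the stabilizer of
`v`, see `SmoothSemidirect.conjInl_eq_iff`. That the semidirect product is a Lie group rests on the
smoothness of the action `H × C^∞(H) → C^∞(H)` (`SmoothFun.lcContDiffOn_translate`); here a smooth
function is encoded by the family of its iterated left-invariant derivatives, so that `C^∞(H)` is a
closed subspace of a product of spaces `C(H, ℝ)`.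

For a group `G` with a countable base, the target has to be a regular Fréchet–Lie group. First, `H` is
`σ`-compact: otherwise `f(G)` together with a compact neighbourhood of `1` generates a proper open
subgroup, and already discrete groups separate it from `H`
(`IsEpiRegularFrechetLieGroup.sigmaCompactSpace`). Then `C^∞(H)` is a Fréchet space, and
`C^∞(H) ⋊ H` is regular (`SmoothSemidirect.isRegularLieGroup`): the evolution of a curve `(η, X)` is
`t ↦ (∫₀ᵗ ρ(γ(s)) η(s) ds, γ(t))`, where `γ` is the evolution of `X` in `H`. The latter exists, and its
end point depends smoothly on the continuous curve `X` (`contMDiff_evolution_one`): for small `X` by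
the inverse function theorem in the Banach space `C([0,1], T₁H)`, in general by subdividing `[0,1]`.
The smooth dependence on `(η, X)` of the function component follows from `LCContDiffOn.curveMap`,
because `γ(s)` is the end point of the evolution of a curve that depends linearly on `X`.
-/

set_option linter.unusedSectionVars false

/-! ### Calculus in locally convex spaces -/

section Prelim

variable {Z : Type*} [AddCommGroup Z] [Module ℝ Z] [TopologicalSpace Z]

/-- In a locally convex space the closed convex neighbourhoods of a point form a basis. -/
theorem tendsto_of_forall_closed_convex [IsTopologicalAddGroup Z] [ContinuousSMul ℝ Z]
    [LocallyConvexSpace ℝ Z] {ι : Type*} {l : Filter ι} {f : ι → Z} {z : Z}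
    (h : ∀ C ∈ 𝓝 z, Convex ℝ C → IsClosed C → ∀ᶠ i in l, f i ∈ C) : Tendsto f l (𝓝 z) := by
  intro N hN
  obtain ⟨N', ⟨hN', hcl⟩, hsub⟩ := (closed_nhds_basis z).mem_iff.1 hN
  obtain ⟨C, ⟨hC, hconv⟩, hCsub⟩ := (LocallyConvexSpace.convex_basis (𝕜 := ℝ) z).mem_iff.1 hN'
  have := h (closure C) (mem_of_superset hC subset_closure) hconv.closure isClosed_closure
  filter_upwards [this] with i hi
  exact hsub (closure_minimal hCsub hcl hi)

/-- Mean value theorem: if all velocities of a curve on `[0,1]` lie in a closed convex set,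
so does its total increment. -/
theorem sub_mem_of_forall_slope_tendsto [IsTopologicalAddGroup Z] [ContinuousSMul ℝ Z]
    [LocallyConvexSpace ℝ Z] {c c' : ℝ → Z} {C : Set Z}
    (hconv : Convex ℝ C) (hcl : IsClosed C)
    (hc : ∀ r ∈ Icc (0 : ℝ) 1,
      Tendsto (fun s : ℝ => s⁻¹ • (c (r + s) - c r)) (𝓝[≠] 0) (𝓝 (c' r)))
    (hC : ∀ r ∈ Icc (0 : ℝ) 1, c' r ∈ C) : c 1 - c 0 ∈ C := by
  -- a functional separating the increment from `C` reduces this to the mean value theorem in `ℝ`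
  by_contra hne
  obtain ⟨f, a, hfa, hfb⟩ := geometric_hahn_banach_point_closed hconv hcl hne
  have hd : ∀ r ∈ Icc (0 : ℝ) 1, HasDerivAt (fun s => f (c s)) (f (c' r)) r := by
    intro r hr
    rw [hasDerivAt_iff_tendsto_slope_zero]
    refine ((f.continuous.tendsto _).comp (hc r hr)).congr fun s => ?_
    simp
  obtain ⟨r, hr, hr'⟩ := exists_hasDerivAt_eq_slope (fun s => f (c s)) (fun s => f (c' s))
    zero_lt_one (fun r hr => (hd r hr).continuousAt.continuousWithinAt)
    (fun r hr => hd r (Ioo_subset_Icc_self hr))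
  have h1 := hfb _ (hC r (Ioo_subset_Icc_self hr))
  have h2 : f (c' r) = f (c 1 - c 0) := by simpa using hr'
  rw [h2] at h1
  exact lt_asymm h1 hfa

end Prelim

section DirectionalDerivative

variable {F : Type*} [AddCommGroup F] [Module ℝ F]
  {Z : Type*} [AddCommGroup Z] [Module ℝ Z] [TopologicalSpace Z]

theorem eventually_add_smul_mem [TopologicalSpace F] [IsTopologicalAddGroup F]
    [ContinuousSMul ℝ F] {V : Set F} (hV : IsOpen V) {y : F} (hy : y ∈ V) (k : F) :
    ∀ᶠ t : ℝ in 𝓝 0, y + t • k ∈ V := by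
  have : ContinuousAt (fun t : ℝ => y + t • k) 0 := by fun_prop
  exact this.eventually_mem (hV.mem_nhds (by simpa using hy))

/-- The derivative of `r ↦ g (y + r • k)` from the directional derivative of `g`. -/
theorem tendsto_slope_of_directional {g : F → Z} {dg : F × F → Z} {x k : F} {t : ℝ}
    [ContinuousSMul ℝ Z]
    (ht : t ≠ 0)
    (hg : Tendsto (fun s : ℝ => s⁻¹ • (g (x + s • k) - g x)) (𝓝[≠] 0) (𝓝 (dg (x, k)))) :
    Tendsto (fun s : ℝ => s⁻¹ • (g (x + s • t • k) - g x)) (𝓝[≠] 0) (𝓝 (t • dg (x, k))) := by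
  have h0 : Tendsto (fun s : ℝ => s * t) (𝓝[≠] 0) (𝓝[≠] 0) := by
    refine tendsto_nhdsWithin_iff.2 ⟨?_, ?_⟩
    · have : Tendsto (fun s : ℝ => s * t) (𝓝 0) (𝓝 (0 * t)) := by
        exact (continuous_id.mul continuous_const).tendsto 0
      rw [zero_mul] at this
      exact this.mono_left nhdsWithin_le_nhds
    · filter_upwards [self_mem_nhdsWithin] with s hs
      exact mul_ne_zero hs ht
  refine ((hg.comp h0).const_smul t).congr fun s => ?_
  simp only [Function.comp, smul_smul, mul_inv]
  congr 1
  field_simp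

/-- A map with continuous directional derivatives is differentiable along converging directions:
`τ⁻¹ (g (y + τ k) - g y)` tends to `dg (y, k₀)` when `τ → 0` and `k → k₀`. -/
theorem tendsto_slope_of_continuousOn_directional [TopologicalSpace F] [IsTopologicalAddGroup F]
    [ContinuousSMul ℝ F] [IsTopologicalAddGroup Z] [ContinuousSMul ℝ Z]
    [LocallyConvexSpace ℝ Z] {g : F → Z} {dg : F × F → Z} {V : Set F} (hV : IsOpen V)
    (hg : ∀ x ∈ V, ∀ h : F,
      Tendsto (fun t : ℝ => t⁻¹ • (g (x + t • h) - g x)) (𝓝[≠] 0) (𝓝 (dg (x, h))))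
    (hdg : ContinuousOn dg (V ×ˢ univ))
    {ι : Type*} {l : Filter ι} {τ : ι → ℝ} {k : ι → F} {y k₀ : F} (hy : y ∈ V)
    (hτ : Tendsto τ l (𝓝[≠] 0)) (hk : Tendsto k l (𝓝 k₀)) :
    Tendsto (fun i => (τ i)⁻¹ • (g (y + τ i • k i) - g y)) l (𝓝 (dg (y, k₀))) := by
  refine tendsto_of_forall_closed_convex fun C hC hconv hcl => ?_
  have hopen : IsOpen (V ×ˢ (univ : Set F)) := hV.prod isOpen_univ
  have hcont : ContinuousAt dg (y, k₀) := hdg.continuousAt (hopen.mem_nhds ⟨hy, mem_univ _⟩)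
  -- compactness of `[0,1]` makes the whole segment of velocities lie in `C`
  have key : ∀ᶠ p : ℝ × F in 𝓝 ((0 : ℝ), k₀), ∀ r ∈ Icc (0 : ℝ) 1,
      y + (r * p.1) • p.2 ∈ V ∧ dg (y + (r * p.1) • p.2, p.2) ∈ C := by
    refine isCompact_Icc.eventually_forall_of_forall_eventually fun r _ => ?_
    have hc : ContinuousAt (fun z : (ℝ × F) × ℝ => (y + (z.2 * z.1.1) • z.1.2, z.1.2))
        (((0 : ℝ), k₀), r) := by fun_prop
    have hv : (fun z : (ℝ × F) × ℝ => (y + (z.2 * z.1.1) • z.1.2, z.1.2)) (((0 : ℝ), k₀), r)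
        = (y, k₀) := by simp
    have h1 := hc.tendsto.mono_right (le_of_eq (congrArg 𝓝 hv))
    filter_upwards [h1 (hopen.mem_nhds ⟨hy, mem_univ _⟩), h1 (hcont hC)] with z hz1 hz2
    exact ⟨hz1.1, hz2⟩
  have hτ0 : Tendsto τ l (𝓝 0) := hτ.mono_right nhdsWithin_le_nhds
  filter_upwards [(hτ0.prodMk_nhds hk).eventually key,
    hτ.eventually self_mem_nhdsWithin] with i hi hne
  have hne' : τ i ≠ 0 := hne
  have := sub_mem_of_forall_slope_tendsto (c := fun r => (τ i)⁻¹ • g (y + (r * τ i) • k i))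
    (c' := fun r => dg (y + (r * τ i) • k i, k i)) hconv hcl ?_ (fun r hr => (hi r hr).2)
  · simpa [smul_sub] using this
  · intro r hr
    have h2 := (tendsto_slope_of_directional (dg := dg) hne' (hg _ (hi r hr).1 (k i))).const_smul
      (τ i)⁻¹
    rw [smul_smul, inv_mul_cancel₀ hne', one_smul] at h2
    refine h2.congr fun s => ?_
    rw [smul_comm, ← smul_sub]
    congr 4
    rw [add_mul, add_smul, smul_smul, add_assoc]

end DirectionalDerivative

section LCContDiffOn

variable {F : Type v} [AddCommGroup F] [Module ℝ F] [TopologicalSpace F]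
  {E : Type u} [AddCommGroup E] [Module ℝ E] [TopologicalSpace E]

theorem LCContDiffOn.continuousOn {n : ℕ} {f : E → F} {U : Set E} (h : LCContDiffOn n f U) :
    ContinuousOn f U := by
  cases n with
  | zero => exact h
  | succ n => exact h.1

theorem LCContDiffOn.mono {n : ℕ} {f : E → F} {U U' : Set E} (h : LCContDiffOn n f U)
    (hU : U' ⊆ U) : LCContDiffOn n f U' := by
  induction n generalizing E with
  | zero => exact ContinuousOn.mono h hU
  | succ n ih =>
    obtain ⟨h1, df, h2, h3⟩ := h
    exact ⟨h1.mono hU, df, fun x hx => h2 x (hU hx), ih h3 (prod_mono hU subset_rfl)⟩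

theorem LCContDiffOn.of_succ {n : ℕ} {f : E → F} {U : Set E} (h : LCContDiffOn (n + 1) f U) :
    LCContDiffOn n f U := by
  induction n generalizing E with
  | zero => exact h.1
  | succ n ih =>
    obtain ⟨h1, df, h2, h3⟩ := h
    exact ⟨h1, df, h2, ih h3⟩

/-- The set `U` has to be open, because the difference quotients at a point involve all nearby
values. -/
theorem LCContDiffOn.congr [IsTopologicalAddGroup E] [ContinuousSMul ℝ E] {n : ℕ} {f g : E → F}
    {U : Set E} (hU : IsOpen U) (h : LCContDiffOn n f U) (hfg : EqOn g f U) :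
    LCContDiffOn n g U := by
  cases n with
  | zero => exact ContinuousOn.congr h hfg
  | succ n =>
    obtain ⟨h1, df, h2, h3⟩ := h
    refine ⟨h1.congr hfg, df, fun x hx k => ?_, h3⟩
    refine (h2 x hx k).congr' ?_
    filter_upwards [(eventually_add_smul_mem hU hx k).filter_mono nhdsWithin_le_nhds] with t ht
    rw [hfg ht, hfg hx]

/-- Being of class `C^n` is a local property. -/
theorem LCContDiffOn.of_locally [IsTopologicalAddGroup E] [ContinuousSMul ℝ E] [T2Space F]
    {n : ℕ} {f : E → F} {U : Set E} (hU : IsOpen U)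
    (h : ∀ x ∈ U, ∃ W, IsOpen W ∧ x ∈ W ∧ LCContDiffOn n f (U ∩ W)) : LCContDiffOn n f U := by
  classical
  induction n generalizing E with
  | zero =>
    intro x hx
    obtain ⟨W, hW, hxW, hc⟩ := h x hx
    exact ((ContinuousOn.continuousAt hc ((hU.inter hW).mem_nhds ⟨hx, hxW⟩))).continuousWithinAt
  | succ n ih =>
    choose! W hW hxW hc using h
    choose! df hdf hdf' using fun x hx => (hc x hx).2
    refine ⟨fun x hx => (((hc x hx).1.continuousAt ((hU.inter (hW x hx)).mem_nhds
      ⟨hx, hxW x hx⟩))).continuousWithinAt, fun p => df p.1 p, fun x hx k =>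
      hdf x hx x ⟨hx, hxW x hx⟩ k, ?_⟩
    refine ih (hU.prod isOpen_univ) fun p hp => ⟨W p.1 ×ˢ univ, (hW _ hp.1).prod isOpen_univ,
      ⟨hxW _ hp.1, mem_univ _⟩, ?_⟩
    have hO : IsOpen ((U ∩ W p.1) ×ˢ (univ : Set E)) :=
      (hU.inter (hW _ hp.1)).prod isOpen_univ
    have heq : U ×ˢ univ ∩ W p.1 ×ˢ univ = (U ∩ W p.1) ×ˢ (univ : Set E) := by
      rw [prod_inter_prod, inter_univ]
    rw [heq]
    refine (hdf' p.1 hp.1).congr hO fun q hq => ?_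
    exact tendsto_nhds_unique (hdf q.1 hq.1.1 q.1 ⟨hq.1.1, hxW _ hq.1.1⟩ q.2)
      (hdf p.1 hp.1 q.1 hq.1 q.2)

theorem LCContDiffOn.clm_comp {G : Type*} [AddCommGroup G] [Module ℝ G] [TopologicalSpace G]
    (L : F →L[ℝ] G) {n : ℕ} {f : E → F} {U : Set E} (h : LCContDiffOn n f U) :
    LCContDiffOn n (fun x => L (f x)) U := by
  induction n generalizing E with
  | zero => exact L.continuous.comp_continuousOn h
  | succ n ih =>
    obtain ⟨h1, df, h2, h3⟩ := h
    refine ⟨L.continuous.comp_continuousOn h1, fun p => L (df p), fun x hx k => ?_, ih h3⟩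
    refine ((L.continuous.tendsto _).comp (h2 x hx k)).congr fun t => ?_
    simp

theorem LCContDiffOn.comp_clm {E' : Type u} [AddCommGroup E'] [Module ℝ E'] [TopologicalSpace E']
    (L : E' →L[ℝ] E) {n : ℕ} {f : E → F} {U : Set E} (h : LCContDiffOn n f U) {U' : Set E'}
    (hm : MapsTo L U' U) :
    LCContDiffOn n (fun x => f (L x)) U' := by
  induction n generalizing E E' with
  | zero => exact ContinuousOn.comp h L.continuous.continuousOn hm
  | succ n ih =>
    obtain ⟨h1, df, h2, h3⟩ := h
    refine ⟨h1.comp L.continuous.continuousOn hm, fun p => df (L p.1, L p.2), fun x hx k => ?_,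
      ih (L.prodMap L) h3 fun p hp => ⟨hm hp.1, mem_univ _⟩⟩
    refine (h2 (L x) (hm hx) (L k)).congr fun t => ?_
    simp

theorem LCContDiffOn.prodMk {G : Type*} [AddCommGroup G] [Module ℝ G] [TopologicalSpace G]
    {n : ℕ} {f : E → F} {g : E → G} {U : Set E} (hf : LCContDiffOn n f U)
    (hg : LCContDiffOn n g U) : LCContDiffOn n (fun x => (f x, g x)) U := by
  induction n generalizing E with
  | zero => exact ContinuousOn.prodMk hf hg
  | succ n ih =>
    obtain ⟨h1, df, h2, h3⟩ := hf
    obtain ⟨k1, dg, k2, k3⟩ := hg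
    exact ⟨h1.prodMk k1, fun p => (df p, dg p), fun x hx k =>
      ((h2 x hx k).prodMk_nhds (k2 x hx k)).congr fun t => rfl, ih h3 k3⟩

theorem LCContDiffOn.const (n : ℕ) (c : F) (U : Set E) : LCContDiffOn n (fun _ : E => c) U := by
  induction n generalizing E c with
  | zero => exact continuousOn_const
  | succ n ih =>
    exact ⟨continuousOn_const, fun _ => 0, fun x _ k => by simp [tendsto_const_nhds],
      ih 0 _⟩

theorem ContinuousLinearMap.lcContDiffOn (L : E →L[ℝ] F) (n : ℕ) (U : Set E) :
    LCContDiffOn n (fun x => L x) U := by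
  cases n with
  | zero => exact L.continuous.continuousOn
  | succ n =>
    refine ⟨L.continuous.continuousOn, fun p => L p.2, fun x _ k => ?_, ?_⟩
    · refine tendsto_const_nhds.congr' ?_
      filter_upwards [self_mem_nhdsWithin] with t ht
      have : t ≠ 0 := ht
      simp [smul_smul, this]
    · induction n generalizing E with
      | zero => exact (L.continuous.comp continuous_snd).continuousOn
      | succ n ih =>
        refine ⟨(L.continuous.comp continuous_snd).continuousOn, fun p => L p.2.2,
          fun x _ k => ?_, ?_⟩
        · refine tendsto_const_nhds.congr' ?_
          filter_upwards [self_mem_nhdsWithin] with t ht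
          have : t ≠ 0 := ht
          simp [smul_smul, this]
        · exact (ih (E := E × E) (L.comp (ContinuousLinearMap.snd ℝ E E)) (U ×ˢ univ))

theorem LCContDiffOn.add [IsTopologicalAddGroup F] {n : ℕ} {f g : E → F} {U : Set E}
    (hf : LCContDiffOn n f U) (hg : LCContDiffOn n g U) :
    LCContDiffOn n (fun x => f x + g x) U :=
  (hf.prodMk hg).clm_comp (ContinuousLinearMap.fst ℝ F F + ContinuousLinearMap.snd ℝ F F)

theorem LCContDiffOn.neg [IsTopologicalAddGroup F] {n : ℕ} {f : E → F} {U : Set E}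
    (hf : LCContDiffOn n f U) : LCContDiffOn n (fun x => -f x) U :=
  hf.clm_comp (-ContinuousLinearMap.id ℝ F)

theorem LCContDiffOn.sub [IsTopologicalAddGroup F] {n : ℕ} {f g : E → F} {U : Set E}
    (hf : LCContDiffOn n f U) (hg : LCContDiffOn n g U) :
    LCContDiffOn n (fun x => f x - g x) U := by
  simpa only [sub_eq_add_neg] using hf.add hg.neg

/-- A jointly continuous bilinear map is smooth. -/
theorem lcContDiffOn_of_bilinear {E₁ E₂ : Type u}
    [AddCommGroup E₁] [Module ℝ E₁] [TopologicalSpace E₁] [IsTopologicalAddGroup E₁]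
    [ContinuousSMul ℝ E₁]
    [AddCommGroup E₂] [Module ℝ E₂] [TopologicalSpace E₂] [IsTopologicalAddGroup E₂]
    [ContinuousSMul ℝ E₂] [IsTopologicalAddGroup F] [ContinuousSMul ℝ F]
    (b : E₁ →ₗ[ℝ] E₂ →ₗ[ℝ] F) (hb : Continuous fun p : E₁ × E₂ => b p.1 p.2) (n : ℕ) (U) :
    LCContDiffOn n (fun p : E₁ × E₂ => b p.1 p.2) U := by
  suffices h : LCContDiffOn n (fun p : E₁ × E₂ => b p.1 p.2) univ from h.mono (subset_univ _)
  induction n with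
  | zero => exact hb.continuousOn
  | succ n ih =>
    refine ⟨hb.continuousOn, fun q => b q.1.1 q.2.2 + b q.2.1 q.1.2, fun x _ k => ?_, ?_⟩
    · have h1 : Tendsto (fun t : ℝ => (b x.1 k.2 + b k.1 x.2) + t • b k.1 k.2) (𝓝[≠] 0)
          (𝓝 ((b x.1 k.2 + b k.1 x.2) + (0 : ℝ) • b k.1 k.2)) := by
        have : Continuous fun t : ℝ => (b x.1 k.2 + b k.1 x.2) + t • b k.1 k.2 := by fun_prop
        exact (this.tendsto 0).mono_left nhdsWithin_le_nhds
      rw [zero_smul, add_zero] at h1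
      refine h1.congr' ?_
      filter_upwards [self_mem_nhdsWithin] with t ht
      have ht' : t ≠ 0 := ht
      simp only [Prod.fst_add, Prod.snd_add, Prod.smul_fst, Prod.smul_snd, map_add, map_smul,
        LinearMap.add_apply, LinearMap.smul_apply, smul_add, smul_sub, smul_smul]
      simp only [← mul_assoc, inv_mul_cancel₀ ht', one_mul, one_smul]
      abel
    · let A : (E₁ × E₂) × (E₁ × E₂) →L[ℝ] E₁ × E₂ :=
        ((ContinuousLinearMap.fst ℝ E₁ E₂).comp (ContinuousLinearMap.fst ℝ _ _)).prod
          ((ContinuousLinearMap.snd ℝ E₁ E₂).comp (ContinuousLinearMap.snd ℝ _ _))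
      let A' : (E₁ × E₂) × (E₁ × E₂) →L[ℝ] E₁ × E₂ :=
        ((ContinuousLinearMap.fst ℝ E₁ E₂).comp (ContinuousLinearMap.snd ℝ _ _)).prod
          ((ContinuousLinearMap.snd ℝ E₁ E₂).comp (ContinuousLinearMap.fst ℝ _ _))
      exact (ih.comp_clm A (mapsTo_univ _ _)).add (ih.comp_clm A' (mapsTo_univ _ _))

/-- The chain rule. -/
theorem LCContDiffOn.comp [IsTopologicalAddGroup F] [ContinuousSMul ℝ F]
    {Z : Type*} [AddCommGroup Z] [Module ℝ Z] [TopologicalSpace Z]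
    [IsTopologicalAddGroup Z] [ContinuousSMul ℝ Z] [LocallyConvexSpace ℝ Z]
    {n : ℕ} {g : F → Z} {f : E → F} {V : Set F} {U : Set E} (hV : IsOpen V)
    (hg : LCContDiffOn n g V) (hf : LCContDiffOn n f U) (hm : MapsTo f U V) :
    LCContDiffOn n (fun x => g (f x)) U := by
  induction n generalizing E F with
  | zero => exact ContinuousOn.comp hg hf hm
  | succ n ih =>
    have hf' := hf.of_succ
    obtain ⟨h1, df, h2, h3⟩ := hf
    obtain ⟨k1, dg, k2, k3⟩ := hg
    refine ⟨k1.comp h1 hm, fun p => dg (f p.1, df p), fun x hx k => ?_, ?_⟩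
    · refine (tendsto_slope_of_continuousOn_directional hV k2 k3.continuousOn (hm hx)
        tendsto_id (h2 x hx k)).congr' ?_
      filter_upwards [self_mem_nhdsWithin] with t ht
      have ht' : t ≠ 0 := ht
      simp [smul_smul, ht']
    · refine ih (hV.prod isOpen_univ) k3 (?_ : LCContDiffOn n (fun p => (f p.1, df p)) _)
        fun p hp => ⟨hm hp.1, mem_univ _⟩
      exact (hf'.comp_clm (ContinuousLinearMap.fst ℝ E E) (fun p hp => hp.1)).prodMk h3

/-- On an open subset of a normed space, `C^n` maps in the Fréchet sense are `C^n` in the sense of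
Bastiani. -/
theorem ContDiffOn.lcContDiffOn {E : Type u} [NormedAddCommGroup E] [NormedSpace ℝ E]
    {F : Type v} [NormedAddCommGroup F] [NormedSpace ℝ F] {n : ℕ} {f : E → F} {U : Set E}
    (hU : IsOpen U) (h : ContDiffOn ℝ n f U) : LCContDiffOn n f U := by
  induction n generalizing E with
  | zero => exact h.continuousOn
  | succ n ih =>
    refine ⟨h.continuousOn, fun p => fderiv ℝ f p.1 p.2, fun x hx k => ?_, ?_⟩
    · have hd : DifferentiableAt ℝ f x :=
        (h.contDiffAt (hU.mem_nhds hx)).differentiableAt (by simp)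
      have := hd.hasFDerivAt.hasLineDerivAt k
      rw [HasLineDerivAt, hasDerivAt_iff_tendsto_slope_zero] at this
      simpa using this
    · refine ih (hU.prod isOpen_univ) ?_
      have h1 : ContDiffOn ℝ n (fderiv ℝ f) U := h.fderiv_of_isOpen hU (by simp)
      exact (h1.comp contDiffOn_fst fun p hp => hp.1).clm_apply contDiffOn_snd

theorem ContDiffOn.lcSmoothOn {E : Type u} [NormedAddCommGroup E] [NormedSpace ℝ E]
    {F : Type v} [NormedAddCommGroup F] [NormedSpace ℝ F] {f : E → F} {U : Set E}
    (hU : IsOpen U) (h : ContDiffOn ℝ ∞ f U) : LCSmoothOn f U :=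
  fun _ => ContDiffOn.lcContDiffOn hU (h.of_le (by exact_mod_cast le_top))

end LCContDiffOn

section Curves

variable {F : Type v} [AddCommGroup F] [Module ℝ F] [TopologicalSpace F]

/-- The curve `c : [0,1] → F` is of class `C^n` on the relatively open set `s ⊆ [0,1]`. -/
def CurveContDiffOn : ℕ → (unitInterval → F) → Set unitInterval → Prop
  | 0, c, s => ContinuousOn c s
  | n + 1, c, s => ContinuousOn c s ∧ ∃ c' : unitInterval → F,
      (∀ t ∈ s, HasCurveDerivAt c t (c' t)) ∧ CurveContDiffOn n c' s

theorem tendsto_unitInterval_sub (t : unitInterval) :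
    Tendsto (fun s : unitInterval => (s : ℝ) - t) (𝓝[≠] t) (𝓝[≠] 0) := by
  refine tendsto_nhdsWithin_iff.2 ⟨?_, ?_⟩
  · have : Continuous fun s : unitInterval => (s : ℝ) - t := by fun_prop
    have h := this.tendsto t
    rw [sub_self] at h
    exact h.mono_left nhdsWithin_le_nhds
  · filter_upwards [self_mem_nhdsWithin] with s hs
    exact sub_ne_zero.2 fun h => hs (Subtype.ext h)

theorem CurveContDiffOn.continuousOn {n : ℕ} {c : unitInterval → F} {s : Set unitInterval}
    (h : CurveContDiffOn n c s) : ContinuousOn c s := by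
  cases n with
  | zero => exact h
  | succ n => exact h.1

theorem CurveContDiffOn.of_succ {n : ℕ} {c : unitInterval → F} {s : Set unitInterval}
    (h : CurveContDiffOn (n + 1) c s) : CurveContDiffOn n c s := by
  induction n generalizing c with
  | zero => exact h.1
  | succ n ih =>
    obtain ⟨h1, c', h2, h3⟩ := h
    exact ⟨h1, c', h2, ih h3⟩

theorem HasCurveDerivAt.congr {c d : unitInterval → F} {s : Set unitInterval} (hs : IsOpen s)
    {t : unitInterval} (ht : t ∈ s) {w : F} (h : HasCurveDerivAt c t w) (hcd : EqOn d c s) :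
    HasCurveDerivAt d t w := by
  refine Tendsto.congr' ?_ h
  filter_upwards [nhdsWithin_le_nhds (hs.mem_nhds ht)] with r hr
  rw [hcd hr, hcd ht]

theorem CurveContDiffOn.congr {n : ℕ} {c d : unitInterval → F} {s : Set unitInterval}
    (hs : IsOpen s) (h : CurveContDiffOn n c s) (hcd : EqOn d c s) : CurveContDiffOn n d s := by
  cases n with
  | zero => exact ContinuousOn.congr h hcd
  | succ n =>
    obtain ⟨h1, c', h2, h3⟩ := h
    exact ⟨h1.congr hcd, c', fun t ht => (h2 t ht).congr hs ht hcd, h3⟩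

theorem CurveContDiffOn.mono {n : ℕ} {c : unitInterval → F} {s s' : Set unitInterval}
    (h : CurveContDiffOn n c s) (hs : s' ⊆ s) : CurveContDiffOn n c s' := by
  induction n generalizing c with
  | zero => exact ContinuousOn.mono h hs
  | succ n ih =>
    obtain ⟨h1, c', h2, h3⟩ := h
    exact ⟨h1.mono hs, c', fun t ht => h2 t (hs ht), ih h3⟩

theorem HasCurveDerivAt.unique [T2Space F] {c : unitInterval → F} {t : unitInterval} {w w' : F}
    (h : HasCurveDerivAt c t w) (h' : HasCurveDerivAt c t w') : w = w' :=
  tendsto_nhds_unique h h'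

/-- The successive derivatives of a curve that is `C^n` for all `n` fit together to one sequence,
since derivatives are unique. -/
theorem CurveContDiffOn.smoothCurveOn [T2Space F] {c : unitInterval → F} {s : Set unitInterval}
    (hs : IsOpen s) (h : ∀ n, CurveContDiffOn n c s) : SmoothCurveOn c s := by
  classical
  let der : (unitInterval → F) → unitInterval → F := fun c t =>
    if h : ∃ w, HasCurveDerivAt c t w then h.choose else 0
  have hder : ∀ (c : unitInterval → F) t w, HasCurveDerivAt c t w → der c t = w := by
    intro c t w hw
    have hex : ∃ w, HasCurveDerivAt c t w := ⟨w, hw⟩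
    simp only [der, dif_pos hex]
    exact hex.choose_spec.unique hw
  have key : ∀ n m, CurveContDiffOn m (der^[n] c) s := by
    intro n
    induction n with
    | zero => exact h
    | succ n ih =>
      intro m
      obtain ⟨_, c', h2, h3⟩ := ih (m + 1)
      rw [Function.iterate_succ_apply']
      exact h3.congr hs fun t ht => hder _ _ _ (h2 t ht)
  refine ⟨fun n => der^[n] c, fun _ _ => rfl, fun n => ⟨key n 0, fun t ht => ?_⟩⟩
  obtain ⟨_, c', h2, _⟩ := key n 1
  simp only [Function.iterate_succ_apply']
  rw [hder _ _ _ (h2 t ht)]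
  exact h2 t ht

theorem HasCurveDerivAt.prodMk {G : Type*} [AddCommGroup G] [Module ℝ G] [TopologicalSpace G]
    {c : unitInterval → F} {d : unitInterval → G} {t : unitInterval} {w : F} {w' : G}
    (h : HasCurveDerivAt c t w) (h' : HasCurveDerivAt d t w') :
    HasCurveDerivAt (fun s => (c s, d s)) t (w, w') :=
  (Tendsto.prodMk_nhds h h').congr fun _ => rfl

theorem CurveContDiffOn.prodMk {G : Type*} [AddCommGroup G] [Module ℝ G] [TopologicalSpace G]
    {n : ℕ} {c : unitInterval → F} {d : unitInterval → G} {s : Set unitInterval}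
    (h : CurveContDiffOn n c s) (h' : CurveContDiffOn n d s) :
    CurveContDiffOn n (fun t => (c t, d t)) s := by
  induction n generalizing c d with
  | zero => exact ContinuousOn.prodMk h h'
  | succ n ih =>
    obtain ⟨h1, c', h2, h3⟩ := h
    obtain ⟨k1, d', k2, k3⟩ := h'
    exact ⟨h1.prodMk k1, fun t => (c' t, d' t), fun t ht => (h2 t ht).prodMk (k2 t ht), ih h3 k3⟩

theorem HasCurveDerivAt.clm_comp {G : Type*} [AddCommGroup G] [Module ℝ G] [TopologicalSpace G]
    (L : F →L[ℝ] G) {c : unitInterval → F} {t : unitInterval} {w : F}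
    (h : HasCurveDerivAt c t w) : HasCurveDerivAt (fun s => L (c s)) t (L w) := by
  refine ((L.continuous.tendsto _).comp h).congr fun s => ?_
  simp

/-- The chain rule for a curve followed by a map with continuous directional derivatives. -/
theorem HasCurveDerivAt.comp [IsTopologicalAddGroup F] [ContinuousSMul ℝ F]
    {Z : Type*} [AddCommGroup Z] [Module ℝ Z] [TopologicalSpace Z]
    [IsTopologicalAddGroup Z] [ContinuousSMul ℝ Z] [LocallyConvexSpace ℝ Z]
    {g : F → Z} {dg : F × F → Z} {V : Set F} (hV : IsOpen V)
    (hg : ∀ x ∈ V, ∀ h : F,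
      Tendsto (fun t : ℝ => t⁻¹ • (g (x + t • h) - g x)) (𝓝[≠] 0) (𝓝 (dg (x, h))))
    (hdg : ContinuousOn dg (V ×ˢ univ)) {c : unitInterval → F} {t : unitInterval} {w : F}
    (h : HasCurveDerivAt c t w) (ht : c t ∈ V) :
    HasCurveDerivAt (fun s => g (c s)) t (dg (c t, w)) := by
  refine (tendsto_slope_of_continuousOn_directional hV hg hdg ht
    (tendsto_unitInterval_sub t) h).congr' ?_
  filter_upwards [(tendsto_unitInterval_sub t).eventually self_mem_nhdsWithin] with s hs
  have hs' : (s : ℝ) - t ≠ 0 := hs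
  simp [smul_smul, hs']

/-- The composition of a `C^n` curve with a `C^n` map is a `C^n` curve. -/
theorem LCContDiffOn.comp_curve [IsTopologicalAddGroup F] [ContinuousSMul ℝ F]
    {Z : Type*} [AddCommGroup Z] [Module ℝ Z] [TopologicalSpace Z]
    [IsTopologicalAddGroup Z] [ContinuousSMul ℝ Z] [LocallyConvexSpace ℝ Z]
    {n : ℕ} {g : F → Z} {c : unitInterval → F} {V : Set F} {s : Set unitInterval} (hV : IsOpen V)
    (hg : LCContDiffOn n g V) (hc : CurveContDiffOn n c s) (hm : MapsTo c s V) :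
    CurveContDiffOn n (fun t => g (c t)) s := by
  induction n generalizing F with
  | zero => exact ContinuousOn.comp hg hc hm
  | succ n ih =>
    have hc' := hc.of_succ
    obtain ⟨h1, c', h2, h3⟩ := hc
    obtain ⟨k1, dg, k2, k3⟩ := hg
    refine ⟨k1.comp h1 hm, fun t => dg (c t, c' t), fun t ht => ?_, ?_⟩
    · exact (h2 t ht).comp hV k2 k3.continuousOn (hm ht)
    · exact ih (hV.prod isOpen_univ) k3 (hc'.prodMk h3) fun t ht => ⟨hm ht, mem_univ _⟩

/-- The chain rule for a curve in a normed space followed by a Fréchet differentiable map. -/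
theorem HasFDerivAt.comp_hasCurveDerivAt {F Z : Type*} [NormedAddCommGroup F] [NormedSpace ℝ F]
    [NormedAddCommGroup Z] [NormedSpace ℝ Z] {g : F → Z} {g' : F →L[ℝ] Z} {c : unitInterval → F}
    {t : unitInterval} {w : F} (hg : HasFDerivAt g g' (c t)) (h : HasCurveDerivAt c t w) :
    HasCurveDerivAt (fun s => g (c s)) t (g' w) := by
  have h0 := (tendsto_unitInterval_sub t)
  have hne := h0.eventually self_mem_nhdsWithin
  have hlim := h0.mono_right nhdsWithin_le_nhds
  have := (hasFDerivWithinAt_univ.2 hg).lim (l := 𝓝[≠] t) (c := fun s => ((s : ℝ) - t)⁻¹)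
    (d := fun s => c s - c t) ?_ (Eventually.of_forall fun _ => mem_univ _) h
  · simpa [HasCurveDerivAt] using this
  · have h1 : Tendsto (fun s : unitInterval => ((s : ℝ) - t) • (((s : ℝ) - t)⁻¹ • (c s - c t)))
      (𝓝[≠] t) (𝓝 ((0 : ℝ) • w)) := hlim.smul h
    rw [zero_smul] at h1
    refine h1.congr' ?_
    filter_upwards [hne] with s hs
    rw [smul_inv_smul₀ hs]

end Curves

/-! ### Charts of a Lie group and the Maurer–Cartan form -/

section ChartCalculus

variable {E : Type*} [NormedAddCommGroup E] [NormedSpace ℝ E]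
  {H : Type*} [TopologicalSpace H] [ChartedSpace E H]

theorem contMDiffOn_atlas_symm [IsManifold 𝓘(ℝ, E) ∞ H] {e : OpenPartialHomeomorph H E}
    (he : e ∈ atlas E H) : ContMDiffOn 𝓘(ℝ, E) 𝓘(ℝ, E) ∞ e.symm e.target :=
  contMDiffOn_symm_of_mem_maximalAtlas (IsManifold.subset_maximalAtlas he)

theorem contMDiffOn_atlas [IsManifold 𝓘(ℝ, E) ∞ H] {e : OpenPartialHomeomorph H E}
    (he : e ∈ atlas E H) : ContMDiffOn 𝓘(ℝ, E) 𝓘(ℝ, E) ∞ e e.source :=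
  contMDiffOn_of_mem_maximalAtlas (IsManifold.subset_maximalAtlas he)

/-- A smooth map from an open subset of a normed space to a manifold is smooth in a chart. -/
theorem ContMDiffOn.contDiffOn_chart [IsManifold 𝓘(ℝ, E) ∞ H] {W : Type*} [NormedAddCommGroup W]
    [NormedSpace ℝ W] {F : W → H} {Ω : Set W} (hF : ContMDiffOn 𝓘(ℝ, W) 𝓘(ℝ, E) ∞ F Ω)
    {e : OpenPartialHomeomorph H E} (he : e ∈ atlas E H) :
    ContDiffOn ℝ ∞ (fun x => e (F x)) (Ω ∩ F ⁻¹' e.source) := by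
  rw [← contMDiffOn_iff_contDiffOn]
  exact (contMDiffOn_atlas he).comp (hF.mono inter_subset_left) fun x hx => hx.2

theorem ContMDiffOn.comp_fst_atlas_symm [IsManifold 𝓘(ℝ, E) ∞ H] {W : Type*}
    [NormedAddCommGroup W] [NormedSpace ℝ W] {g : W → E} {Ω : Set W} (hg : ContDiffOn ℝ ∞ g Ω)
    {e : OpenPartialHomeomorph H E} (he : e ∈ atlas E H) (hm : MapsTo g Ω e.target) :
    ContMDiffOn 𝓘(ℝ, W) 𝓘(ℝ, E) ∞ (fun x => e.symm (g x)) Ω :=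
  (contMDiffOn_atlas_symm he).comp hg.contMDiffOn hm

/-- The partial derivative of a smooth map in the second variable is smooth in the first one. -/
theorem ContDiffOn.partial_fderiv {E₁ E₂ E₃ : Type*} [NormedAddCommGroup E₁] [NormedSpace ℝ E₁]
    [NormedAddCommGroup E₂] [NormedSpace ℝ E₂] [NormedAddCommGroup E₃] [NormedSpace ℝ E₃]
    {F : E₁ × E₂ → E₃} {Ω : Set (E₁ × E₂)} (hΩ : IsOpen Ω) (hF : ContDiffOn ℝ ∞ F Ω)
    {z : E₁ → E₂} {U : Set E₁} (hz : ContDiffOn ℝ ∞ z U) (hm : ∀ y ∈ U, (y, z y) ∈ Ω) :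
    ContDiffOn ℝ ∞ (fun y => fderiv ℝ (fun w => F (y, w)) (z y)) U := by
  have h1 : ContDiffOn ℝ ∞ (fun y => fderiv ℝ F (y, z y)) U :=
    (hF.fderiv_of_isOpen hΩ (m := ∞) (by simp)).comp (contDiffOn_id.prodMk hz) hm
  have h2 : ContDiffOn ℝ ∞
      (fun y => (fderiv ℝ F (y, z y)).comp (ContinuousLinearMap.inr ℝ E₁ E₂)) U :=
    h1.clm_comp contDiffOn_const
  refine h2.congr fun y hy => ?_
  have hd : HasFDerivAt F (fderiv ℝ F (y, z y)) (y, z y) :=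
    ((hF.contDiffAt (hΩ.mem_nhds (hm y hy))).differentiableAt (by simp)).hasFDerivAt
  exact (hd.comp (z y) (hasFDerivAt_prodMk_right y (z y))).fderiv

end ChartCalculus

section LieChart

variable {E : Type*} [NormedAddCommGroup E] [NormedSpace ℝ E]
  {H : Type*} [Group H] [TopologicalSpace H] [ChartedSpace E H]

/-- The logarithmic derivative (Maurer–Cartan form) read in a chart `e`: the derivative at `y` of
`y' ↦ e(y)⁻¹ e(y')`, with `T₁H` identified with `E` by the preferred chart at `1`. -/
noncomputable def maurerCartan (e : OpenPartialHomeomorph H E) (y : E) : E →L[ℝ] E :=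
  fderiv ℝ (fun y' => chartAt E (1 : H) ((e.symm y)⁻¹ * e.symm y')) y

/-- The adjoint action of `h⁻¹` on `T₁H = E`, the derivative of `g ↦ h⁻¹ g h` at `1`. -/
noncomputable def adInv (E : Type*) [NormedAddCommGroup E] [NormedSpace ℝ E]
    {H : Type*} [Group H] [TopologicalSpace H] [ChartedSpace E H] (h : H) : E →L[ℝ] E :=
  fderiv ℝ (fun z => chartAt E (1 : H) (h⁻¹ * (chartAt E (1 : H)).symm z * h))
    (chartAt E (1 : H) 1)

theorem chartAt_one_mem_target : chartAt E (1 : H) 1 ∈ (chartAt E (1 : H)).target :=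
  (chartAt E (1 : H)).map_source (mem_chart_source E 1)

@[simp]
theorem chartAt_one_symm_apply : (chartAt E (1 : H)).symm (chartAt E (1 : H) 1) = 1 :=
  (chartAt E (1 : H)).left_inv (mem_chart_source E 1)

variable [LieGroup 𝓘(ℝ, E) ∞ H] [IsTopologicalGroup H]

/-- The domain on which `(y, y') ↦ e(y)⁻¹ e(y')` can be read in the preferred chart at `1`. -/
theorem isOpen_maurerCartan_domain (e : OpenPartialHomeomorph H E) :
    IsOpen {p : E × E | (p.1 ∈ e.target ∧ p.2 ∈ e.target) ∧
      (e.symm p.1)⁻¹ * e.symm p.2 ∈ (chartAt E (1 : H)).source} := by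
  have h1 : IsOpen (e.target ×ˢ e.target) := e.open_target.prod e.open_target
  have h2 : ContinuousOn (fun p : E × E => (e.symm p.1)⁻¹ * e.symm p.2) (e.target ×ˢ e.target) :=
    ((e.continuousOn_symm.comp continuousOn_fst fun p hp => hp.1).inv).mul
      (e.continuousOn_symm.comp continuousOn_snd fun p hp => hp.2)
  exact h2.isOpen_inter_preimage h1 (chartAt E (1 : H)).open_source

omit [IsTopologicalGroup H] in
theorem contDiffOn_inv_mul_chart {e : OpenPartialHomeomorph H E} (he : e ∈ atlas E H) :
    ContDiffOn ℝ ∞ (fun p : E × E => chartAt E (1 : H) ((e.symm p.1)⁻¹ * e.symm p.2))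
      {p : E × E | (p.1 ∈ e.target ∧ p.2 ∈ e.target) ∧
        (e.symm p.1)⁻¹ * e.symm p.2 ∈ (chartAt E (1 : H)).source} := by
  have h1 : ContMDiffOn 𝓘(ℝ, E × E) 𝓘(ℝ, E) ∞ (fun p : E × E => (e.symm p.1)⁻¹ * e.symm p.2)
      (e.target ×ˢ e.target) :=
    (ContMDiffOn.comp_fst_atlas_symm contDiffOn_fst he fun p hp => hp.1).inv.mul
      (ContMDiffOn.comp_fst_atlas_symm contDiffOn_snd he fun p hp => hp.2)
  exact h1.contDiffOn_chart (chart_mem_atlas E 1)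

theorem contDiffOn_maurerCartan {e : OpenPartialHomeomorph H E} (he : e ∈ atlas E H) :
    ContDiffOn ℝ ∞ (maurerCartan e) e.target := by
  refine ContDiffOn.partial_fderiv (isOpen_maurerCartan_domain e) (contDiffOn_inv_mul_chart he)
    contDiffOn_id fun y hy => ⟨⟨hy, hy⟩, ?_⟩
  simp

theorem hasFDerivAt_maurerCartan {e : OpenPartialHomeomorph H E} (he : e ∈ atlas E H) {y : E}
    (hy : y ∈ e.target) : HasFDerivAt
      (fun y' => chartAt E (1 : H) ((e.symm y)⁻¹ * e.symm y')) (maurerCartan e y) y := by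
  have h1 := (contDiffOn_inv_mul_chart he).contDiffAt
    ((isOpen_maurerCartan_domain e).mem_nhds (x := (y, y)) ⟨⟨hy, hy⟩, by simp⟩)
  have h2 : DifferentiableAt ℝ (fun y' => chartAt E (1 : H) ((e.symm y)⁻¹ * e.symm y')) y :=
    (h1.differentiableAt (by simp)).comp y (f := fun y' => (y, y'))
      (hasFDerivAt_prodMk_right y y).differentiableAt
  exact h2.hasFDerivAt

theorem contDiffOn_conj_chart (h : H) : ∃ U : Set E, IsOpen U ∧ chartAt E (1 : H) 1 ∈ U ∧
    ContDiffOn ℝ ∞ (fun z => chartAt E (1 : H) (h⁻¹ * (chartAt E (1 : H)).symm z * h)) U := by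
  have h1 : ContMDiffOn 𝓘(ℝ, E) 𝓘(ℝ, E) ∞
      (fun z => h⁻¹ * (chartAt E (1 : H)).symm z * h) (chartAt E (1 : H)).target :=
    (contMDiffOn_const.mul (contMDiffOn_atlas_symm (chart_mem_atlas E 1))).mul contMDiffOn_const
  refine ⟨_, ?_, ?_, h1.contDiffOn_chart (chart_mem_atlas E 1)⟩
  · exact h1.continuousOn.isOpen_inter_preimage (chartAt E (1 : H)).open_target
      (chartAt E (1 : H)).open_source
  · exact ⟨chartAt_one_mem_target, by simp⟩

theorem hasFDerivAt_adInv (h : H) : HasFDerivAt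
    (fun z => chartAt E (1 : H) (h⁻¹ * (chartAt E (1 : H)).symm z * h)) (adInv E h)
    (chartAt E (1 : H) 1) := by
  obtain ⟨U, hU, h1, h2⟩ := contDiffOn_conj_chart (E := E) h
  exact ((h2.contDiffAt (hU.mem_nhds h1)).differentiableAt (by simp)).hasFDerivAt

theorem continuous_adInv : Continuous (adInv E : H → E →L[ℝ] E) := by
  rw [continuous_iff_continuousAt]
  intro h
  set e := chartAt E h
  set c := chartAt E (1 : H)
  have h1 : ContMDiffOn 𝓘(ℝ, E × E) 𝓘(ℝ, E) ∞
      (fun p : E × E => (e.symm p.1)⁻¹ * c.symm p.2 * e.symm p.1) (e.target ×ˢ c.target) :=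
    ((ContMDiffOn.comp_fst_atlas_symm contDiffOn_fst (chart_mem_atlas E h) fun p hp => hp.1).inv.mul
      (ContMDiffOn.comp_fst_atlas_symm contDiffOn_snd (chart_mem_atlas E 1) fun p hp => hp.2)).mul
      (ContMDiffOn.comp_fst_atlas_symm contDiffOn_fst (chart_mem_atlas E h) fun p hp => hp.1)
  have h2 := h1.contDiffOn_chart (chart_mem_atlas E (1 : H))
  have ho := h1.continuousOn.isOpen_inter_preimage (e.open_target.prod c.open_target) c.open_source
  have h3 : ContDiffOn ℝ ∞ (fun y => fderiv ℝ (fun w => c ((e.symm y)⁻¹ * c.symm w * e.symm y))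
      (c 1)) e.target :=
    ContDiffOn.partial_fderiv ho h2 contDiffOn_const fun y hy =>
      ⟨⟨hy, chartAt_one_mem_target⟩, by simp [c]⟩
  have h4 : ContinuousOn (fun x => fderiv ℝ (fun w => c ((e.symm (e x))⁻¹ * c.symm w * e.symm (e x)))
      (c 1)) e.source := h3.continuousOn.comp e.continuousOn e.mapsTo
  refine (h4.congr fun x hx => ?_).continuousAt (e.open_source.mem_nhds (mem_chart_source E h))
  rw [e.left_inv hx]
  rfl

end LieChart

/-! ### The space of smooth functions on a Lie group -/

theorem ContinuousMap.isUniformAddGroup {X : Type*} [TopologicalSpace X] :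
    IsUniformAddGroup C(X, ℝ) := by
  let f : C(X, ℝ) →+ UniformOnFun X ℝ {K | IsCompact K} :=
    { toFun := ContinuousMap.toUniformOnFunIsCompact
      map_zero' := rfl
      map_add' := fun _ _ => rfl }
  exact (ContinuousMap.isUniformEmbedding_toUniformOnFunIsCompact (α := X)
    (β := ℝ)).isUniformInducing.isUniformAddGroup f

section SmoothFun

variable (E : Type*) [NormedAddCommGroup E] [NormedSpace ℝ E] [FiniteDimensional ℝ E]

/-- The coordinates with respect to a fixed basis of the model space. -/
noncomputable def modelCoord (i : Fin (Module.finrank ℝ E)) : E →L[ℝ] ℝ :=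
  LinearMap.toContinuousLinearMap ((Module.finBasis ℝ E).coord i)

variable {E}

theorem modelCoord_basis (i j : Fin (Module.finrank ℝ E)) :
    modelCoord E i (Module.finBasis ℝ E j) = if j = i then 1 else 0 := by
  simp [modelCoord, Finsupp.single_apply]

theorem sum_smul_modelCoord_basis (a : Fin (Module.finrank ℝ E) → ℝ)
    (j : Fin (Module.finrank ℝ E)) :
    (∑ i, a i • modelCoord E i) (Module.finBasis ℝ E j) = a j := by
  simp [modelCoord_basis]

theorem sum_apply_basis_smul_modelCoord (L : E →L[ℝ] ℝ) :
    ∑ i, L (Module.finBasis ℝ E i) • modelCoord E i = L := by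
  refine ContinuousLinearMap.coe_injective ((Module.finBasis ℝ E).ext fun j => ?_)
  exact sum_smul_modelCoord_basis _ j

variable (E)
variable (H : Type*) [Group H] [TopologicalSpace H] [ChartedSpace E H]

/-- The space of smooth real functions on the Lie group `H`. A function is recorded together with
its iterated derivatives along left-invariant vector fields: the entry at `i :: α` is the derivative
of the entry at `α` along the left-invariant vector field of the `i`-th basis vector of `T₁H = E`.
The topology is that of uniform convergence on compact sets of all these derivatives. -/
noncomputable def SmoothFun : Submodule ℝ (List (Fin (Module.finrank ℝ E)) → C(H, ℝ)) where
  carrier := {v | ∀ α x, HasFDerivAt (fun z => v α (x * (chartAt E (1 : H)).symm z))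
    (∑ i, v (i :: α) x • modelCoord E i) (chartAt E (1 : H) 1)}
  zero_mem' := by
    intro α x
    simpa using hasFDerivAt_const (𝕜 := ℝ) (0 : ℝ) (chartAt E (1 : H) 1)
  add_mem' := by
    intro v w hv hw α x
    simp only [Pi.add_apply, ContinuousMap.add_apply, add_smul, Finset.sum_add_distrib]
    exact (hv α x).add (hw α x)
  smul_mem' := by
    intro r v hv α x
    simp only [Pi.smul_apply, ContinuousMap.smul_apply, smul_assoc, ← Finset.smul_sum]
    exact (hv α x).const_smul r

variable {E H}

namespace SmoothFun

instance : IsUniformAddGroup (SmoothFun E H) := by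
  have : IsUniformAddGroup C(H, ℝ) := ContinuousMap.isUniformAddGroup
  have : IsUniformAddGroup (List (Fin (Module.finrank ℝ E)) → C(H, ℝ)) := inferInstance
  exact inferInstanceAs (IsUniformAddGroup (SmoothFun E H).toAddSubgroup)

theorem hasFDerivAt (v : SmoothFun E H) (α : List (Fin (Module.finrank ℝ E))) (x : H) :
    HasFDerivAt (fun z => v.1 α (x * (chartAt E (1 : H)).symm z))
      (∑ i, v.1 (i :: α) x • modelCoord E i) (chartAt E (1 : H) 1) :=
  v.2 α x

/-- The derivatives of a smooth function are determined by the function itself. -/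
@[ext]
theorem ext {v w : SmoothFun E H} (h : ∀ x, v.1 [] x = w.1 [] x) : v = w := by
  refine Subtype.ext (funext fun α => ?_)
  induction α with
  | nil => exact ContinuousMap.ext h
  | cons i α ih =>
    ext x
    have h1 := hasFDerivAt v α x
    rw [ih] at h1
    have h2 := congrArg (fun L : E →L[ℝ] ℝ => L (Module.finBasis ℝ E i))
      (h1.unique (hasFDerivAt w α x))
    simpa only [sum_smul_modelCoord_basis] using h2

variable [LieGroup 𝓘(ℝ, E) ∞ H] [IsTopologicalGroup H]

omit [FiniteDimensional ℝ E] in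
theorem _root_.maurerCartan_chartAt_one :
    maurerCartan (chartAt E (1 : H)) (chartAt E (1 : H) 1) = ContinuousLinearMap.id ℝ E := by
  have h1 := hasFDerivAt_maurerCartan (chart_mem_atlas E (1 : H)) chartAt_one_mem_target
  refine h1.unique ((hasFDerivAt_id _).congr_of_eventuallyEq ?_)
  filter_upwards [(chartAt E (1 : H)).open_target.mem_nhds chartAt_one_mem_target] with y hy
  simp [(chartAt E (1 : H)).right_inv hy]

omit [FiniteDimensional ℝ E] in
/-- The derivative at `1` of a function along left translates of the chart at `1` determines its
derivative along any chart. -/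
theorem _root_.HasFDerivAt.comp_chart_symm {Z : Type*} [NormedAddCommGroup Z] [NormedSpace ℝ Z]
    {u : H → Z} {e : OpenPartialHomeomorph H E} (he : e ∈ atlas E H) {y : E}
    (hy : y ∈ e.target) {x : H} {L : E →L[ℝ] Z}
    (hu : HasFDerivAt (fun z => u (x * e.symm y * (chartAt E (1 : H)).symm z)) L
      (chartAt E (1 : H) 1)) :
    HasFDerivAt (fun y' => u (x * e.symm y')) (L.comp (maurerCartan e y)) y := by
  have h1 := hasFDerivAt_maurerCartan he hy
  have h0 : chartAt E (1 : H) ((e.symm y)⁻¹ * e.symm y) = chartAt E (1 : H) 1 := by simp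
  rw [← h0] at hu
  refine (hu.comp y h1).congr_of_eventuallyEq ?_
  have hc : ContinuousAt (fun y' => (e.symm y)⁻¹ * e.symm y') y :=
    continuousAt_const.mul (e.continuousAt_symm hy)
  filter_upwards [hc.eventually_mem ((chartAt E (1 : H)).open_source.mem_nhds
    (by simp))] with y' hy'
  simp only [Function.comp]
  rw [(chartAt E (1 : H)).left_inv hy']
  group

theorem hasFDerivAt_chart (v : SmoothFun E H) (α : List (Fin (Module.finrank ℝ E)))
    {e : OpenPartialHomeomorph H E} (he : e ∈ atlas E H) (x : H) {y : E} (hy : y ∈ e.target) :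
    HasFDerivAt (fun y' => v.1 α (x * e.symm y'))
      ((∑ i, v.1 (i :: α) (x * e.symm y) • modelCoord E i).comp (maurerCartan e y)) y :=
  HasFDerivAt.comp_chart_symm he hy (hasFDerivAt v α _)

/-- Evaluation is jointly continuous, because `H` is locally compact. -/
theorem continuous_eval [LocallyCompactSpace H] {X : Type*} [TopologicalSpace X]
    {v : X → SmoothFun E H} {x : X → H} (hv : Continuous v) (hx : Continuous x)
    (α : List (Fin (Module.finrank ℝ E))) : Continuous fun p => (v p).1 α (x p) := by
  have : Continuous fun p => (v p).1 α :=
    (continuous_apply α).comp (continuous_subtype_val.comp hv)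
  exact this.eval hx

/-- A locally uniform limit of functions whose derivatives converge locally uniformly is
differentiable, so that `SmoothFun E H` is a closed subspace, and hence complete. -/
theorem isClosed [LocallyCompactSpace H] :
    IsClosed ((SmoothFun E H : Submodule ℝ _) :
      Set (List (Fin (Module.finrank ℝ E)) → C(H, ℝ))) := by
  refine isClosed_of_closure_subset fun v hv α x => ?_
  set c := chartAt E (1 : H)
  have hne : (comap (Subtype.val : SmoothFun E H → _) (𝓝 v)).NeBot := by
    refine comap_neBot fun t ht => ?_
    obtain ⟨w, hw, hw'⟩ := mem_closure_iff_nhds.1 hv t ht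
    exact ⟨⟨w, hw'⟩, hw⟩
  have hval : Tendsto (Subtype.val : SmoothFun E H → _)
    (comap (Subtype.val : SmoothFun E H → _) (𝓝 v)) (𝓝 v) := tendsto_comap
  have hev : ∀ β, ∀ z ∈ c.target, Tendsto
      (fun p : (List (Fin (Module.finrank ℝ E)) → C(H, ℝ)) × E => p.1 β (x * c.symm p.2))
      (𝓝 v ×ˢ 𝓝[c.target] z) (𝓝 (v β (x * c.symm z))) := by
    intro β z hz
    have h1 : Tendsto (fun p : (List (Fin (Module.finrank ℝ E)) → C(H, ℝ)) × E =>
        (p.1 β, x * c.symm p.2)) (𝓝 v ×ˢ 𝓝[c.target] z) (𝓝 (v β, x * c.symm z)) := by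
      refine Tendsto.prodMk_nhds ?_ ?_
      · exact ((continuous_apply β).tendsto v).comp tendsto_fst
      · exact ((c.continuousOn_symm z hz).tendsto.comp tendsto_snd).const_mul x
    exact ((ContinuousEval.continuous_eval (F := C(H, ℝ))).tendsto _).comp h1
  obtain ⟨f', hf'⟩ : ∃ f' : (List (Fin (Module.finrank ℝ E)) → C(H, ℝ)) → E → E →L[ℝ] ℝ,
    ∀ u z, f' u z = (∑ i, u (i :: α) (x * c.symm z) • modelCoord E i).comp (maurerCartan c z) :=
    ⟨_, fun _ _ => rfl⟩
  have hΘ := (contDiffOn_maurerCartan (chart_mem_atlas E (1 : H))).continuousOn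
  have hf'c : ∀ z ∈ c.target, Tendsto (fun p : (List (Fin (Module.finrank ℝ E)) → C(H, ℝ)) × E =>
      f' p.1 p.2) (𝓝 v ×ˢ 𝓝[c.target] z) (𝓝 (f' v z)) := by
    intro z hz
    simp only [hf']
    have h1 : Tendsto (fun p : (List (Fin (Module.finrank ℝ E)) → C(H, ℝ)) × E =>
        maurerCartan c p.2) (𝓝 v ×ˢ 𝓝[c.target] z) (𝓝 (maurerCartan c z)) :=
      (hΘ z hz).tendsto.comp tendsto_snd
    have h2 := tendsto_finsetSum Finset.univ fun i (_ : i ∈ Finset.univ) =>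
      (hev (i :: α) z hz).smul_const (modelCoord E i)
    exact ((isBoundedBilinearMap_comp (𝕜 := ℝ) (E := E) (F := E) (G := ℝ)).continuous.tendsto
      _).comp (h2.prodMk_nhds h1)
  have key := hasFDerivAt_of_tendstoLocallyUniformlyOn (𝕜 := ℝ)
    (l := comap (Subtype.val : SmoothFun E H → _) (𝓝 v)) c.open_target
    (f := fun u z => u.1 α (x * c.symm z)) (g := fun z => v α (x * c.symm z))
    (f' := fun u z => f' u.1 z) (g' := f' v) (x := c 1) ?_ ?_ ?_ chartAt_one_mem_target
  · have h1 : f' v (c 1) = ∑ i, v (i :: α) x • modelCoord E i := by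
      rw [hf', maurerCartan_chartAt_one, chartAt_one_symm_apply, mul_one]
      rfl
    exact h1 ▸ key
  · rw [tendstoLocallyUniformlyOn_iff_forall_tendsto]
    intro z hz
    have h1 : Tendsto (fun p : SmoothFun E H × E => f' p.1.1 p.2)
        (comap (Subtype.val : SmoothFun E H → _) (𝓝 v) ×ˢ 𝓝[c.target] z) (𝓝 (f' v z)) :=
      (hf'c z hz).comp (hval.prodMap tendsto_id)
    have h2 : Tendsto (fun p : SmoothFun E H × E => f' v p.2)
        (comap (Subtype.val : SmoothFun E H → _) (𝓝 v) ×ˢ 𝓝[c.target] z) (𝓝 (f' v z)) := by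
      have h3 : Tendsto (fun z' => ((v, z') : _ × E)) (𝓝[c.target] z) (𝓝 v ×ˢ 𝓝[c.target] z) :=
        tendsto_const_nhds.prodMk tendsto_id
      exact ((hf'c z hz).comp h3).comp tendsto_snd
    exact (h2.prodMk_nhds h1).mono_right (nhds_le_uniformity _)
  · intro u z hz
    rw [hf']
    exact hasFDerivAt_chart u α (chart_mem_atlas E (1 : H)) x hz
  · intro z hz
    have h3 : Tendsto (fun u : SmoothFun E H => ((u.1, z) : _ × E))
        (comap (Subtype.val : SmoothFun E H → _) (𝓝 v)) (𝓝 v ×ˢ 𝓝[c.target] z) :=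
      hval.prodMk (tendsto_const_pure.mono_right (pure_le_nhdsWithin hz))
    exact (hev α z hz).comp h3

instance [LocallyCompactSpace H] : CompleteSpace (SmoothFun E H) :=
  (isClosed (E := E) (H := H)).completeSpace_coe

end SmoothFun

end SmoothFun

/-! ### Integrals of families of smooth functions -/

namespace SmoothFun
open MeasureTheory

variable {E : Type*} [NormedAddCommGroup E] [NormedSpace ℝ E] [FiniteDimensional ℝ E]
  {H : Type*} [Group H] [TopologicalSpace H] [ChartedSpace E H]
  [LieGroup 𝓘(ℝ, E) ∞ H] [IsTopologicalGroup H] [LocallyCompactSpace H]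

/-- Integrals of continuous families of smooth functions with locally compact support exist, and
are computed entrywise. -/
theorem exists_integral {Y : Type*} [TopologicalSpace Y] [T2Space Y] [MeasurableSpace Y]
    [OpensMeasurableSpace Y] (μ : Measure Y) [IsFiniteMeasureOnCompacts μ]
    (c : Y → SmoothFun E H) (hc : Continuous c)
    (hsupp : ∀ x₀ : H, ∃ N ∈ 𝓝 x₀, ∃ C : Set Y, IsCompact C ∧
      ∀ y ∉ C, ∀ x ∈ N, ∀ α, (c y).1 α x = 0) :
    ∃ u : SmoothFun E H, ∀ α x, u.1 α x = ∫ y, (c y).1 α x ∂μ := by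
  have hjoint : ∀ α, Continuous fun p : H × Y => (c p.2).1 α p.1 := fun α =>
    continuous_eval (hc.comp continuous_snd) continuous_fst α
  have hcont : ∀ α, Continuous fun x : H => ∫ y, (c y).1 α x ∂μ := by
    intro α
    rw [continuous_iff_continuousAt]
    intro x₀
    obtain ⟨N, hN, C, hC, hv⟩ := hsupp x₀
    have h1 := continuousOn_integral_of_compact_support (μ := μ) (s := N) hC
      (f := fun x y => (c y).1 α x) (hjoint α).continuousOn fun x y hx hy => hv y hy x hx α
    exact h1.continuousAt hN
  -- differentiation under the integral sign, in the chart `φ` around `x`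
  refine ⟨⟨fun α => ⟨fun x => ∫ y, (c y).1 α x ∂μ, hcont α⟩, fun α x => ?_⟩, fun _ _ => rfl⟩
  obtain ⟨N, hN, C, hC, hv⟩ := hsupp x
  set φ := chartAt E (1 : H)
  have hint : ∀ α x', x' ∈ N → Integrable (fun y => (c y).1 α x') μ := fun α x' hx' =>
    ((hjoint α).comp (continuous_const.prodMk continuous_id)).integrable_of_hasCompactSupport
      (HasCompactSupport.intro hC fun y hy => hv y hy x' hx' α)
  have hφc : ContinuousAt (fun z => x * φ.symm z) (φ 1) :=
    continuousAt_const.mul (φ.continuousAt_symm chartAt_one_mem_target)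
  have hs : (fun z => x * φ.symm z) ⁻¹' N ∩ φ.target ∈ 𝓝 (φ 1) :=
    inter_mem (hφc (by simpa [φ] using hN)) (φ.open_target.mem_nhds chartAt_one_mem_target)
  obtain ⟨K, hK, hKs, hKc⟩ := local_compact_nhds hs
  obtain ⟨F', hF'⟩ : ∃ F' : E → Y → E →L[ℝ] ℝ, ∀ z y, F' z y =
      (∑ i, (c y).1 (i :: α) (x * φ.symm z) • modelCoord E i).comp (maurerCartan φ z) :=
    ⟨_, fun _ _ => rfl⟩
  have hF'1 : ∀ y, F' (φ 1) y = ∑ i, (c y).1 (i :: α) x • modelCoord E i := fun y => by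
    rw [hF', maurerCartan_chartAt_one, chartAt_one_symm_apply, mul_one]
    rfl
  have hcontF : ContinuousOn (fun p : E × Y => F' p.1 p.2) (K ×ˢ C) := by
    have hsymm : ContinuousOn (fun p : E × Y => (x * φ.symm p.1, p.2)) (K ×ˢ C) :=
      (continuousOn_const.mul (φ.continuousOn_symm.comp continuousOn_fst
        fun p hp => (hKs hp.1).2)).prodMk continuousOn_snd
    simp only [hF']
    refine ContinuousOn.clm_comp (continuousOn_finsetSum _ fun i _ => ?_) ?_
    · have h1 : ContinuousOn (fun p : E × Y => (c p.2).1 (i :: α) (x * φ.symm p.1)) (K ×ˢ C) :=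
        (hjoint (i :: α)).comp_continuousOn hsymm
      exact h1.smul continuousOn_const
    · exact (contDiffOn_maurerCartan (chart_mem_atlas E (1 : H))).continuousOn.comp
        continuousOn_fst fun p hp => (hKs hp.1).2
  obtain ⟨B, hB⟩ := (hKc.prod hC).exists_bound_of_continuousOn hcontF
  obtain ⟨F, hF⟩ : ∃ F : E → Y → ℝ, ∀ z y, F z y = (c y).1 α (x * φ.symm z) :=
    ⟨_, fun _ _ => rfl⟩
  have hint' := fun i => (hint (i :: α) x (mem_of_mem_nhds hN)).smul_const (modelCoord E i)
  have hsum : ∫ y, F' (φ 1) y ∂μ = ∑ i, (∫ y, (c y).1 (i :: α) x ∂μ) • modelCoord E i := by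
    simp only [hF'1]
    rw [integral_finsetSum _ fun i _ => hint' i]
    exact Finset.sum_congr rfl fun i _ => integral_smul_const _ _
  have key := hasFDerivAt_integral_of_dominated_of_fderiv_le (𝕜 := ℝ) (μ := μ) (s := K)
    (x₀ := φ 1) (F := F) (F' := F') (bound := C.indicator fun _ => B)
    hK ?_ ?_ ?_ ?_ ?_ ?_
  · rw [hsum] at key
    simp only [hF] at key
    exact key
  · refine Eventually.of_forall fun z => ?_
    have : F z = fun y => (c y).1 α (x * φ.symm z) := funext (hF z)
    rw [this]
    exact ((hjoint α).comp (continuous_const.prodMk continuous_id)).aestronglyMeasurable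
  · have : F (φ 1) = fun y => (c y).1 α x := funext fun y => by
      rw [hF, chartAt_one_symm_apply, mul_one]
    rw [this]
    exact hint α x (mem_of_mem_nhds hN)
  · have : F' (φ 1) = fun y => ∑ i, (c y).1 (i :: α) x • modelCoord E i := funext hF'1
    rw [this]
    exact (integrable_finsetSum _ fun i _ => hint' i).aestronglyMeasurable
  · refine Eventually.of_forall fun y z hz => ?_
    by_cases hy : y ∈ C
    · simpa [hy] using hB (z, y) ⟨hz, hy⟩
    · have h0 : F' z y = 0 := by
        rw [hF', Finset.sum_eq_zero fun i _ => by rw [hv y hy _ (hKs hz).1, zero_smul]]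
        exact ContinuousLinearMap.zero_comp _
      simp [hy, h0]
  · exact (integrable_indicator_iff hC.measurableSet).2
      (integrableOn_const hC.measure_ne_top)
  · refine Eventually.of_forall fun y z hz => ?_
    have : (fun z => F z y) = fun z => (c y).1 α (x * φ.symm z) := funext fun z => hF z y
    rw [this, hF']
    exact hasFDerivAt_chart (c y) α (chart_mem_atlas E (1 : H)) x (hKs hz).2

theorem exists_integral_unitInterval (c : C(unitInterval, SmoothFun E H)) :
    ∃ u : SmoothFun E H, ∀ α x, u.1 α x = ∫ t, (c t).1 α x :=
  exists_integral volume c c.continuous fun _ =>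
    ⟨univ, univ_mem, univ, isCompact_univ, fun y hy => (hy (mem_univ y)).elim⟩

/-- Integration over `[0,1]` of continuous curves of smooth functions, as a continuous linear map for
the compact-open topologies. -/
noncomputable def integralCLM : C(unitInterval, SmoothFun E H) →L[ℝ] SmoothFun E H where
  toFun c := (exists_integral_unitInterval c).choose
  map_add' c d := by
    have hint : ∀ (c : C(unitInterval, SmoothFun E H)) (x : H),
        Integrable (fun t => (c t).1 [] x) := fun c x =>
      (continuous_eval c.continuous continuous_const []).integrable_of_hasCompactSupport
        (HasCompactSupport.of_compactSpace _)
    ext x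
    have h1 := (exists_integral_unitInterval (c + d)).choose_spec [] x
    have h2 := (exists_integral_unitInterval c).choose_spec [] x
    have h3 := (exists_integral_unitInterval d).choose_spec [] x
    refine h1.trans ((integral_add (hint c x) (hint d x)).trans ?_)
    rw [← h2, ← h3]
    rfl
  map_smul' r c := by
    ext x
    have h1 := (exists_integral_unitInterval (r • c)).choose_spec [] x
    have h2 := (exists_integral_unitInterval c).choose_spec [] x
    refine h1.trans ((integral_const_mul r _).trans ?_)
    rw [← h2]
    rfl
  cont := by
    refine continuous_induced_rng.2 (continuous_pi fun α => ?_)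
    refine ContinuousMap.continuous_of_continuous_uncurry _ ?_
    have h1 : (Function.uncurry fun (c : C(unitInterval, SmoothFun E H)) (x : H) =>
        (exists_integral_unitInterval c).choose.1 α x) =
        fun p : C(unitInterval, SmoothFun E H) × H => ∫ t, (p.1 t).1 α p.2 :=
      funext fun p => (exists_integral_unitInterval p.1).choose_spec α p.2
    refine Eq.mpr (congrArg _ h1) ?_
    rw [← continuousOn_univ]
    refine continuousOn_integral_of_compact_support (k := univ) isCompact_univ ?_
      fun _ _ _ h => (h (mem_univ _)).elim
    refine Continuous.continuousOn ?_
    refine continuous_eval (v := fun q : (C(unitInterval, SmoothFun E H) × H) × unitInterval =>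
      q.1.1 q.2) ?_ (continuous_snd.comp continuous_fst) α
    exact (continuous_fst.comp continuous_fst).eval continuous_snd

theorem integralCLM_apply (c : C(unitInterval, SmoothFun E H))
    (α : List (Fin (Module.finrank ℝ E))) (x : H) :
    (integralCLM c).1 α x = ∫ t, (c t).1 α x :=
  (exists_integral_unitInterval c).choose_spec α x

end SmoothFun

/-! ### The action on smooth functions by right translations -/

namespace SmoothFun
open MeasureTheory

section Action

variable {E : Type*} [NormedAddCommGroup E] [NormedSpace ℝ E] [FiniteDimensional ℝ E]
  {H : Type*} [Group H] [TopologicalSpace H] [ChartedSpace E H]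
  [IsTopologicalGroup H]

/-- The entry at `α` of the right translate `x ↦ v (x h)` of a smooth function: left-invariant
derivatives of a right translate are combinations, with the coefficients of `Ad h⁻¹`, of the right
translates of left-invariant derivatives. -/
noncomputable def translateEntry (E : Type*) [NormedAddCommGroup E] [NormedSpace ℝ E]
    [FiniteDimensional ℝ E] {H : Type*} [Group H] [TopologicalSpace H] [ChartedSpace E H]
    [IsTopologicalGroup H] (h : H) : List (Fin (Module.finrank ℝ E)) →
    (List (Fin (Module.finrank ℝ E)) → C(H, ℝ)) → C(H, ℝ)
  | [], v => (v []).comp ⟨fun x => x * h, continuous_mul_const h⟩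
  | i :: α, v => ∑ j, modelCoord E j (adInv E h (Module.finBasis ℝ E i)) •
      translateEntry E h α fun β => v (j :: β)

theorem translateEntry_nil_apply (h : H) (v : List (Fin (Module.finrank ℝ E)) → C(H, ℝ)) (x : H) :
    translateEntry E h [] v x = v [] (x * h) := rfl

theorem translateEntry_cons_apply (h : H) (i : Fin (Module.finrank ℝ E))
    (α : List (Fin (Module.finrank ℝ E)))
    (v : List (Fin (Module.finrank ℝ E)) → C(H, ℝ)) (x : H) :
    translateEntry E h (i :: α) v x = ∑ j, modelCoord E j (adInv E h (Module.finBasis ℝ E i)) *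
      translateEntry E h α (fun β => v (j :: β)) x := by
  simp only [translateEntry, ContinuousMap.sum_apply, ContinuousMap.smul_apply, smul_eq_mul]

/-- Translates of functions with support in `S` are supported in `S h⁻¹`. -/
theorem translateEntry_eq_zero {S : Set H} {v : List (Fin (Module.finrank ℝ E)) → C(H, ℝ)}
    (hv : ∀ α, ∀ x ∉ S, v α x = 0) (h : H) (α : List (Fin (Module.finrank ℝ E))) {x : H}
    (hx : x * h ∉ S) : translateEntry E h α v x = 0 := by
  induction α generalizing v with
  | nil => exact hv [] _ hx
  | cons i α ih =>
    rw [translateEntry_cons_apply]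
    exact Finset.sum_eq_zero fun j _ => by rw [ih fun β x hx => hv (j :: β) x hx, mul_zero]

variable [LieGroup 𝓘(ℝ, E) ∞ H] [LocallyCompactSpace H]

theorem continuous_translateEntry (α : List (Fin (Module.finrank ℝ E))) :
    Continuous fun p : H × (List (Fin (Module.finrank ℝ E)) → C(H, ℝ)) =>
      translateEntry E p.1 α p.2 := by
  induction α with
  | nil =>
    refine ContinuousMap.continuous_of_continuous_uncurry _ ?_
    have h1 : Continuous fun q : (H × (List (Fin (Module.finrank ℝ E)) → C(H, ℝ))) × H =>
        q.1.2 [] := (continuous_apply []).comp (continuous_snd.comp continuous_fst)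
    exact h1.eval (continuous_snd.mul (continuous_fst.comp continuous_fst))
  | cons i α ih =>
    simp only [translateEntry]
    refine continuous_finsetSum _ fun j _ => ?_
    have h1 : Continuous fun p : H × (List (Fin (Module.finrank ℝ E)) → C(H, ℝ)) =>
        modelCoord E j (adInv E p.1 (Module.finBasis ℝ E i)) := (modelCoord E j).continuous.comp
      (((continuous_adInv (E := E)).comp continuous_fst).clm_apply continuous_const)
    have h2 : Continuous fun p : H × (List (Fin (Module.finrank ℝ E)) → C(H, ℝ)) =>
        (p.1, fun β => p.2 (j :: β)) :=
      continuous_fst.prodMk (continuous_pi fun β => (continuous_apply _).comp continuous_snd)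
    exact h1.smul (ih.comp h2)

/-- If the `w i` are the left-invariant derivatives of `v`, then those of the translate of `v` are
combinations of translates of the `w i`. -/
theorem hasFDerivAt_translateEntry (h : H) (α : List (Fin (Module.finrank ℝ E)))
    {v : List (Fin (Module.finrank ℝ E)) → C(H, ℝ)}
    {w : Fin (Module.finrank ℝ E) → List (Fin (Module.finrank ℝ E)) → C(H, ℝ)}
    (hv : ∀ β x, HasFDerivAt (fun z => v β (x * (chartAt E (1 : H)).symm z))
      (∑ i, w i β x • modelCoord E i) (chartAt E (1 : H) 1)) (x : H) :
    HasFDerivAt (fun z => translateEntry E h α v (x * (chartAt E (1 : H)).symm z))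
      (∑ i, (∑ j, modelCoord E j (adInv E h (Module.finBasis ℝ E i)) *
        translateEntry E h α (w j) x) • modelCoord E i) (chartAt E (1 : H) 1) := by
  induction α generalizing v w with
  | nil =>
    set φ := chartAt E (1 : H)
    have h1 := hasFDerivAt_adInv (E := E) h
    have h2 := hv [] (x * h)
    have h0 : φ (h⁻¹ * φ.symm (φ 1) * h) = φ 1 := by simp [φ]
    rw [← h0] at h2
    have h3 := h2.comp (φ 1) h1
    have h4 : (∑ i, w i [] (x * h) • modelCoord E i).comp (adInv E h) =
        ∑ i, (∑ j, modelCoord E j (adInv E h (Module.finBasis ℝ E i)) *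
        translateEntry E h [] (w j) x) • modelCoord E i := by
      rw [← sum_apply_basis_smul_modelCoord ((∑ i, w i [] (x * h) • modelCoord E i).comp _)]
      refine Finset.sum_congr rfl fun i _ => ?_
      congr 1
      simp [translateEntry_nil_apply, mul_comm]
    rw [h4] at h3
    refine h3.congr_of_eventuallyEq ?_
    have hc : ContinuousAt (fun z => h⁻¹ * φ.symm z * h) (φ 1) :=
      (continuousAt_const.mul (φ.continuousAt_symm chartAt_one_mem_target)).mul continuousAt_const
    filter_upwards [hc.eventually_mem (φ.open_source.mem_nhds (by simp [φ]))] with z hz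
    simp only [Function.comp, translateEntry_nil_apply]
    rw [φ.left_inv hz]
    congr 1
    group
  | cons k α ih =>
    simp only [translateEntry_cons_apply]
    have h1 := fun j => (ih (v := fun β => v (j :: β)) (w := fun l β => w l (j :: β))
      fun β x => hv (j :: β) x).const_mul
        (modelCoord E j (adInv E h (Module.finBasis ℝ E k)))
    refine (HasFDerivAt.fun_sum fun j (_ : j ∈ Finset.univ) => h1 j).congr_fderiv ?_
    simp only [Finset.smul_sum, smul_smul]
    rw [Finset.sum_comm]
    refine Finset.sum_congr rfl fun i _ => ?_
    rw [← Finset.sum_smul]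
    congr 1
    simp only [Finset.mul_sum]
    rw [Finset.sum_comm]
    exact Finset.sum_congr rfl fun j _ => Finset.sum_congr rfl fun l _ => by ring

/-- The action of `H` on smooth functions by right translation, `(h, v) ↦ (x ↦ v (x h))`. -/
noncomputable def translate (h : H) (v : SmoothFun E H) : SmoothFun E H :=
  ⟨fun α => translateEntry E h α v.1, fun α x => by
    simp only [translateEntry_cons_apply]
    exact hasFDerivAt_translateEntry h α (w := fun i β => v.1 (i :: β)) v.2 x⟩

theorem translate_nil_apply (h : H) (v : SmoothFun E H) (x : H) :
    (translate h v).1 [] x = v.1 [] (x * h) := rfl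

theorem translate_one (v : SmoothFun E H) : translate 1 v = v := by
  ext x; simp [translate_nil_apply]

theorem translate_mul (g h : H) (v : SmoothFun E H) :
    translate (g * h) v = translate g (translate h v) := by
  ext x; simp [translate_nil_apply, mul_assoc]

theorem translate_add (h : H) (v w : SmoothFun E H) :
    translate h (v + w) = translate h v + translate h w := by
  ext x; rfl

theorem translate_smul (h : H) (r : ℝ) (v : SmoothFun E H) :
    translate h (r • v) = r • translate h v := by
  ext x; rfl

theorem translate_sub (h : H) (v w : SmoothFun E H) :
    translate h (v - w) = translate h v - translate h w := by
  ext x; rfl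

theorem translate_zero (h : H) : translate h (0 : SmoothFun E H) = 0 := by
  ext x; rfl

theorem continuous_translate :
    Continuous fun p : H × SmoothFun E H => translate p.1 p.2 := by
  refine continuous_induced_rng.2 (continuous_pi fun α => ?_)
  have h1 : Continuous fun p : H × SmoothFun E H => (p.1, p.2.1) :=
    continuous_fst.prodMk (continuous_subtype_val.comp continuous_snd)
  exact (continuous_translateEntry α).comp h1

/-- Translation by a fixed element, as a continuous linear map. -/
noncomputable def translateCLM (h : H) : SmoothFun E H →L[ℝ] SmoothFun E H where
  toFun := translate h
  map_add' := translate_add h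
  map_smul' := translate_smul h
  cont := continuous_translate.comp (continuous_const.prodMk continuous_id)

/-- The left-invariant derivative of a smooth function in the direction of a basis vector. -/
noncomputable def basisDeriv (i : Fin (Module.finrank ℝ E)) :
    SmoothFun E H →L[ℝ] SmoothFun E H where
  toFun v := ⟨fun α => v.1 (α ++ [i]), fun α x => v.2 (α ++ [i]) x⟩
  map_add' _ _ := rfl
  map_smul' _ _ := rfl
  cont := continuous_induced_rng.2
    (continuous_pi fun α => (continuous_apply (α ++ [i])).comp continuous_subtype_val)

/-- The derived action of `T₁H = E` on smooth functions, by left-invariant vector fields. -/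
noncomputable def derivAction : E →ₗ[ℝ] SmoothFun E H →ₗ[ℝ] SmoothFun E H :=
  ∑ i, (modelCoord E i).toLinearMap.smulRight (basisDeriv (H := H) i).toLinearMap

theorem derivAction_apply (a : E) (v : SmoothFun E H) :
    derivAction a v = ∑ i, modelCoord E i a • basisDeriv i v := by
  simp [derivAction, LinearMap.sum_apply]

theorem derivAction_nil_apply (a : E) (v : SmoothFun E H) (x : H) :
    (derivAction a v).1 [] x = (∑ i, v.1 [i] x • modelCoord E i) a := by
  rw [derivAction_apply]
  simp [basisDeriv, mul_comm]

theorem continuous_derivAction :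
    Continuous fun p : E × SmoothFun E H => derivAction p.1 p.2 := by
  simp only [derivAction_apply]
  exact continuous_finsetSum _ fun i _ => ((modelCoord E i).continuous.comp continuous_fst).smul
    ((basisDeriv i).continuous.comp continuous_snd)

theorem _root_.integral_unitInterval (f : ℝ → ℝ) :
    ∫ t : unitInterval, f t = ∫ t in (0 : ℝ)..1, f t := by
  rw [intervalIntegral.integral_of_le zero_le_one, ← integral_Icc_eq_integral_Ioc]
  exact integral_subtype measurableSet_Icc f

theorem integralCLM_const (v : SmoothFun E H) :
    integralCLM (ContinuousMap.const unitInterval v) = v := by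
  ext x
  rw [integralCLM_apply]
  simp

/-- In a chart, the action by right translations has the derivative
`(y, k) ↦ ρ(y) (derivAction (maurerCartan y k) v)` in the group variable. -/
theorem tendsto_slope_translate {e : OpenPartialHomeomorph H E} (he : e ∈ atlas E H) {y : E}
    (hy : y ∈ e.target) (k : E) (v : SmoothFun E H) :
    Tendsto (fun t : ℝ => t⁻¹ • (translate (e.symm (y + t • k)) v - translate (e.symm y) v))
      (𝓝[≠] 0) (𝓝 (translate (e.symm y) (derivAction (maurerCartan e y k) v))) := by
  obtain ⟨ε, hε, hball⟩ : ∃ ε > 0, ∀ t : ℝ, |t| ≤ ε → y + t • k ∈ e.target := by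
    obtain ⟨ε, hε, h⟩ := Metric.eventually_nhds_iff.1 (eventually_add_smul_mem e.open_target hy k)
    refine ⟨ε / 2, by positivity, fun t ht => h ?_⟩
    rw [Real.dist_eq, sub_zero]
    linarith
  -- the velocity of the curve, with time clamped to `[-ε, ε]` so that it is defined for all times
  let p : ℝ → ℝ := fun s => projIcc (-ε) ε (by linarith) s
  have hp : Continuous p := continuous_subtype_val.comp continuous_projIcc
  have hpm : ∀ s, |p s| ≤ ε := fun s => abs_le.2 (projIcc (-ε) ε _ s).2
  have hpe : ∀ s, |s| ≤ ε → p s = s := fun s hs =>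
    congrArg Subtype.val (projIcc_of_mem (by linarith) (abs_le.1 hs))
  have hyp : Continuous fun s => y + p s • k := by fun_prop
  have hmem : ∀ s, y + p s • k ∈ e.target := fun s => hball _ (hpm s)
  let G : ℝ → SmoothFun E H := fun s => translate (e.symm (y + p s • k))
    (derivAction (maurerCartan e (y + p s • k) k) v)
  have hG : Continuous G := by
    have h1 : Continuous fun s => e.symm (y + p s • k) :=
      e.continuousOn_symm.comp_continuous hyp hmem
    have h2 : Continuous fun s => maurerCartan e (y + p s • k) :=
      (contDiffOn_maurerCartan he).continuousOn.comp_continuous hyp hmem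
    have h3 : Continuous fun s => derivAction (maurerCartan e (y + p s • k) k) v :=
      continuous_derivAction.comp ((h2.clm_apply continuous_const).prodMk continuous_const)
    exact continuous_translate.comp (h1.prodMk h3)
  let Γ : C(ℝ, C(unitInterval, SmoothFun E H)) :=
    ContinuousMap.curry ⟨fun q : ℝ × unitInterval => G (q.1 * q.2), by fun_prop⟩
  have hlim : Tendsto (fun t => integralCLM (Γ t)) (𝓝[≠] 0)
      (𝓝 (translate (e.symm y) (derivAction (maurerCartan e y k) v))) := by
    have h1 : Tendsto (fun t => integralCLM (Γ t)) (𝓝 0) (𝓝 (integralCLM (Γ 0))) :=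
      (integralCLM.continuous.comp Γ.continuous).tendsto 0
    have h2 : Γ 0 = ContinuousMap.const unitInterval
        (translate (e.symm y) (derivAction (maurerCartan e y k) v)) := by
      ext1 s
      have : p 0 = 0 := hpe 0 (by simpa using hε.le)
      simp [Γ, G, this]
    rw [h2, integralCLM_const] at h1
    exact h1.mono_left nhdsWithin_le_nhds
  refine hlim.congr' ?_
  have hev : ∀ᶠ t : ℝ in 𝓝[≠] 0, |t| ≤ ε := by
    refine nhdsWithin_le_nhds ?_
    filter_upwards [Metric.ball_mem_nhds (0 : ℝ) hε] with t ht
    rw [mem_ball_zero_iff, Real.norm_eq_abs] at ht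
    exact ht.le
  filter_upwards [hev, self_mem_nhdsWithin] with t ht hne
  have hne' : t ≠ 0 := hne
  -- a smooth function is determined by its values, so the fundamental theorem of calculus in `ℝ`
  -- suffices to express the difference quotient as an integral
  rw [eq_inv_smul_iff₀ hne']
  ext x
  have hstep : ∀ s ∈ uIcc (0 : ℝ) 1, HasDerivAt (fun s => v.1 [] (x * e.symm (y + (t * s) • k)))
      (t * (G (t * s)).1 [] x) s := by
    intro s hs
    rw [uIcc_of_le zero_le_one] at hs
    have hts : |t * s| ≤ ε := by
      rw [abs_mul, abs_of_nonneg hs.1]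
      exact (mul_le_of_le_one_right (abs_nonneg t) hs.2).trans ht
    have h1 := hasFDerivAt_chart v [] he x (hball _ hts)
    have h2 : HasDerivAt (fun s : ℝ => y + (t * s) • k) (t • k) s := by
      have := (((hasDerivAt_id s).const_mul t).smul_const k).const_add y
      simpa using this
    have h3 := h1.comp_hasDerivAt s h2
    refine h3.congr_deriv ?_
    simp only [G, translate_nil_apply, derivAction_nil_apply, hpe _ hts, map_smul, smul_eq_mul]
    rfl
  have hcont : Continuous fun s => (G (t * s)).1 [] x :=
    continuous_eval (hG.comp (continuous_const_mul t)) continuous_const []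
  have hFTC := intervalIntegral.integral_eq_sub_of_hasDerivAt hstep
    ((hcont.const_mul t).intervalIntegrable 0 1)
  rw [intervalIntegral.integral_const_mul, ← integral_unitInterval] at hFTC
  simp only [mul_one, mul_zero, zero_smul, add_zero] at hFTC
  have h4 : (integralCLM (Γ t)).1 [] x = ∫ s : unitInterval, (G (t * s)).1 [] x :=
    integralCLM_apply _ _ _
  change t * (integralCLM (Γ t)).1 [] x = _
  rw [h4, hFTC]
  rfl

end Action

section Smooth

variable {E : Type u} [NormedAddCommGroup E] [NormedSpace ℝ E] [FiniteDimensional ℝ E]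
  {H : Type u} [Group H] [TopologicalSpace H] [ChartedSpace E H]
  [IsTopologicalGroup H] [LieGroup 𝓘(ℝ, E) ∞ H] [LocallyCompactSpace H]

/-- In a chart, the action of `H` on smooth functions is smooth. -/
theorem lcContDiffOn_translate {e : OpenPartialHomeomorph H E} (he : e ∈ atlas E H) (n : ℕ) :
    LCContDiffOn n (fun p : E × SmoothFun E H => translate (e.symm p.1) p.2)
      (e.target ×ˢ univ) := by
  have hc : ContinuousOn (fun p : E × SmoothFun E H => translate (e.symm p.1) p.2)
      (e.target ×ˢ univ) :=
    continuous_translate.comp_continuousOn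
      ((e.continuousOn_symm.comp continuousOn_fst fun p hp => hp.1).prodMk continuousOn_snd)
  induction n with
  | zero => exact hc
  | succ n ih =>
    refine ⟨hc, fun q => translate (e.symm q.1.1)
      (q.2.2 + derivAction (maurerCartan e q.1.1 q.2.1) q.1.2), fun x hx k => ?_, ?_⟩
    · have h1 := tendsto_slope_translate he hx.1 k.1 x.2
      have h2 : Tendsto (fun t : ℝ => translate (e.symm (x.1 + t • k.1)) k.2) (𝓝[≠] 0)
          (𝓝 (translate (e.symm x.1) k.2)) := by
        have h3 : ContinuousAt (fun t : ℝ => x.1 + t • k.1) 0 := by fun_prop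
        have h4 : Tendsto (fun t : ℝ => e.symm (x.1 + t • k.1)) (𝓝 0) (𝓝 (e.symm x.1)) := by
          have h5 := e.continuousAt_symm hx.1
          have h6 : Tendsto (fun t : ℝ => x.1 + t • k.1) (𝓝 0) (𝓝 x.1) := by
            simpa [ContinuousAt] using h3
          exact h5.tendsto.comp h6
        exact ((continuous_translate.tendsto _).comp
          (h4.prodMk_nhds tendsto_const_nhds)).mono_left nhdsWithin_le_nhds
      have h3 := h2.add h1
      rw [← translate_add] at h3
      refine h3.congr' ?_
      filter_upwards [self_mem_nhdsWithin] with t ht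
      have ht' : t ≠ 0 := ht
      simp only [Prod.fst_add, Prod.smul_fst, Prod.snd_add, Prod.smul_snd, translate_add,
        translate_smul]
      rw [add_sub_right_comm, smul_add, smul_smul, inv_mul_cancel₀ ht', one_smul, add_comm]
    · have hΘ : LCContDiffOn n (fun q : (E × SmoothFun E H) × (E × SmoothFun E H) =>
          maurerCartan e q.1.1 q.2.1) ((e.target ×ˢ univ) ×ˢ univ) := by
        have h1 : ContDiffOn ℝ ∞ (fun q : E × E => maurerCartan e q.1 q.2) (e.target ×ˢ univ) :=
          ((contDiffOn_maurerCartan he).comp contDiffOn_fst fun q hq => hq.1).clm_apply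
            contDiffOn_snd
        have h2 := ContDiffOn.lcSmoothOn (e.open_target.prod isOpen_univ) h1 n
        exact h2.comp_clm (((ContinuousLinearMap.fst ℝ E (SmoothFun E H)).comp
          (ContinuousLinearMap.fst ℝ _ _)).prod ((ContinuousLinearMap.fst ℝ E (SmoothFun E H)).comp
          (ContinuousLinearMap.snd ℝ _ _))) fun q hq => ⟨hq.1.1, mem_univ _⟩
      have h11 : LCContDiffOn n (fun q : (E × SmoothFun E H) × (E × SmoothFun E H) => q.1.1)
          ((e.target ×ˢ univ) ×ˢ univ) :=
        ((ContinuousLinearMap.fst ℝ E (SmoothFun E H)).comp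
          (ContinuousLinearMap.fst ℝ (E × SmoothFun E H) (E × SmoothFun E H))).lcContDiffOn n _
      have h12 : LCContDiffOn n (fun q : (E × SmoothFun E H) × (E × SmoothFun E H) => q.1.2)
          ((e.target ×ˢ univ) ×ˢ univ) :=
        ((ContinuousLinearMap.snd ℝ E (SmoothFun E H)).comp
          (ContinuousLinearMap.fst ℝ (E × SmoothFun E H) (E × SmoothFun E H))).lcContDiffOn n _
      have h22 : LCContDiffOn n (fun q : (E × SmoothFun E H) × (E × SmoothFun E H) => q.2.2)
          ((e.target ×ˢ univ) ×ˢ univ) :=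
        ((ContinuousLinearMap.snd ℝ E (SmoothFun E H)).comp
          (ContinuousLinearMap.snd ℝ (E × SmoothFun E H) (E × SmoothFun E H))).lcContDiffOn n _
      have hB := (lcContDiffOn_of_bilinear (derivAction (E := E) (H := H)) continuous_derivAction n
        univ).comp isOpen_univ (hΘ.prodMk h12) (mapsTo_univ _ _)
      exact ih.comp (e.open_target.prod isOpen_univ) (h11.prodMk (h22.add hB))
        fun q hq => ⟨hq.1.1, mem_univ _⟩

end Smooth

end SmoothFun

/-! ### The semidirect product `C^∞(H) ⋊ H` -/

/-- The semidirect product `C^∞(H) ⋊ H`, where `H` acts on functions by right translation.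
Its charts are the products of the identity of `C^∞(H)` with the charts of `H`. -/
def SmoothSemidirect (E : Type*) [NormedAddCommGroup E] [NormedSpace ℝ E] [FiniteDimensional ℝ E]
    (H : Type*) [Group H] [TopologicalSpace H] [ChartedSpace E H] : Type _ :=
  SmoothFun E H × H

namespace SmoothSemidirect

section Group

variable {E : Type*} [NormedAddCommGroup E] [NormedSpace ℝ E] [FiniteDimensional ℝ E]
  {H : Type*} [Group H] [TopologicalSpace H] [ChartedSpace E H]

instance : TopologicalSpace (SmoothSemidirect E H) :=
  inferInstanceAs (TopologicalSpace (SmoothFun E H × H))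

instance : ChartedSpace (SmoothFun E H × E) (SmoothSemidirect E H) where
  atlas := {e | ∃ c ∈ atlas E H, e = (OpenPartialHomeomorph.refl (SmoothFun E H)).prod c}
  chartAt p := (OpenPartialHomeomorph.refl (SmoothFun E H)).prod (chartAt E p.2)
  mem_chart_source p := ⟨mem_univ _, mem_chart_source E p.2⟩
  chart_mem_atlas p := ⟨_, chart_mem_atlas E p.2, rfl⟩

variable [IsTopologicalGroup H] [LieGroup 𝓘(ℝ, E) ∞ H] [LocallyCompactSpace H]

noncomputable instance : Group (SmoothSemidirect E H) where
  mul p q := (p.1 + SmoothFun.translate p.2 q.1, p.2 * q.2)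
  one := ((0 : SmoothFun E H), (1 : H))
  inv p := (-SmoothFun.translate p.2⁻¹ p.1, p.2⁻¹)
  mul_assoc p q r := Prod.ext
    (by
      change p.1 + SmoothFun.translate p.2 q.1 + SmoothFun.translate (p.2 * q.2) r.1 =
        p.1 + SmoothFun.translate p.2 (q.1 + SmoothFun.translate q.2 r.1)
      rw [SmoothFun.translate_add, SmoothFun.translate_mul, add_assoc])
    (mul_assoc p.2 q.2 r.2)
  one_mul p := Prod.ext
    (by
      change 0 + SmoothFun.translate 1 p.1 = p.1
      rw [SmoothFun.translate_one, zero_add])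
    (one_mul p.2)
  mul_one p := Prod.ext
    (by
      change p.1 + SmoothFun.translate p.2 0 = p.1
      rw [SmoothFun.translate_zero, add_zero])
    (mul_one p.2)
  inv_mul_cancel p := Prod.ext (neg_add_cancel _) (inv_mul_cancel p.2)

instance : IsTopologicalGroup (SmoothSemidirect E H) where
  continuous_mul := by
    have h1 : Continuous fun r : (SmoothFun E H × H) × (SmoothFun E H × H) =>
        SmoothFun.translate r.1.2 r.2.1 := SmoothFun.continuous_translate.comp
      ((continuous_snd.comp continuous_fst).prodMk (continuous_fst.comp continuous_snd))
    have h2 : Continuous fun r : (SmoothFun E H × H) × (SmoothFun E H × H) =>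
        (r.1.1 + SmoothFun.translate r.1.2 r.2.1, r.1.2 * r.2.2) := by fun_prop
    exact h2
  continuous_inv := by
    have h1 : Continuous fun r : SmoothFun E H × H => SmoothFun.translate r.2⁻¹ r.1 :=
      SmoothFun.continuous_translate.comp (continuous_snd.inv.prodMk continuous_fst)
    have h2 : Continuous fun r : SmoothFun E H × H => (-SmoothFun.translate r.2⁻¹ r.1, r.2⁻¹) := by
      fun_prop
    exact h2

end Group

section Smooth

variable {E : Type u} [NormedAddCommGroup E] [NormedSpace ℝ E] [FiniteDimensional ℝ E]
  {H : Type u} [Group H] [TopologicalSpace H] [ChartedSpace E H]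
  [IsTopologicalGroup H] [LieGroup 𝓘(ℝ, E) ∞ H] [LocallyCompactSpace H]

/-- The action by translations, composed with a `C^n` map into a chart domain of `H` and a `C^n` map
into the space of smooth functions, is `C^n`. -/
theorem _root_.LCContDiffOn.translate {X : Type v} [AddCommGroup X] [Module ℝ X]
    [TopologicalSpace X] {n : ℕ} {y : X → E} {w : X → SmoothFun E H} {U : Set X}
    {e : OpenPartialHomeomorph H E} (he : e ∈ atlas E H) (hy : LCContDiffOn n y U)
    (hw : LCContDiffOn n w U) (hm : MapsTo y U e.target) :
    LCContDiffOn n (fun x => SmoothFun.translate (e.symm (y x)) (w x)) U :=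
  (SmoothFun.lcContDiffOn_translate he n).comp (e.open_target.prod isOpen_univ) (hy.prodMk hw)
    fun _ hx => ⟨hm hx, mem_univ _⟩

theorem _root_.contDiffOn_chart_change {c c' : OpenPartialHomeomorph H E} (hc : c ∈ atlas E H)
    (hc' : c' ∈ atlas E H) :
    ContDiffOn ℝ ∞ (fun y => c' (c.symm y)) (c.target ∩ c.symm ⁻¹' c'.source) :=
  (contMDiffOn_atlas_symm hc).contDiffOn_chart hc'

theorem _root_.contDiffOn_chart_inv {c c' : OpenPartialHomeomorph H E} (hc : c ∈ atlas E H)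
    (hc' : c' ∈ atlas E H) :
    ContDiffOn ℝ ∞ (fun y => c' (c.symm y)⁻¹) (c.target ∩ (fun y => (c.symm y)⁻¹) ⁻¹' c'.source) :=
  (contMDiffOn_atlas_symm hc).inv.contDiffOn_chart hc'

theorem _root_.contDiffOn_chart_mul {c₁ c₂ c₃ : OpenPartialHomeomorph H E}
    (h₁ : c₁ ∈ atlas E H) (h₂ : c₂ ∈ atlas E H) (h₃ : c₃ ∈ atlas E H) :
    ContDiffOn ℝ ∞ (fun p : E × E => c₃ (c₁.symm p.1 * c₂.symm p.2))
      ((c₁.target ×ˢ c₂.target) ∩ (fun p : E × E => c₁.symm p.1 * c₂.symm p.2) ⁻¹' c₃.source) :=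
  ((ContMDiffOn.comp_fst_atlas_symm contDiffOn_fst h₁ fun _ hp => hp.1).mul
    (ContMDiffOn.comp_fst_atlas_symm contDiffOn_snd h₂ fun _ hp => hp.2)).contDiffOn_chart h₃

instance [T2Space H] : LCLieGroup (SmoothFun E H × E) (SmoothSemidirect E H) where
  toT2Space := inferInstanceAs (T2Space (SmoothFun E H × H))
  smooth_chart_change := by
    rintro _ ⟨c, hc, rfl⟩ _ ⟨c', hc', rfl⟩ n
    have ho := c.continuousOn_symm.isOpen_inter_preimage c.open_target c'.open_source
    have h1 := (ContDiffOn.lcSmoothOn ho (contDiffOn_chart_change hc hc') n).comp_clm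
      (ContinuousLinearMap.snd ℝ (SmoothFun E H) E)
      (U' := univ ×ˢ (c.target ∩ c.symm ⁻¹' c'.source)) fun p hp => hp.2
    refine (((ContinuousLinearMap.fst ℝ (SmoothFun E H) E).lcContDiffOn n _).prodMk h1).mono ?_
    rintro p ⟨⟨_, h2⟩, _, h3⟩
    exact ⟨mem_univ _, h2, h3⟩
  smooth_mul := by
    rintro _ ⟨c₁, h₁, rfl⟩ _ ⟨c₂, h₂, rfl⟩ _ ⟨c₃, h₃, rfl⟩ n
    have ho : IsOpen ((c₁.target ×ˢ c₂.target) ∩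
        (fun p : E × E => c₁.symm p.1 * c₂.symm p.2) ⁻¹' c₃.source) :=
      ((c₁.continuousOn_symm.comp continuousOn_fst fun _ hp => hp.1).mul
        (c₂.continuousOn_symm.comp continuousOn_snd fun _ hp => hp.2)).isOpen_inter_preimage
        (c₁.open_target.prod c₂.open_target) c₃.open_source
    let S : Set ((SmoothFun E H × E) × (SmoothFun E H × E)) := {p |
      (p.1.2, p.2.2) ∈ (c₁.target ×ˢ c₂.target) ∩
        (fun p : E × E => c₁.symm p.1 * c₂.symm p.2) ⁻¹' c₃.source}
    let F := SmoothFun E H × E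
    have k11 : LCContDiffOn n (fun p : F × F => p.1.1) S :=
      ((ContinuousLinearMap.fst ℝ (SmoothFun E H) E).comp
        (ContinuousLinearMap.fst ℝ F F)).lcContDiffOn n S
    have k12 : LCContDiffOn n (fun p : F × F => p.1.2) S :=
      ((ContinuousLinearMap.snd ℝ (SmoothFun E H) E).comp
        (ContinuousLinearMap.fst ℝ F F)).lcContDiffOn n S
    have k21 : LCContDiffOn n (fun p : F × F => p.2.1) S :=
      ((ContinuousLinearMap.fst ℝ (SmoothFun E H) E).comp
        (ContinuousLinearMap.snd ℝ F F)).lcContDiffOn n S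
    have k22 : LCContDiffOn n (fun p : F × F => p.2.2) S :=
      ((ContinuousLinearMap.snd ℝ (SmoothFun E H) E).comp
        (ContinuousLinearMap.snd ℝ F F)).lcContDiffOn n S
    have k1 := k11.add (LCContDiffOn.translate h₁ k12 k21 fun p hp => hp.1.1)
    have k2 := (ContDiffOn.lcSmoothOn ho (contDiffOn_chart_mul h₁ h₂ h₃) n).comp ho
      (k12.prodMk k22) fun p hp => hp
    refine (k1.prodMk k2).mono ?_
    rintro p ⟨⟨_, h1⟩, ⟨_, h2⟩, _, h3⟩
    exact ⟨⟨h1, h2⟩, h3⟩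
  smooth_inv := by
    refine ⟨continuous_inv, ?_⟩
    rintro _ ⟨c, hc, rfl⟩ _ ⟨c', hc', rfl⟩ n
    have ho := (c.continuousOn_symm.inv).isOpen_inter_preimage c.open_target c'.open_source
    let S : Set (SmoothFun E H × E) := {p |
      p.2 ∈ c.target ∩ (fun y => (c.symm y)⁻¹) ⁻¹' c'.source}
    have k1 : LCContDiffOn n (fun p : SmoothFun E H × E => p.1) S :=
      (ContinuousLinearMap.fst ℝ (SmoothFun E H) E).lcContDiffOn n S
    have k2 := (ContDiffOn.lcSmoothOn ho (contDiffOn_chart_inv hc hc') n).comp_clm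
      (ContinuousLinearMap.snd ℝ (SmoothFun E H) E) (U' := S) fun p hp => hp
    have k3 := (LCContDiffOn.translate hc' k2 k1 fun p hp => c'.map_source hp.2).neg
    have hS : IsOpen S := ho.preimage continuous_snd
    refine ((k3.prodMk k2).congr hS (g := fun p =>
      (-SmoothFun.translate (c.symm p.2)⁻¹ p.1, c' (c.symm p.2)⁻¹)) fun p hp => ?_).mono ?_
    · have h1 : c'.symm (c' (c.symm p.2)⁻¹) = (c.symm p.2)⁻¹ := c'.left_inv hp.2
      simp [h1]
    · rintro p ⟨⟨_, h1⟩, _, h2⟩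
      exact ⟨h1, h2⟩

/-- The homomorphism `h ↦ (v - ρ(h) v, h)` into the semidirect product. It is the conjugate by `v`
of the inclusion of `H`, and coincides with it exactly on the stabilizer of `v`. -/
noncomputable def conjInl (v : SmoothFun E H) : H →* SmoothSemidirect E H where
  toFun h := (v - SmoothFun.translate h v, h)
  map_one' := Prod.ext (by
    change v - SmoothFun.translate 1 v = 0
    rw [SmoothFun.translate_one, sub_self]) rfl
  map_mul' g h := Prod.ext (by
    change v - SmoothFun.translate (g * h) v =
      v - SmoothFun.translate g v + SmoothFun.translate g (v - SmoothFun.translate h v)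
    rw [SmoothFun.translate_sub, SmoothFun.translate_mul]
    abel) rfl

theorem lcSmooth_conjInl (v : SmoothFun E H) :
    LCSmooth E (SmoothFun E H × E) (conjInl v) := by
  constructor
  · have h1 : Continuous fun h : H => SmoothFun.translate h v :=
      SmoothFun.continuous_translate.comp (continuous_id.prodMk continuous_const)
    have h2 : Continuous fun h : H => (v - SmoothFun.translate h v, h) := by fun_prop
    exact h2
  · rintro c hc _ ⟨c', hc', rfl⟩ n
    have ho := c.continuousOn_symm.isOpen_inter_preimage c.open_target c'.open_source
    have k1 := ContDiffOn.lcSmoothOn ho (contDiffOn_chart_change hc hc') n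
    have k2 : LCContDiffOn n (fun y : E => y) (c.target ∩ c.symm ⁻¹' c'.source) :=
      (ContinuousLinearMap.id ℝ E).lcContDiffOn n _
    have k3 := (LCContDiffOn.const n v (c.target ∩ c.symm ⁻¹' c'.source)).sub
      (LCContDiffOn.translate hc k2 (LCContDiffOn.const n v _) fun y hy => hy.1)
    refine (k3.prodMk k1).mono ?_
    rintro y ⟨h1, _, h2⟩
    exact ⟨h1, h2⟩

theorem conjInl_eq_iff (v : SmoothFun E H) (h : H) :
    conjInl v h = conjInl 0 h ↔ SmoothFun.translate h v = v := by
  change (v - SmoothFun.translate h v, h) = ((0 : SmoothFun E H) - SmoothFun.translate h 0, h) ↔ _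
  rw [SmoothFun.translate_zero, sub_self, Prod.mk.injEq, sub_eq_zero]
  exact ⟨fun h => h.1.symm, fun h => ⟨h.symm, rfl⟩⟩

end Smooth

end SmoothSemidirect

/-! ### Smooth functions invariant under a closed subgroup -/

namespace SmoothFun
open MeasureTheory

section OfContMDiff

variable {E : Type*} [NormedAddCommGroup E] [NormedSpace ℝ E] [FiniteDimensional ℝ E]
  {H : Type*} [Group H] [TopologicalSpace H] [ChartedSpace E H]

/-- The derivative of a function along the left-invariant vector field of a basis vector. -/
noncomputable def leftDeriv (i : Fin (Module.finrank ℝ E)) (u : H → ℝ) (x : H) : ℝ :=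
  fderiv ℝ (fun z => u (x * (chartAt E (1 : H)).symm z)) (chartAt E (1 : H) 1)
    (Module.finBasis ℝ E i)

variable [LieGroup 𝓘(ℝ, E) ∞ H]

theorem contDiffOn_mul_chart {u : H → ℝ} (hu : ContMDiff 𝓘(ℝ, E) 𝓘(ℝ, ℝ) ∞ u)
    {e : OpenPartialHomeomorph H E} (he : e ∈ atlas E H) :
    ContDiffOn ℝ ∞ (fun p : E × E => u (e.symm p.1 * (chartAt E (1 : H)).symm p.2))
      (e.target ×ˢ (chartAt E (1 : H)).target) := by
  rw [← contMDiffOn_iff_contDiffOn]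
  exact hu.comp_contMDiffOn
    ((ContMDiffOn.comp_fst_atlas_symm contDiffOn_fst he fun _ hp => hp.1).mul
      (ContMDiffOn.comp_fst_atlas_symm contDiffOn_snd (chart_mem_atlas E 1) fun _ hp => hp.2))

theorem hasFDerivAt_of_contMDiff {u : H → ℝ} (hu : ContMDiff 𝓘(ℝ, E) 𝓘(ℝ, ℝ) ∞ u) (x : H) :
    HasFDerivAt (fun z => u (x * (chartAt E (1 : H)).symm z))
      (∑ i, leftDeriv i u x • modelCoord E i) (chartAt E (1 : H) 1) := by
  have h1 : ContDiffOn ℝ ∞ (fun z => u (x * (chartAt E (1 : H)).symm z))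
      (chartAt E (1 : H)).target := by
    rw [← contMDiffOn_iff_contDiffOn]
    exact hu.comp_contMDiffOn (contMDiffOn_const.mul (contMDiffOn_atlas_symm (chart_mem_atlas E 1)))
  have h2 := ((h1.contDiffAt ((chartAt E (1 : H)).open_target.mem_nhds
    chartAt_one_mem_target)).differentiableAt (by simp)).hasFDerivAt
  rw [← sum_apply_basis_smul_modelCoord (fderiv ℝ _ _)] at h2
  exact h2

theorem contMDiff_leftDeriv {u : H → ℝ} (hu : ContMDiff 𝓘(ℝ, E) 𝓘(ℝ, ℝ) ∞ u)
    (i : Fin (Module.finrank ℝ E)) : ContMDiff 𝓘(ℝ, E) 𝓘(ℝ, ℝ) ∞ (leftDeriv (H := H) i u) := by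
  intro h
  set e := chartAt E h
  have h1 : ContDiffOn ℝ ∞ (fun y => fderiv ℝ (fun w => u (e.symm y *
      (chartAt E (1 : H)).symm w)) (chartAt E (1 : H) 1) (Module.finBasis ℝ E i)) e.target :=
    (ContDiffOn.partial_fderiv (e.open_target.prod (chartAt E (1 : H)).open_target)
      (contDiffOn_mul_chart hu (chart_mem_atlas E h)) contDiffOn_const
      fun y hy => ⟨hy, chartAt_one_mem_target⟩).clm_apply contDiffOn_const
  have h2 := h1.contMDiffOn.comp (contMDiffOn_atlas (chart_mem_atlas E h)) e.mapsTo
  refine (h2.congr fun x hx => ?_).contMDiffAt (e.open_source.mem_nhds (mem_chart_source E h))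
  simp only [Function.comp, leftDeriv, e, (chartAt E h).left_inv hx]

theorem contMDiff_foldr_leftDeriv {u : H → ℝ} (hu : ContMDiff 𝓘(ℝ, E) 𝓘(ℝ, ℝ) ∞ u)
    (α : List (Fin (Module.finrank ℝ E))) :
    ContMDiff 𝓘(ℝ, E) 𝓘(ℝ, ℝ) ∞ (α.foldr leftDeriv u : H → ℝ) := by
  induction α with
  | nil => exact hu
  | cons i α ih => exact contMDiff_leftDeriv ih i

/-- A smooth function on `H`, together with all its left-invariant derivatives. -/
noncomputable def ofContMDiff (u : H → ℝ) (hu : ContMDiff 𝓘(ℝ, E) 𝓘(ℝ, ℝ) ∞ u) :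
    SmoothFun E H :=
  ⟨fun α => ⟨α.foldr leftDeriv u, (contMDiff_foldr_leftDeriv hu α).continuous⟩, fun α x =>
    hasFDerivAt_of_contMDiff (contMDiff_foldr_leftDeriv hu α) x⟩

/-- Left-invariant derivatives do not enlarge supports. -/
theorem ofContMDiff_eq_zero [IsTopologicalGroup H] {u : H → ℝ}
    (hu : ContMDiff 𝓘(ℝ, E) 𝓘(ℝ, ℝ) ∞ u) {S : Set H} (hS : IsClosed S) (h0 : ∀ x ∉ S, u x = 0)
    (α : List (Fin (Module.finrank ℝ E))) {x : H} (hx : x ∉ S) :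
    (ofContMDiff u hu).1 α x = 0 := by
  change (α.foldr leftDeriv u : H → ℝ) x = 0
  induction α generalizing x with
  | nil => exact h0 x hx
  | cons i α ih =>
    rw [List.foldr_cons]
    have hc : ContinuousAt (fun z => x * (chartAt E (1 : H)).symm z) (chartAt E (1 : H) 1) :=
      continuousAt_const.mul ((chartAt E (1 : H)).continuousAt_symm chartAt_one_mem_target)
    have hev : (fun z => (α.foldr leftDeriv u : H → ℝ) (x * (chartAt E (1 : H)).symm z))
        =ᶠ[𝓝 (chartAt E (1 : H) 1)] fun _ => 0 := by
      filter_upwards [hc.eventually_mem (hS.isOpen_compl.mem_nhds (by simpa using hx))] with z hz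
      exact ih hz
    rw [leftDeriv, hev.fderiv_eq]
    simp

end OfContMDiff

section Invariant
open scoped Pointwise

variable {E : Type*} [NormedAddCommGroup E] [NormedSpace ℝ E] [FiniteDimensional ℝ E]
  {H : Type*} [Group H] [TopologicalSpace H] [ChartedSpace E H] [T2Space H]
  [IsTopologicalGroup H] [LieGroup 𝓘(ℝ, E) ∞ H] [LocallyCompactSpace H]

/-- A point outside a closed subgroup `L` can be separated from `L` by a symmetric neighbourhood
`O` of `1`: the point does not lie in `O * O * L`. -/
theorem _root_.Subgroup.exists_isOpen_symm_forall_mul_ne {L : Subgroup H}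
    (hL : IsClosed (L : Set H)) {h₀ : H} (h : h₀ ∉ L) :
    ∃ O : Set H, IsOpen O ∧ (1 : H) ∈ O ∧ (∀ x ∈ O, x⁻¹ ∈ O) ∧
      ∀ x ∈ O, ∀ y ∈ O, ∀ l ∈ L, x * y * l ≠ h₀ := by
  have h1 : {g : H | g⁻¹ * h₀ ∉ L} ∈ 𝓝 (1 : H) := by
    have hc : Continuous fun g : H => g⁻¹ * h₀ := by fun_prop
    exact (hL.isOpen_compl.preimage hc).mem_nhds (by simpa using h)
  obtain ⟨W, hW, hW1, hWs⟩ := exists_open_nhds_one_split h1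
  refine ⟨W ∩ W⁻¹, hW.inter hW.inv, ⟨hW1, by simpa using hW1⟩, fun x hx => ⟨hx.2, by
    simpa using hx.1⟩, fun x hx y hy l hl heq => ?_⟩
  refine hWs x hx.1 y hy.1 ?_
  have : (x * y)⁻¹ * h₀ = l := by rw [← heq]; group
  rwa [this]

/-- For a proper closed subgroup `L` of a Lie group `H`, some smooth function on `H` is invariant
under right translations by `L`, but not under all right translations. It is obtained by smoothing
the indicator function of a set `O L` by convolution with a bump function. -/
theorem exists_invariant {L : Subgroup H} (hL : IsClosed (L : Set H)) (hne : L ≠ ⊤) :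
    ∃ v : SmoothFun E H, (∀ l ∈ L, translate l v = v) ∧ ∃ h : H, translate h v ≠ v := by
  obtain ⟨h₀, hh₀⟩ : ∃ h₀, h₀ ∉ L := by
    by_contra! h
    exact hne ((Subgroup.eq_top_iff' L).2 h)
  obtain ⟨O, hO, hO1, hOinv, hOL⟩ := Subgroup.exists_isOpen_symm_forall_mul_ne hL hh₀
  obtain ⟨b, -, hbO⟩ := (SmoothBumpFunction.nhds_basis_tsupport (I := 𝓘(ℝ, E)) (1 : H)).mem_iff.1
    (hO.mem_nhds hO1)
  let _ : MeasurableSpace H := borel H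
  have : BorelSpace H := ⟨rfl⟩
  -- `v(x)` is the Haar integral of `b(x y)` over `y ∈ S = (O L)⁻¹`; left translation by `l ∈ L` maps
  -- `S` to itself, which gives the invariance, and `v(1) > 0 = v(h₀)`
  set S : Set H := {y | ∃ o ∈ O, ∃ l ∈ L, o * l = y⁻¹} with hSdef
  have hS : IsOpen S := by
    have : S = ⋃ l ∈ L, (fun y : H => y⁻¹ * l⁻¹) ⁻¹' O := by
      ext y
      simp only [hSdef, mem_ofPred_eq, mem_iUnion, mem_preimage, exists_prop]
      constructor
      · rintro ⟨o, ho, l, hl, h⟩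
        exact ⟨l, hl, by rw [← h]; simpa using ho⟩
      · rintro ⟨l, hl, h⟩
        exact ⟨_, h, l, hl, by group⟩
    rw [this]
    exact isOpen_biUnion fun l _ => hO.preimage (by fun_prop)
  let μ : Measure H := Measure.haar
  let bV : SmoothFun E H := ofContMDiff b b.contMDiff
  have hb0 : ∀ α, ∀ x ∉ tsupport b, bV.1 α x = 0 := fun α x hx =>
    ofContMDiff_eq_zero b.contMDiff (isClosed_tsupport _)
      (fun x hx => image_eq_zero_of_notMem_tsupport hx) α hx
  obtain ⟨v, hv⟩ := exists_integral (μ.restrict S) (fun y : H => translate y bV)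
    (continuous_translate.comp (continuous_id.prodMk continuous_const)) (by
      intro x₀
      obtain ⟨N, hN, hN'⟩ := exists_compact_mem_nhds x₀
      refine ⟨N, hN', N⁻¹ * tsupport b, hN.inv.mul b.hasCompactSupport.isCompact,
        fun y hy x hx α => translateEntry_eq_zero hb0 y α fun hmem => hy ?_⟩
      exact ⟨x⁻¹, by simpa using hx, x * y, hmem, by group⟩)
  have hv' : ∀ x, v.1 [] x = ∫ y in S, b (x * y) ∂μ := fun x => hv [] x
  refine ⟨v, fun l hl => ?_, h₀, fun heq => ?_⟩
  · ext x
    rw [translate_nil_apply, hv', hv', ← integral_indicator hS.measurableSet,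
      ← integral_indicator hS.measurableSet,
      ← integral_mul_left_eq_self (S.indicator fun y => b (x * y)) l]
    refine integral_congr_ae (Eventually.of_forall fun y => ?_)
    have hmem : l * y ∈ S ↔ y ∈ S := by
      constructor
      · rintro ⟨o, ho, l', hl', h⟩
        exact ⟨o, ho, l' * l, L.mul_mem hl' hl, by rw [← mul_assoc, h]; group⟩
      · rintro ⟨o, ho, l', hl', h⟩
        exact ⟨o, ho, l' * l⁻¹, L.mul_mem hl' (L.inv_mem hl), by rw [← mul_assoc, h]; group⟩
    beta_reduce
    by_cases hy : y ∈ S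
    · rw [indicator_of_mem hy, indicator_of_mem (hmem.2 hy), mul_assoc]
    · rw [indicator_of_notMem hy, indicator_of_notMem (mt hmem.1 hy)]
  · have h1 : v.1 [] 1 = ∫ y, b y ∂μ := by
      rw [hv']
      simp only [one_mul]
      refine setIntegral_eq_integral_of_forall_compl_eq_zero fun y hy => ?_
      refine image_eq_zero_of_notMem_tsupport fun hy' => hy ?_
      exact ⟨y⁻¹, hOinv y (hbO hy'), 1, L.one_mem, mul_one _⟩
    have h2 : v.1 [] h₀ = 0 := by
      rw [hv']
      refine setIntegral_eq_zero_of_forall_eq_zero fun y hy => ?_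
      refine image_eq_zero_of_notMem_tsupport fun hy' => ?_
      obtain ⟨o, ho, l, hl, h⟩ := hy
      refine hOL _ (hbO hy') o ho l hl ?_
      rw [mul_assoc, h]
      group
    have h3 : 0 < ∫ y, b y ∂μ :=
      b.continuous.integral_pos_of_hasCompactSupport_nonneg_nonzero b.hasCompactSupport
        (fun _ => b.nonneg) (x := 1) (by rw [b.eq_one]; exact one_ne_zero)
    have h4 := congrArg (fun w : SmoothFun E H => w.1 [] 1) heq
    simp only [translate_nil_apply, one_mul, h1, h2] at h4
    exact h3.ne h4

end Invariant

end SmoothFun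

section Dense

variable {E : Type u} [NormedAddCommGroup E] [NormedSpace ℝ E] [FiniteDimensional ℝ E]
  {G H : Type u} [Group G] [Group H] [TopologicalSpace H] [ChartedSpace E H] [T2Space H]
  [IsTopologicalGroup H] [LieGroup 𝓘(ℝ, E) ∞ H] [LocallyCompactSpace H]

/-- If the image of `f` is determined by homomorphisms into the semidirect product
`C^∞(H) ⋊ H`, then it is dense. -/
theorem denseRange_of_conjInl (f : G →* H)
    (h : ∀ v : SmoothFun E H, (SmoothSemidirect.conjInl v).comp f =
      (SmoothSemidirect.conjInl 0).comp f →
      SmoothSemidirect.conjInl v = SmoothSemidirect.conjInl 0) : DenseRange f := by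
  by_contra hd
  have hne : f.range.topologicalClosure ≠ ⊤ := fun htop => hd fun x => by
    have : x ∈ f.range.topologicalClosure := htop ▸ Subgroup.mem_top x
    rwa [← SetLike.mem_coe, Subgroup.topologicalClosure_coe, MonoidHom.coe_range] at this
  obtain ⟨v, hv, x, hx⟩ := SmoothFun.exists_invariant (E := E)
    (Subgroup.isClosed_topologicalClosure f.range) hne
  refine hx ((SmoothSemidirect.conjInl_eq_iff v x).1 (DFunLike.congr_fun (h v ?_) x))
  ext1 g
  exact (SmoothSemidirect.conjInl_eq_iff v (f g)).2
    (hv _ (Subgroup.le_topologicalClosure _ ⟨g, rfl⟩))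

/-- The semidirect product is a Lie group modelled on a complete space, hence an admissible target. -/
theorem IsEpiLCLieGroup.denseRange (f : G →* H) (h : IsEpiLCLieGroup E f) : DenseRange f :=
  denseRange_of_conjInl (E := E) f fun v hv => h (SmoothFun E H × E) (SmoothSemidirect E H) _ _
    (SmoothSemidirect.lcSmooth_conjInl v) (SmoothSemidirect.lcSmooth_conjInl 0) hv

end Dense

/-! ### Separation of open subgroups by discrete groups -/

section DiscreteGroups

/-- Two homomorphisms from `H` that agree on a proper subgroup `H₁`, are distinct, and are trivial
on a given normal subgroup `N ≤ H₁`. They exist because epimorphisms of groups are surjective, which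
is applied to the inclusion of `H₁ / N` into `H / N`. -/
theorem exists_ne_hom_of_subgroup_ne_top {H : Type u} [Group H] (N H₁ : Subgroup H) [N.Normal]
    (hN : N ≤ H₁) (hH₁ : H₁ ≠ ⊤) :
    ∃ (K : Type u) (_ : Group K) (g₁ g₂ : H →* K), g₁ ≠ g₂ ∧ (∀ x ∈ H₁, g₁ x = g₂ x) ∧
      (∀ x ∈ N, g₁ x = 1) ∧ ∀ x ∈ N, g₂ x = 1 := by
  let π := QuotientGroup.mk' N
  let i := GrpCat.ofHom (H₁.map π).subtype
  have hi : ¬ CategoryTheory.Epi i := by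
    intro hepi
    refine hH₁ ((Subgroup.eq_top_iff' _).2 fun x => ?_)
    obtain ⟨⟨_, y, hy, rfl⟩, hxy⟩ := GrpCat.surjective_of_epi i (π x)
    have hxy' : π y = π x := hxy
    have h1 : y⁻¹ * x ∈ N := QuotientGroup.eq.1 hxy'
    simpa using H₁.mul_mem hy (hN h1)
  obtain ⟨K, a, b, hab, hne⟩ : ∃ (K : GrpCat.{u}) (a b : GrpCat.of (H ⧸ N) ⟶ K),
      CategoryTheory.CategoryStruct.comp i a = CategoryTheory.CategoryStruct.comp i b ∧ a ≠ b := by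
    by_contra! h
    exact hi ⟨fun a b hab => h _ a b hab⟩
  have hker : ∀ (c : GrpCat.of (H ⧸ N) ⟶ K), ∀ x ∈ N, c.hom.comp π x = 1 := fun c x hx => by
    have : π x = 1 := (QuotientGroup.eq_one_iff x).2 hx
    rw [MonoidHom.comp_apply, this]
    exact map_one _
  refine ⟨K, inferInstance, a.hom.comp π, b.hom.comp π, fun h => hne ?_, fun x hx => ?_,
    hker a, hker b⟩
  · refine GrpCat.hom_ext (MonoidHom.ext fun q => ?_)
    obtain ⟨x, rfl⟩ := QuotientGroup.mk'_surjective N q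
    exact DFunLike.congr_fun h x
  · have h1 := congrArg (fun c => c.hom ⟨π x, x, hx, rfl⟩) hab
    exact h1

theorem LCSmoothOn.of_subsingleton {E : Type u} [AddCommGroup E] [Module ℝ E] [TopologicalSpace E]
    {F : Type v} [AddCommGroup F] [Module ℝ F] [TopologicalSpace F] [Subsingleton F]
    (f : E → F) (U : Set E) : LCSmoothOn f U := fun n => by
  have : f = fun _ => 0 := funext fun _ => Subsingleton.elim _ _
  rw [this]
  exact LCContDiffOn.const n 0 U

variable {F : Type u} [AddCommGroup F] [Module ℝ F] [TopologicalSpace F] [Subsingleton F]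
  {K : Type v} [Group K] [TopologicalSpace K] [DiscreteTopology K] [ChartedSpace F K]

/-- Discrete groups are zero-dimensional Lie groups. -/
theorem LCLieGroup.of_discreteTopology : LCLieGroup F K where
  smooth_chart_change _ _ _ _ := LCSmoothOn.of_subsingleton _ _
  smooth_mul _ _ _ _ _ _ := LCSmoothOn.of_subsingleton _ _
  smooth_inv := ⟨continuous_of_discreteTopology, fun _ _ _ _ => LCSmoothOn.of_subsingleton _ _⟩

theorem HasCurveDerivAt.of_subsingleton (c : unitInterval → F) (t : unitInterval) (w : F) :
    HasCurveDerivAt c t w := by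
  refine tendsto_const_nhds.congr fun s => Subsingleton.elim _ _

/-- The model space is trivial, so the constant curve `1` is the evolution of the only curve in it. -/
theorem IsRegularLieGroup.of_discreteTopology [IsTopologicalAddGroup F] [ContinuousSMul ℝ F] :
    IsRegularLieGroup F K := by
  refine ⟨fun _ => 1, ⟨continuous_const, fun _ _ _ _ => LCSmoothOn.of_subsingleton _ _⟩,
    fun ξ => ⟨fun _ => 1, ⟨continuous_const, fun e _ => ?_⟩, rfl,
      fun t => HasCurveDerivAt.of_subsingleton _ _ _, rfl⟩⟩
  exact ⟨fun _ _ => 0, fun _ _ => Subsingleton.elim _ _, fun n => ⟨continuousOn_const,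
    fun t _ => HasCurveDerivAt.of_subsingleton _ _ _⟩⟩

/-- A homomorphism to a discrete group that is trivial near `1` is continuous, and then smooth, the
target being zero-dimensional. -/
theorem LCSmooth.of_trivial_on_nhds {E : Type u} [AddCommGroup E] [Module ℝ E] [TopologicalSpace E]
    {H : Type u} [Group H] [TopologicalSpace H] [IsTopologicalGroup H] [ChartedSpace E H]
    (g : H →* K) (hg : ∀ᶠ x in 𝓝 (1 : H), g x = 1) : LCSmooth E F g := by
  refine ⟨continuous_of_continuousAt_one g ?_, fun _ _ _ _ => LCSmoothOn.of_subsingleton _ _⟩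
  refine tendsto_const_nhds.congr' ?_
  filter_upwards [hg] with x hx
  rw [hx, map_one]

end DiscreteGroups

section SigmaCompact

/-- A subgroup generated by a `σ`-compact set is `σ`-compact. -/
theorem IsSigmaCompact.subgroup_closure {H : Type*} [Group H] [TopologicalSpace H]
    [IsTopologicalGroup H] {S : Set H} (hS : IsSigmaCompact S) :
    IsSigmaCompact (Subgroup.closure S : Set H) := by
  -- `P n` consists of the words of length `n` in `S ∪ S⁻¹`
  let P : ℕ → Set H := fun n =>
    Nat.rec (motive := fun _ => Set H) {1} (fun _ Q => image2 (· * ·) Q (S ∪ S⁻¹)) n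
  have hT : IsSigmaCompact (S ∪ S⁻¹) := by
    have hinv : IsSigmaCompact S⁻¹ := by
      rw [← image_inv_eq_inv]
      exact hS.image continuous_inv
    rw [union_eq_iUnion]
    exact isSigmaCompact_iUnion _ (by rintro (_ | _) <;> assumption)
  have hP : ∀ n, IsSigmaCompact (P n) := by
    intro n
    induction n with
    | zero => exact isCompact_singleton.isSigmaCompact
    | succ n ih =>
      have : SigmaCompactSpace ↥(P n) := isSigmaCompact_iff_sigmaCompactSpace.1 ih
      have : SigmaCompactSpace ↥(S ∪ S⁻¹) := isSigmaCompact_iff_sigmaCompactSpace.1 hT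
      have h1 : P (n + 1) = range fun p : ↥(P n) × ↥(S ∪ S⁻¹) => p.1.1 * p.2.1 := by
        ext x
        constructor
        · rintro ⟨a, ha, b, hb, rfl⟩
          exact ⟨(⟨a, ha⟩, ⟨b, hb⟩), rfl⟩
        · rintro ⟨⟨⟨a, ha⟩, ⟨b, hb⟩⟩, rfl⟩
          exact ⟨a, ha, b, hb, rfl⟩
      rw [h1]
      exact isSigmaCompact_range (by fun_prop)
  have hU : (Subgroup.closure S : Set H) = ⋃ n, P n := by
    ext x
    rw [SetLike.mem_coe, ← Subgroup.mem_toSubmonoid, Subgroup.closure_toSubmonoid, mem_iUnion]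
    constructor
    · intro hx
      induction hx using Submonoid.closure_induction_right with
      | one => exact ⟨0, rfl⟩
      | mul_right a _ b hb ih =>
        obtain ⟨n, hn⟩ := ih
        exact ⟨n + 1, a, hn, b, hb, rfl⟩
    · rintro ⟨n, hn⟩
      induction n generalizing x with
      | zero =>
        have hx : x = 1 := hn
        exact hx ▸ Submonoid.one_mem _
      | succ n ih =>
        obtain ⟨a, ha, b, hb, rfl⟩ := hn
        exact Submonoid.mul_mem _ (ih a ha) (Submonoid.subset_closure hb)
  rw [hU]
  exact isSigmaCompact_iUnion _ hP

/-- If `f : G → H` is an epimorphism of regular Fréchet–Lie groups and `G` is `σ`-compact, then so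
is `H`: otherwise the open subgroup generated by `f(G)` and a compact neighbourhood of `1` would be
proper, and discrete groups would separate it from `H`. -/
theorem IsEpiRegularFrechetLieGroup.sigmaCompactSpace {E : Type u} [NormedAddCommGroup E]
    [NormedSpace ℝ E] [FiniteDimensional ℝ E]
    {G H : Type u} [Group G] [TopologicalSpace G] [SigmaCompactSpace G] [Group H]
    [TopologicalSpace H] [ChartedSpace E H] [IsTopologicalGroup H] [LocallyCompactSpace H]
    {f : G →* H} (hf : Continuous f) (h : IsEpiRegularFrechetLieGroup E f) :
    SigmaCompactSpace H := by
  obtain ⟨C, hC, hC1⟩ := exists_compact_mem_nhds (1 : H)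
  have hσ : IsSigmaCompact (range f ∪ C) := by
    rw [union_eq_iUnion]
    refine isSigmaCompact_iUnion _ ?_
    rintro (_ | _)
    · exact hC.isSigmaCompact
    · exact isSigmaCompact_range hf
  set H₁ := Subgroup.closure (range f ∪ C) with hH₁
  suffices htop : H₁ = ⊤ by
    have h1 := hσ.subgroup_closure
    rw [← hH₁, htop] at h1
    exact isSigmaCompact_univ_iff.1 h1
  by_contra hne
  have hnhds : (H₁ : Set H) ∈ 𝓝 (1 : H) :=
    mem_of_superset hC1 (subset_union_right.trans Subgroup.subset_closure)
  have hopen : IsOpen (H₁ : Set H) := Subgroup.isOpen_of_mem_nhds H₁ hnhds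
  have hclopen : IsClopen (H₁ : Set H) := ⟨Subgroup.isClosed_of_isOpen H₁ hopen, hopen⟩
  have hlc : LocallyConnectedSpace H := ChartedSpace.locallyConnectedSpace E H
  -- homomorphisms that are trivial on the open subgroup `N` are smooth, whatever they are elsewhere
  let N := Subgroup.connectedComponentOfOne H
  have hNn : N.Normal := ⟨fun x hx g => by
    have hc : Continuous fun y : H => g * y * g⁻¹ := by fun_prop
    have h1 := hc.image_connectedComponent_subset 1 (mem_image_of_mem _ hx)
    rw [mul_one, mul_inv_cancel] at h1
    exact h1⟩
  have hNo : (N : Set H) ∈ 𝓝 (1 : H) := isOpen_connectedComponent.mem_nhds mem_connectedComponent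
  obtain ⟨K, _, g₁, g₂, hg, hagree, ht₁, ht₂⟩ := exists_ne_hom_of_subgroup_ne_top N H₁
    (hclopen.connectedComponent_subset H₁.one_mem) hne
  let _ : TopologicalSpace K := ⊥
  have : DiscreteTopology K := ⟨rfl⟩
  let _ : ChartedSpace PUnit.{u + 1} K := ChartedSpace.ofDiscreteTopology
  have : LCLieGroup PUnit.{u + 1} K := LCLieGroup.of_discreteTopology
  refine hg (h PUnit.{u + 1} K IsRegularLieGroup.of_discreteTopology g₁ g₂ ?_ ?_ ?_)
  · exact LCSmooth.of_trivial_on_nhds g₁ (mem_of_superset hNo ht₁)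
  · exact LCSmooth.of_trivial_on_nhds g₂ (mem_of_superset hNo ht₂)
  · ext1 x
    exact hagree _ (Subgroup.subset_closure (Or.inl ⟨x, rfl⟩))

end SigmaCompact

/-! ### Smooth dependence of solutions of differential equations on parameters -/

section Nemytskii

variable {E Z : Type*} [NormedAddCommGroup E] [NormedSpace ℝ E]
  [NormedAddCommGroup Z] [NormedSpace ℝ Z]

/-- Pointwise evaluation of a continuous family of operators on a continuous curve. -/
noncomputable def pointwiseApply (E Z : Type*) [NormedAddCommGroup E] [NormedSpace ℝ E]
    [NormedAddCommGroup Z] [NormedSpace ℝ Z] :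
    C(unitInterval, E →L[ℝ] Z) →L[ℝ] C(unitInterval, E) →L[ℝ] C(unitInterval, Z) :=
  LinearMap.mkContinuous₂
    (LinearMap.mk₂ ℝ (fun (A : C(unitInterval, E →L[ℝ] Z)) (h : C(unitInterval, E)) =>
        (⟨fun t => A t (h t), by fun_prop⟩ : C(unitInterval, Z)))
      (fun _ _ _ => by ext; simp) (fun _ _ _ => by ext; simp)
      (fun _ _ _ => by ext; simp) (fun _ _ _ => by ext; simp)) 1
    fun A h => by
      rw [one_mul]
      refine (ContinuousMap.norm_le _ (by positivity)).2 fun t => ?_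
      exact ((A t).le_opNorm (h t)).trans (mul_le_mul (A.norm_coe_le_norm t)
        (h.norm_coe_le_norm t) (norm_nonneg _) (norm_nonneg A))

theorem contDiff_pointwiseApply {n : WithTop ℕ∞} :
    ContDiff ℝ n fun A : C(unitInterval, E →L[ℝ] Z) => pointwiseApply E Z A := by
  fun_prop

/-- The superposition operator `y ↦ g ∘ y` on `C([0,1], E)` has the derivative `h ↦ (g' ∘ y) h`. -/
theorem hasFDerivAt_postcomp {g : C(E, Z)} {g' : C(E, E →L[ℝ] Z)}
    (hg : ∀ x, HasFDerivAt g (g' x) x) (y : C(unitInterval, E)) :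
    HasFDerivAt (fun y : C(unitInterval, E) => g.comp y) (pointwiseApply E Z (g'.comp y)) y := by
  rw [hasFDerivAt_iff_isLittleO_nhds_zero, Asymptotics.isLittleO_iff]
  intro ε hε
  have hc : Continuous fun y : C(unitInterval, E) => g'.comp y := ContinuousMap.continuous_postcomp g'
  obtain ⟨δ, hδ, hball⟩ := (Metric.continuousAt_iff (f := fun y : C(unitInterval, E) => g'.comp y)
    (a := y)).1 hc.continuousAt ε hε
  filter_upwards [Metric.ball_mem_nhds (0 : C(unitInterval, E)) hδ] with h hh
  rw [mem_ball_zero_iff] at hh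
  refine (ContinuousMap.norm_le _ (by positivity)).2 fun t => ?_
  have hseg : ∀ z ∈ Metric.ball (y t) δ, ‖g' z - g' (y t)‖ ≤ ε := by
    intro z hz
    have h1 : dist (y + ContinuousMap.const _ (z - y t)) y < δ := by
      rw [dist_eq_norm, add_sub_cancel_left]
      refine lt_of_le_of_lt ((ContinuousMap.norm_le _ (norm_nonneg (z - y t))).2
        fun s => le_rfl) ?_
      rwa [← dist_eq_norm]
    have h2 := (ContinuousMap.dist_apply_le_dist t).trans_lt (hball h1)
    rw [dist_eq_norm] at h2
    simpa using h2.le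
  have hmem : y t + h t ∈ Metric.ball (y t) δ := by
    rw [mem_ball_iff_norm, add_sub_cancel_left]
    exact (h.norm_coe_le_norm t).trans_lt hh
  have key := (convex_ball (y t) δ).norm_image_sub_le_of_norm_hasFDerivWithin_le'
    (f := g) (f' := fun z => g' z) (φ := g' (y t)) (fun z _ => (hg z).hasFDerivWithinAt)
    hseg (Metric.mem_ball_self hδ) hmem
  rw [add_sub_cancel_left] at key
  exact key.trans (mul_le_mul_of_nonneg_left (h.norm_coe_le_norm t) hε.le)

/-- The superposition operator of a smooth map is smooth on spaces of continuous curves. -/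
theorem contDiff_postcomp {E Z : Type u} [NormedAddCommGroup E] [NormedSpace ℝ E]
    [NormedAddCommGroup Z] [NormedSpace ℝ Z] {g : C(E, Z)} (hg : ContDiff ℝ ∞ g) :
    ContDiff ℝ ∞ (fun y : C(unitInterval, E) => g.comp y) := by
  rw [contDiff_infty]
  intro n
  induction n generalizing Z with
  | zero =>
    exact contDiff_zero.2 (ContinuousMap.continuous_postcomp g)
  | succ n ih =>
    have hd : ContDiff ℝ ∞ (fderiv ℝ g) := hg.fderiv_right (by simp)
    let g' : C(E, E →L[ℝ] Z) := ⟨fderiv ℝ g, hd.continuous⟩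
    push_cast
    rw [contDiff_succ_iff_hasFDerivAt]
    refine ⟨fun y => pointwiseApply E Z (g'.comp y), ?_, fun y => hasFDerivAt_postcomp
      (fun x => (hg.differentiable (by simp) x).hasFDerivAt) y⟩
    exact contDiff_pointwiseApply.comp (ih (g := g') hd)

end Nemytskii

section Primitive

variable {E : Type*} [NormedAddCommGroup E] [NormedSpace ℝ E]

theorem hasCurveDerivAt_of_hasDerivAt {f : ℝ → E} {t : unitInterval} {w : E}
    (h : HasDerivAt f w t) : HasCurveDerivAt (fun s : unitInterval => f s) t w := by
  have h1 : Tendsto (fun s : unitInterval => (s : ℝ)) (𝓝[≠] t) (𝓝[≠] (t : ℝ)) := by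
    refine tendsto_nhdsWithin_iff.2 ⟨continuous_subtype_val.continuousAt.mono_left
      nhdsWithin_le_nhds, ?_⟩
    filter_upwards [self_mem_nhdsWithin] with s hs
    exact fun h => hs (Subtype.ext h)
  refine ((hasDerivAt_iff_tendsto_slope.1 h).comp h1).congr fun s => ?_
  simp [slope, vsub_eq_sub]

theorem HasCurveDerivAt.hasDerivWithinAt {c : unitInterval → E} {t : unitInterval} {w : E}
    (h : HasCurveDerivAt c t w) :
    HasDerivWithinAt (IccExtend zero_le_one c) w (Icc 0 1) t := by
  rw [hasDerivWithinAt_iff_tendsto_slope]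
  have h1 : Tendsto (projIcc (0 : ℝ) 1 zero_le_one) (𝓝[Icc 0 1 \ {(t : ℝ)}] (t : ℝ)) (𝓝[≠] t) := by
    refine tendsto_nhdsWithin_iff.2 ⟨?_, ?_⟩
    · have := (continuous_projIcc (a := (0 : ℝ)) (b := 1) (h := zero_le_one)).tendsto t
      rw [projIcc_val] at this
      exact this.mono_left nhdsWithin_le_nhds
    · filter_upwards [self_mem_nhdsWithin] with s hs heq
      refine hs.2 ?_
      have := congrArg Subtype.val heq
      rwa [projIcc_of_mem zero_le_one hs.1] at this
  refine (Tendsto.comp h h1).congr' ?_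
  filter_upwards [self_mem_nhdsWithin] with s hs
  simp [slope, IccExtend, projIcc_of_mem zero_le_one hs.1, vsub_eq_sub]

variable [CompleteSpace E]

/-- The primitive `t ↦ ∫₀ᵗ c` of a continuous curve. -/
noncomputable def primitiveCLM (E : Type*) [NormedAddCommGroup E] [NormedSpace ℝ E]
    [CompleteSpace E] : C(unitInterval, E) →L[ℝ] C(unitInterval, E) :=
  have hc : ∀ c : C(unitInterval, E), Continuous (IccExtend zero_le_one c) := fun c =>
    c.continuous.Icc_extend'
  LinearMap.mkContinuous
    { toFun := fun c => ⟨fun t => ∫ s in (0 : ℝ)..t, IccExtend zero_le_one c s,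
        (intervalIntegral.continuous_primitive (fun a b => (hc c).intervalIntegrable a b) 0).comp
          continuous_subtype_val⟩
      map_add' := fun c d => by
        ext t
        exact intervalIntegral.integral_add ((hc c).intervalIntegrable _ _)
          ((hc d).intervalIntegrable _ _)
      map_smul' := fun r c => by
        ext t
        exact intervalIntegral.integral_smul r _ } 1
    fun c => by
      rw [one_mul]
      refine (ContinuousMap.norm_le _ (norm_nonneg _)).2 fun t => ?_
      have h1 := intervalIntegral.norm_integral_le_of_norm_le_const (a := 0) (b := (t : ℝ))
        (f := IccExtend zero_le_one c) (C := ‖c‖) fun s _ => c.norm_coe_le_norm _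
      refine h1.trans ?_
      rw [sub_zero, abs_of_nonneg t.2.1]
      exact mul_le_of_le_one_right (norm_nonneg _) t.2.2

theorem primitiveCLM_zero (c : C(unitInterval, E)) : primitiveCLM E c 0 = 0 :=
  intervalIntegral.integral_same

theorem hasCurveDerivAt_primitiveCLM (c : C(unitInterval, E)) (t : unitInterval) :
    HasCurveDerivAt (primitiveCLM E c) t (c t) := by
  have hc : Continuous (IccExtend zero_le_one c) := c.continuous.Icc_extend'
  have h1 := intervalIntegral.integral_hasDerivAt_right (hc.intervalIntegrable 0 t)
    (hc.stronglyMeasurableAtFilter _ _) hc.continuousAt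
  have h2 := hasCurveDerivAt_of_hasDerivAt h1
  rw [IccExtend_val] at h2
  exact h2

end Primitive

section LocalSolution

variable {E : Type*} [NormedAddCommGroup E] [NormedSpace ℝ E] [CompleteSpace E]

/-- The initial value problem `y' = M(y) X`, `y(0) = c`, has for small `X` a solution on
`[0,1]` that depends smoothly on the curve `X` and stays in a given neighbourhood `W` of `c`.
The solution is obtained from the inverse function theorem in `C([0,1], E)`, applied near `X = 0`, where
the constant curve `c` is a solution. -/
theorem exists_smooth_local_solution {M : E → E →L[ℝ] E} (hM : ContDiff ℝ ∞ M) (c : E) {W : Set E}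
    (hW : W ∈ 𝓝 c) :
    ∃ r > 0, ∃ ψ : C(unitInterval, E) → C(unitInterval, E),
      ContDiffOn ℝ ∞ ψ (Metric.ball 0 r) ∧ ∀ X ∈ Metric.ball (0 : C(unitInterval, E)) r,
        (∀ t, ψ X t ∈ W) ∧ ψ X 0 = c ∧ ∀ t, HasCurveDerivAt (ψ X) t (M (ψ X t) (X t)) := by
  let C := C(unitInterval, E)
  let Mc : C(E, E →L[ℝ] E) := ⟨M, hM.continuous⟩
  let c₀ : C := ContinuousMap.const _ c
  -- `f (X, y) = 0` is the integral equation equivalent to the initial value problem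
  let f : C × C → C := fun p => p.2 - c₀ - primitiveCLM E (pointwiseApply E E (Mc.comp p.2) p.1)
  have hf : ContDiff ℝ ∞ f := by
    have h1 : ContDiff ℝ ∞ fun p : C × C => Mc.comp p.2 :=
      (contDiff_postcomp (g := Mc) hM).comp contDiff_snd
    have h2' : ContDiff ℝ ∞ fun p : C × C => pointwiseApply E E (Mc.comp p.2) :=
      contDiff_pointwiseApply.comp h1
    have h2 : ContDiff ℝ ∞ fun p : C × C => pointwiseApply E E (Mc.comp p.2) p.1 :=
      h2'.clm_apply contDiff_fst
    exact (contDiff_snd.sub contDiff_const).sub ((primitiveCLM E).contDiff.comp h2)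
  let Ψ : C × C → C × C := fun p => (p.1, f p)
  have hΨ : ContDiff ℝ ∞ Ψ := contDiff_fst.prodMk hf
  have hf0 : ∀ y : C, f (0, y) = y - c₀ := fun y => by simp [f]
  -- the derivative at the base point is a shear, hence invertible
  let D : C × C →L[ℝ] C := fderiv ℝ f (0, c₀)
  have hD : HasFDerivAt f D (0, c₀) := (hf.differentiable (by simp) _).hasFDerivAt
  have hDinr : ∀ y : C, D (0, y) = y := by
    intro y
    have h1 := hD.comp c₀ (hasFDerivAt_prodMk_right (𝕜 := ℝ) (0 : C) c₀)
    have h2 : HasFDerivAt (f ∘ fun y => (0, y)) (ContinuousLinearMap.id ℝ C) c₀ :=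
      ((hasFDerivAt_id c₀).sub_const c₀).congr_of_eventuallyEq
        (Eventually.of_forall fun y => hf0 y)
    have h3 := congrArg (fun L : C →L[ℝ] C => L y) (h1.unique h2)
    simpa using h3
  have hDsplit : ∀ p : C × C, D p = D (p.1, 0) + p.2 := fun p => by
    conv_lhs => rw [← Prod.fst_add_snd p, map_add]
    rw [hDinr]
  let Φ : (C × C) ≃L[ℝ] C × C := ContinuousLinearEquiv.equivOfInverse
    ((ContinuousLinearMap.fst ℝ C C).prod D)
    ((ContinuousLinearMap.fst ℝ C C).prod (ContinuousLinearMap.snd ℝ C C -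
      D.comp ((ContinuousLinearMap.inl ℝ C C).comp (ContinuousLinearMap.fst ℝ C C))))
    (fun p => by ext1 <;> simp [hDsplit p]) (fun p => by
      ext1
      · simp
      · simp [hDsplit (p.1, p.2 - D (p.1, 0))])
  have hΨ' : HasFDerivAt Ψ (Φ : C × C →L[ℝ] C × C) (0, c₀) := hasFDerivAt_fst.prodMk hD
  let e := hΨ.contDiffAt.toOpenPartialHomeomorph Ψ hΨ' (by simp)
  have hemem : ((0 : C), c₀) ∈ e.source :=
    hΨ.contDiffAt.mem_toOpenPartialHomeomorph_source hΨ' (by simp)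
  have hecoe : (e : C × C → C × C) = Ψ := rfl
  have he0 : e.symm (0, 0) = (0, c₀) := by
    have h1 : e (0, c₀) = (0, 0) := by
      rw [hecoe]
      simp [Ψ, hf0]
    rw [← h1, e.left_inv hemem]
  have ht0 : ((0 : C), (0 : C)) ∈ e.target := by
    have h1 := e.map_source hemem
    have h2 : e (0, c₀) = (0, 0) := by
      rw [hecoe]
      simp [Ψ, hf0]
    rwa [h2] at h1
  -- near the base point the derivative of `Ψ` stays invertible
  have hinv : ∀ᶠ p in 𝓝 ((0 : C), c₀), ∃ Φ' : (C × C) ≃L[ℝ] C × C,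
      (Φ' : C × C →L[ℝ] C × C) = fderiv ℝ Ψ p := by
    have h1 : Continuous (fderiv ℝ Ψ) := hΨ.continuous_fderiv (by simp)
    have h2 := (ContinuousLinearEquiv.nhds Φ)
    rw [← hΨ'.fderiv] at h2
    exact h1.continuousAt.eventually_mem h2
  obtain ⟨W', hW'sub, hW'o, hW'c⟩ := mem_nhds_iff.1 hW
  have hWnear : ∀ᶠ p in 𝓝 ((0 : C), c₀), ∀ t, p.2 t ∈ W' := by
    have h1 : IsOpen {y : C | MapsTo y univ W'} := ContinuousMap.isOpen_setOfPred_mapsTo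
      isCompact_univ hW'o
    have h2 : ∀ᶠ y in 𝓝 c₀, y ∈ {y : C | MapsTo y univ W'} :=
      h1.mem_nhds fun t _ => hW'c
    have h3 : ∀ᶠ p in 𝓝 ((0 : C), c₀), p.2 ∈ {y : C | MapsTo y univ W'} :=
      continuous_snd.continuousAt.eventually h2
    filter_upwards [h3] with p hp t
    exact hp (mem_univ t)
  have hcont : ContinuousAt (fun X : C => e.symm (X, 0)) 0 := by
    have h1 : ContinuousAt e.symm ((0 : C), (0 : C)) := e.continuousAt_symm ht0
    exact ContinuousAt.comp (f := fun X : C => (X, (0 : C))) h1 (by fun_prop)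
  have hev : ∀ᶠ X in 𝓝 (0 : C), (X, (0 : C)) ∈ e.target ∧
      (∃ Φ' : (C × C) ≃L[ℝ] C × C, (Φ' : C × C →L[ℝ] C × C) = fderiv ℝ Ψ (e.symm (X, 0))) ∧
      ∀ t, (e.symm (X, 0)).2 t ∈ W' := by
    have h0 : ContinuousAt (fun X : C => (X, (0 : C))) 0 := by fun_prop
    have hcont' : Tendsto (fun X : C => e.symm (X, 0)) (𝓝 0) (𝓝 (0, c₀)) := by
      have := hcont.tendsto
      rwa [he0] at this
    exact (h0.eventually_mem (e.open_target.mem_nhds ht0)).and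
      ((hcont'.eventually hinv).and (hcont'.eventually hWnear))
  obtain ⟨r, hr, hball⟩ := Metric.eventually_nhds_iff_ball.1 hev
  refine ⟨r, hr, fun X => (e.symm (X, 0)).2, fun X hX => ?_, fun X hX => ?_⟩
  · obtain ⟨h1, ⟨Φ', h2⟩, -⟩ := hball X hX
    have h3 : HasFDerivAt e (Φ' : C × C →L[ℝ] C × C) (e.symm (X, 0)) := by
      rw [h2, hecoe]
      exact (hΨ.differentiable (by simp) _).hasFDerivAt
    have h4 := e.contDiffAt_symm h1 h3 hΨ.contDiffAt
    exact (contDiffAt_snd.comp X (h4.comp (f := fun X : C => (X, (0 : C))) X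
      (contDiffAt_id.prodMk contDiffAt_const))).contDiffWithinAt
  · obtain ⟨h1, -, h3⟩ := hball X hX
    have h4 : Ψ (e.symm (X, 0)) = (X, 0) := e.right_inv h1
    have h5 : (e.symm (X, 0)).1 = X := congrArg Prod.fst h4
    have h6 : f (e.symm (X, 0)) = 0 := congrArg Prod.snd h4
    set y := (e.symm (X, 0)).2
    have h7 : y = c₀ + primitiveCLM E (pointwiseApply E E (Mc.comp y) X) := by
      have h8 : y - c₀ - primitiveCLM E (pointwiseApply E E (Mc.comp y) (e.symm (X, 0)).1) = 0 := h6
      rw [h5, sub_sub, sub_eq_zero] at h8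
      exact h8
    refine ⟨fun t => hW'sub (h3 t), ?_, fun t => ?_⟩
    · change y 0 = c
      rw [h7, ContinuousMap.add_apply, primitiveCLM_zero, add_zero]
      rfl
    · have h8 := hasCurveDerivAt_primitiveCLM (pointwiseApply E E (Mc.comp y) X) t
      change HasCurveDerivAt y t _
      have h9 : ∀ s, y s = c + primitiveCLM E (pointwiseApply E E (Mc.comp y) X) s := fun s => by
        conv_lhs => rw [h7]
        rfl
      refine Tendsto.congr (f₁ := fun s : unitInterval => ((s : ℝ) - t)⁻¹ •
        (primitiveCLM E (pointwiseApply E E (Mc.comp y) X) s -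
          primitiveCLM E (pointwiseApply E E (Mc.comp y) X) t)) (fun s => ?_) h8
      rw [h9 s, h9 t, add_sub_add_left_eq_sub]

end LocalSolution

/-! ### Evolutions of small curves, and uniqueness of evolutions -/

section Evolution

variable {E : Type*} [NormedAddCommGroup E] [NormedSpace ℝ E] [FiniteDimensional ℝ E]
  {H : Type*} [Group H] [TopologicalSpace H] [ChartedSpace E H]
  [IsTopologicalGroup H] [LieGroup 𝓘(ℝ, E) ∞ H]

/-- `γ` is the evolution of the curve `X` in the Lie algebra: it starts at `1` and has left
logarithmic derivative `X`. In contrast to smooth evolutions, `X` need only be continuous. -/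
def IsEvolution (X : unitInterval → E) (γ : unitInterval → H) : Prop :=
  Continuous γ ∧ γ 0 = 1 ∧ HasLeftLogDeriv E γ X

/-- Near the base point the Maurer–Cartan form has a smooth right inverse; it is cut off so as to be
defined on the whole model space. -/
theorem exists_inverse_maurerCartan (E : Type*) [NormedAddCommGroup E] [NormedSpace ℝ E]
    [FiniteDimensional ℝ E] (H : Type*) [Group H] [TopologicalSpace H] [ChartedSpace E H]
    [IsTopologicalGroup H] [LieGroup 𝓘(ℝ, E) ∞ H] :
    ∃ M : E → E →L[ℝ] E, ContDiff ℝ ∞ M ∧ ∃ W ∈ 𝓝 (chartAt E (1 : H) 1),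
      W ⊆ (chartAt E (1 : H)).target ∧
      ∀ y ∈ W, ∀ a, maurerCartan (chartAt E (1 : H)) y (M y a) = a := by
  set φ := chartAt E (1 : H)
  have hΘ := contDiffOn_maurerCartan (chart_mem_atlas E (1 : H))
  set U : Set E := φ.target ∩ maurerCartan φ ⁻¹'
    range ((↑) : (E ≃L[ℝ] E) → E →L[ℝ] E) with hUdef
  have hU : IsOpen U := hΘ.continuousOn.isOpen_inter_preimage φ.open_target
    (ContinuousLinearEquiv.isOpen)
  have h1U : φ 1 ∈ U := ⟨chartAt_one_mem_target, ContinuousLinearEquiv.refl ℝ E, by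
    rw [maurerCartan_chartAt_one]; rfl⟩
  have hN : ContDiffOn ℝ ∞ (fun y => (maurerCartan φ y).inverse) U := by
    rintro y ⟨hy, e, he⟩
    have h1 : ContDiffAt ℝ ∞ ContinuousLinearMap.inverse (maurerCartan φ y) := by
      rw [← he]
      exact contDiffAt_map_inverse e
    exact (h1.comp y (hΘ.contDiffAt (φ.open_target.mem_nhds hy))).contDiffWithinAt
  obtain ⟨ε, hε, hεU⟩ := Metric.isOpen_iff.1 hU _ h1U
  let b : ContDiffBump (φ 1) := ⟨ε / 4, ε / 2, by positivity, by linarith⟩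
  refine ⟨fun y => b y • (maurerCartan φ y).inverse, ?_, Metric.ball (φ 1) (ε / 4),
    Metric.ball_mem_nhds _ (by positivity), ?_, ?_⟩
  · rw [contDiff_iff_contDiffAt]
    intro y
    by_cases hy : y ∈ U
    · exact b.contDiff.contDiffAt.smul (hN.contDiffAt (hU.mem_nhds hy))
    · have hyt : y ∉ tsupport b := by
        rw [b.tsupport_eq]
        intro h
        exact hy (hεU (Metric.closedBall_subset_ball (by simp [b]; linarith) h))
      have h0 : (fun y => b y • (maurerCartan φ y).inverse) =ᶠ[𝓝 y] fun _ => 0 := by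
        filter_upwards [(isClosed_tsupport b).isOpen_compl.mem_nhds hyt] with z hz
        rw [image_eq_zero_of_notMem_tsupport hz, zero_smul]
      exact contDiffAt_const.congr_of_eventuallyEq h0
  · exact fun y hy => (hεU (Metric.ball_subset_ball (by linarith) hy)).1
  · intro y hy a
    have hb : b y = 1 := b.one_of_mem_closedBall (Metric.ball_subset_closedBall hy)
    obtain ⟨-, e, he⟩ := hεU (Metric.ball_subset_ball (by linarith) hy)
    simp only [hb, one_smul]
    rw [← he, ContinuousLinearMap.inverse_equiv]
    simp

/-- In a chart, the left logarithmic derivative is given by the Maurer–Cartan form. -/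
theorem HasLeftLogDeriv.of_chart {γ : unitInterval → H} {e : OpenPartialHomeomorph H E}
    (he : e ∈ atlas E H) {y : unitInterval → E} (hγ : ∀ t, γ t = e.symm (y t))
    {X : unitInterval → E} {y' : unitInterval → E} (hy : ∀ t, y t ∈ e.target)
    (hy' : ∀ t, HasCurveDerivAt y t (y' t)) (hX : ∀ t, maurerCartan e (y t) (y' t) = X t) :
    HasLeftLogDeriv E γ X := by
  intro t
  have h1 := (hasFDerivAt_maurerCartan he (hy t)).comp_hasCurveDerivAt (hy' t)
  rw [hX] at h1
  simpa only [hγ] using h1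

/-- For small `X`, evolutions exist and their end points depend smoothly on `X`. -/
theorem exists_local_evolution (E : Type*) [NormedAddCommGroup E] [NormedSpace ℝ E]
    [FiniteDimensional ℝ E] (H : Type*) [Group H] [TopologicalSpace H] [ChartedSpace E H]
    [IsTopologicalGroup H] [LieGroup 𝓘(ℝ, E) ∞ H] :
    ∃ r > 0, ∃ σ : C(unitInterval, E) → unitInterval → H,
      (∀ X ∈ Metric.ball (0 : C(unitInterval, E)) r, IsEvolution X (σ X)) ∧
      ContMDiffOn 𝓘(ℝ, C(unitInterval, E)) 𝓘(ℝ, E) ∞ (fun X => σ X 1) (Metric.ball 0 r) := by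
  obtain ⟨M, hM, W, hW, hWt, hMW⟩ := exists_inverse_maurerCartan E H
  obtain ⟨r, hr, ψ, hψ, hsol⟩ := exists_smooth_local_solution hM (chartAt E (1 : H) 1) hW
  refine ⟨r, hr, fun X t => (chartAt E (1 : H)).symm (ψ X t), fun X hX => ?_, ?_⟩
  · obtain ⟨h1, h2, h3⟩ := hsol X hX
    refine ⟨(chartAt E (1 : H)).continuousOn_symm.comp_continuous (ψ X).continuous
      fun t => hWt (h1 t), ?_, HasLeftLogDeriv.of_chart (chart_mem_atlas E 1) (fun _ => rfl)
        (fun t => hWt (h1 t)) h3 fun t => hMW _ (h1 t) _⟩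
    change (chartAt E (1 : H)).symm (ψ X 0) = 1
    rw [h2, chartAt_one_symm_apply]
  · refine ContMDiffOn.comp_fst_atlas_symm ?_ (chart_mem_atlas E (1 : H))
      fun X hX => hWt ((hsol X hX).1 1)
    exact (ContinuousMap.evalCLM ℝ (1 : unitInterval)).contDiff.comp_contDiffOn hψ

theorem eventually_inv_mul_mem_source {γ : unitInterval → H} (hγ : Continuous γ)
    (t : unitInterval) : ∀ᶠ s in 𝓝 t, (γ t)⁻¹ * γ s ∈ (chartAt E (1 : H)).source := by
  have hc : Continuous fun s => (γ t)⁻¹ * γ s := by fun_prop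
  exact hc.continuousAt.eventually_mem ((chartAt E (1 : H)).open_source.mem_nhds (by simp))

/-- The quotient `γ δ⁻¹` of two curves with the same left logarithmic derivative has derivative `0`
in every chart. -/
theorem HasLeftLogDeriv.hasCurveDerivAt_mul_inv {γ δ : unitInterval → H} (hγ : Continuous γ)
    (hδ : Continuous δ) {X : unitInterval → E} (hX : HasLeftLogDeriv E γ X)
    (hX' : HasLeftLogDeriv E δ X) {e : OpenPartialHomeomorph H E} (he : e ∈ atlas E H)
    {t : unitInterval} (ht : γ t * (δ t)⁻¹ ∈ e.source) :
    HasCurveDerivAt (fun s => e (γ s * (δ s)⁻¹)) t 0 := by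
  set φ := chartAt E (1 : H)
  let R : E × E → H := fun p => γ t * φ.symm p.1 * (φ.symm p.2)⁻¹ * (δ t)⁻¹
  have hR : ContMDiffOn 𝓘(ℝ, E × E) 𝓘(ℝ, E) ∞ R (φ.target ×ˢ φ.target) :=
    ((contMDiffOn_const.mul (ContMDiffOn.comp_fst_atlas_symm contDiffOn_fst
      (chart_mem_atlas E 1) fun p hp => hp.1)).mul (ContMDiffOn.comp_fst_atlas_symm contDiffOn_snd
      (chart_mem_atlas E 1) fun p hp => hp.2).inv).mul contMDiffOn_const
  have hφ1 : φ 1 ∈ φ.target := chartAt_one_mem_target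
  have hR1 : R (φ 1, φ 1) = γ t * (δ t)⁻¹ := by simp [R, φ]
  have ho := hR.continuousOn.isOpen_inter_preimage (φ.open_target.prod φ.open_target)
    e.open_source
  have hd : HasFDerivAt (fun p => e (R p)) (fderiv ℝ (fun p => e (R p)) (φ 1, φ 1)) (φ 1, φ 1) :=
    (((hR.contDiffOn_chart he).contDiffAt (ho.mem_nhds ⟨⟨hφ1, hφ1⟩, by
      rw [mem_preimage, hR1]; exact ht⟩)).differentiableAt (by simp)).hasFDerivAt
  -- on the diagonal `R` is constant, so its derivative vanishes there
  have hdiag : fderiv ℝ (fun p => e (R p)) (φ 1, φ 1) (X t, X t) = 0 := by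
    have h1 := hd.comp (φ 1) (f := fun a => (a, a)) ((hasFDerivAt_id (φ 1)).prodMk
      (hasFDerivAt_id (φ 1)))
    have h2 : HasFDerivAt ((fun p => e (R p)) ∘ fun a => (a, a)) (0 : E →L[ℝ] E) (φ 1) := by
      refine (hasFDerivAt_const (e (γ t * (δ t)⁻¹)) (φ 1)).congr_of_eventuallyEq
        (Eventually.of_forall fun a => ?_)
      simp [R]
    exact congrArg (fun L : E →L[ℝ] E => L (X t)) (h1.unique h2)
  have hcurve := (hX t).prodMk (hX' t)
  have h0 : (φ ((γ t)⁻¹ * γ t), φ ((δ t)⁻¹ * δ t)) = (φ 1, φ 1) := by simp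
  rw [← h0] at hd
  have h1 := HasFDerivAt.comp_hasCurveDerivAt (c := fun s => (φ ((γ t)⁻¹ * γ s),
    φ ((δ t)⁻¹ * δ s))) hd hcurve
  rw [h0, hdiag] at h1
  obtain ⟨s, hs, hso, hts⟩ := mem_nhds_iff.1
    ((eventually_inv_mul_mem_source (E := E) hγ t).and (eventually_inv_mul_mem_source (E := E) hδ t))
  refine h1.congr hso hts fun r hr => ?_
  obtain ⟨k1, k2⟩ := hs hr
  simp only [R]
  rw [φ.left_inv k1, φ.left_inv k2]
  congr 1
  group

/-- A curve with derivative zero on a relatively open interval is constant there. -/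
theorem eq_of_hasCurveDerivAt_zero {c : unitInterval → E} {s : Set unitInterval}
    (hs : s.OrdConnected) (h : ∀ t ∈ s, HasCurveDerivAt c t 0) {a b : unitInterval} (ha : a ∈ s)
    (hb : b ∈ s) : c a = c b := by
  have hconv : Convex ℝ (Subtype.val '' s : Set ℝ) := by
    refine OrdConnected.convex ⟨?_⟩
    rintro _ ⟨x, hx, rfl⟩ _ ⟨y, hy, rfl⟩ z hz
    exact ⟨⟨z, x.2.1.trans hz.1, hz.2.trans y.2.2⟩, hs.out hx hy hz, rfl⟩
  have key := hconv.norm_image_sub_le_of_norm_hasDerivWithin_le (C := 0)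
    (f := IccExtend zero_le_one c) (f' := fun _ => 0) (x := a) (y := b) ?_ ?_
    (mem_image_of_mem _ ha) (mem_image_of_mem _ hb)
  · rw [IccExtend_val, IccExtend_val, zero_mul] at key
    exact (sub_eq_zero.1 (norm_le_zero_iff.1 key)).symm
  · rintro _ ⟨x, hx, rfl⟩
    exact (h x hx).hasDerivWithinAt.mono (by rintro _ ⟨y, -, rfl⟩; exact y.2)
  · simp

/-- The quotient `γ δ⁻¹` of two evolutions of `X` is locally constant, hence equal to `1`. -/
theorem IsEvolution.unique [T2Space H] {X : unitInterval → E} {γ δ : unitInterval → H}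
    (hγ : IsEvolution X γ) (hδ : IsEvolution X δ) : γ = δ := by
  let q : unitInterval → H := fun s => γ s * (δ s)⁻¹
  have hq : Continuous q := hγ.1.mul hδ.1.inv
  have hclosed : IsClosed {s | q s = 1} := isClosed_eq hq continuous_const
  have hopen : IsOpen {s | q s = 1} := by
    rw [isOpen_iff_mem_nhds]
    intro t ht
    set e := chartAt E (q t)
    have hmem : q ⁻¹' e.source ∈ 𝓝 t :=
      hq.continuousAt (e.open_source.mem_nhds (mem_chart_source E (q t)))
    obtain ⟨ε, hε, hball⟩ := Metric.mem_nhds_iff.1 hmem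
    filter_upwards [Metric.ball_mem_nhds t hε] with s hs
    have hoc : (Metric.ball t ε).OrdConnected := by
      refine ⟨fun x hx y hy z hz => ?_⟩
      rw [Metric.mem_ball, Subtype.dist_eq, Real.dist_eq, abs_lt] at hx hy ⊢
      have h1 : (x : ℝ) ≤ z := hz.1
      have h2 : (z : ℝ) ≤ y := hz.2
      constructor <;> linarith
    have h1 := eq_of_hasCurveDerivAt_zero (c := fun s => e (q s)) hoc (fun r hr =>
      hγ.2.2.hasCurveDerivAt_mul_inv hγ.1 hδ.1 hδ.2.2 (chart_mem_atlas E (q t)) (hball hr)) hs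
      (Metric.mem_ball_self hε)
    have h2 := e.injOn (hball hs) (hball (Metric.mem_ball_self hε)) h1
    exact h2.trans ht
  have huniv := IsClopen.eq_univ ⟨hclosed, hopen⟩ ⟨0, by
    change γ 0 * (δ 0)⁻¹ = 1
    rw [hγ.2.1, hδ.2.1]
    simp⟩
  funext t
  have h1 : q t = 1 := (huniv ▸ mem_univ t : t ∈ {s | q s = 1})
  exact mul_inv_eq_one.1 h1

end Evolution

/-! ### Evolutions of arbitrary continuous curves -/

section Rescale

/-- The affine map `s ↦ a + b s`, truncated so as to map `[0,1]` to itself. -/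
noncomputable def unitAffine (a b : ℝ) (s : unitInterval) : unitInterval :=
  projIcc 0 1 zero_le_one (a + b * s)

theorem continuous_unitAffine (a : ℝ) :
    Continuous fun p : ℝ × unitInterval => unitAffine a p.1 p.2 := by
  unfold unitAffine
  fun_prop

theorem continuous_unitAffine_right (a b : ℝ) : Continuous (unitAffine a b) :=
  (continuous_unitAffine a).comp (continuous_const.prodMk continuous_id)

theorem coe_unitAffine {a b : ℝ} {s : unitInterval} (h : a + b * s ∈ Icc (0 : ℝ) 1) :
    (unitAffine a b s : ℝ) = a + b * s :=
  congrArg Subtype.val (projIcc_of_mem zero_le_one h)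

theorem unitAffine_of_eq {a b : ℝ} {s t : unitInterval} (h : a + b * s = t) :
    unitAffine a b s = t :=
  Subtype.ext ((coe_unitAffine (h ▸ t.2)).trans h)

theorem unitAffine_of_le {a b : ℝ} {s : unitInterval} (h : a + b * s ≤ 0) :
    unitAffine a b s = 0 := projIcc_of_le_left _ h

theorem unitAffine_of_ge {a b : ℝ} {s : unitInterval} (h : 1 ≤ a + b * s) :
    unitAffine a b s = 1 := projIcc_of_right_le _ h

theorem mul_mem_Icc (t s : unitInterval) : 0 + (t : ℝ) * s ∈ Icc (0 : ℝ) 1 := by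
  rw [zero_add]
  exact ⟨mul_nonneg t.2.1 s.2.1, mul_le_one₀ t.2.2 s.2.1 s.2.2⟩

variable (E : Type*) [NormedAddCommGroup E] [NormedSpace ℝ E]

/-- The curve `s ↦ b X(a + b s)`: if `X` is the logarithmic derivative of `γ`, this is the logarithmic
derivative of `s ↦ γ(a + b s)`. -/
noncomputable def rescale (a b : ℝ) : C(unitInterval, E) →L[ℝ] C(unitInterval, E) :=
  LinearMap.mkContinuous
    { toFun := fun X => ⟨fun s => b • X (unitAffine a b s),
        (X.continuous.comp (continuous_unitAffine_right a b)).const_smul b⟩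
      map_add' := fun X Y => by ext; simp
      map_smul' := fun r X => by ext; simp [smul_comm b r] } |b|
    fun X => (ContinuousMap.norm_le _ (by positivity)).2 fun s => by
      change ‖b • X (unitAffine a b s)‖ ≤ _
      rw [norm_smul, Real.norm_eq_abs]
      exact mul_le_mul_of_nonneg_left (X.norm_coe_le_norm _) (abs_nonneg b)

variable {E}

theorem rescale_apply (a b : ℝ) (X : C(unitInterval, E)) (s : unitInterval) :
    rescale E a b X s = b • X (unitAffine a b s) := rfl

theorem norm_rescale_le (a b : ℝ) (X : C(unitInterval, E)) : ‖rescale E a b X‖ ≤ |b| * ‖X‖ :=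
  ((rescale E a b).le_opNorm X).trans (mul_le_mul_of_nonneg_right
    (LinearMap.mkContinuous_norm_le _ (abs_nonneg b) _) (norm_nonneg X))

theorem continuous_rescale (a : ℝ) :
    Continuous fun p : ℝ × C(unitInterval, E) => rescale E a p.1 p.2 := by
  let f : C((ℝ × C(unitInterval, E)) × unitInterval, E) :=
    ⟨fun q => q.1.1 • q.1.2 (unitAffine a q.1.1 q.2), by
      have h1 : Continuous fun q : (ℝ × C(unitInterval, E)) × unitInterval =>
          unitAffine a q.1.1 q.2 := (continuous_unitAffine a).comp
          (by fun_prop : Continuous fun q : (ℝ × C(unitInterval, E)) × unitInterval => (q.1.1, q.2))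
      exact (by fun_prop : Continuous fun q : (ℝ × C(unitInterval, E)) × unitInterval =>
        q.1.1).smul ((by fun_prop : Continuous fun q : (ℝ × C(unitInterval, E)) × unitInterval =>
        q.1.2).eval h1)⟩
  exact f.curry.continuous

/-- The derivative along `S` of a curve reparametrized by a map that is affine on `S`. -/
theorem HasCurveDerivAt.tendsto_comp {F : Type*} [AddCommGroup F] [Module ℝ F] [TopologicalSpace F]
    [ContinuousSMul ℝ F] {d : unitInterval → F} {p : unitInterval → unitInterval}
    (hp : Continuous p) {S : Set unitInterval} {t : unitInterval} {k : ℝ} (hk : k ≠ 0)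
    (h : ∀ s ∈ S, (p s : ℝ) - p t = k * (s - t)) {w : F} (hd : HasCurveDerivAt d (p t) w) :
    Tendsto (fun s : unitInterval => ((s : ℝ) - t)⁻¹ • (d (p s) - d (p t))) (𝓝[S \ {t}] t)
      (𝓝 (k • w)) := by
  have h1 : Tendsto p (𝓝[S \ {t}] t) (𝓝[≠] p t) := by
    refine tendsto_nhdsWithin_iff.2 ⟨(hp.tendsto t).mono_left nhdsWithin_le_nhds, ?_⟩
    filter_upwards [self_mem_nhdsWithin] with s hs heq
    have h2 := h s hs.1
    rw [show p s = p t from heq, sub_self] at h2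
    rcases mul_eq_zero.1 h2.symm with h3 | h3
    · exact hk h3
    · exact hs.2 (Subtype.ext (sub_eq_zero.1 h3))
  refine ((Tendsto.comp hd h1).const_smul k).congr' ?_
  filter_upwards [self_mem_nhdsWithin] with s hs
  simp only [Function.comp]
  rw [h s hs.1, smul_smul, mul_inv, ← mul_assoc, mul_inv_cancel₀ hk, one_mul]

end Rescale

section GlobalEvolution

variable {E : Type*} [NormedAddCommGroup E] [NormedSpace ℝ E]
  {H : Type*} [Group H] [TopologicalSpace H] [ChartedSpace E H]

/-- If on a closed set of parameters `S` the curve `γ` is a left translate of a reparametrization of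
`δ`, then its left logarithmic derivative along `S` is that of `δ`, rescaled. -/
theorem HasLeftLogDeriv.tendsto_reparam {γ δ : unitInterval → H} {X Y : unitInterval → E}
    (hδ : HasLeftLogDeriv E δ Y) {p : unitInterval → unitInterval} (hp : Continuous p)
    {S : Set unitInterval} (hS : IsClosed S) {k : ℝ} (hk : k ≠ 0)
    (hpk : ∀ s ∈ S, ∀ t ∈ S, (p s : ℝ) - p t = k * (s - t)) (g : H)
    (hγ : ∀ s ∈ S, γ s = g * δ (p s)) (hX : ∀ t ∈ S, k • Y (p t) = X t) (t : unitInterval) :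
    Tendsto (fun s : unitInterval => ((s : ℝ) - t)⁻¹ • (chartAt E (1 : H) ((γ t)⁻¹ * γ s) -
      chartAt E (1 : H) ((γ t)⁻¹ * γ t))) (𝓝[S \ {t}] t) (𝓝 (X t)) := by
  by_cases ht : t ∈ S
  · have h1 := (hδ (p t)).tendsto_comp hp hk (S := S) fun s hs => hpk s hs t ht
    rw [hX t ht] at h1
    refine h1.congr' ?_
    filter_upwards [self_mem_nhdsWithin] with s hs
    rw [hγ s hs.1, hγ t ht]
    simp only [mul_inv_rev, mul_assoc, inv_mul_cancel_left]
  · have h1 : 𝓝[S \ {t}] t = ⊥ := by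
      rw [← notMem_closure_iff_nhdsWithin_eq_bot]
      exact fun h => ht (closure_minimal sdiff_subset hS h)
    rw [h1]
    exact tendsto_bot

/-- The evolution of a curve on `[0,1]` is obtained by composing those on the two halves. -/
theorem IsEvolution.glue [IsTopologicalGroup H] {X : C(unitInterval, E)} {α β : unitInterval → H}
    (hα : IsEvolution (rescale E 0 (1 / 2) X) α)
    (hβ : IsEvolution (rescale E (1 / 2) (1 / 2) X) β) :
    IsEvolution X fun s => α (unitAffine 0 2 s) * β (unitAffine (-1) 2 s) := by
  refine ⟨(hα.1.comp (continuous_unitAffine_right _ _)).mul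
    (hβ.1.comp (continuous_unitAffine_right _ _)), ?_, fun t => ?_⟩
  · beta_reduce
    rw [unitAffine_of_le (by simp), unitAffine_of_le (by simp), hα.2.1, hβ.2.1, mul_one]
  · have hS₁ : IsClosed {s : unitInterval | (s : ℝ) ≤ 1 / 2} :=
      isClosed_le continuous_subtype_val continuous_const
    have hS₂ : IsClosed {s : unitInterval | 1 / 2 ≤ (s : ℝ)} :=
      isClosed_le continuous_const continuous_subtype_val
    have e₁ : ∀ s : unitInterval, (s : ℝ) ≤ 1 / 2 → (unitAffine 0 2 s : ℝ) = 2 * s := fun s hs => by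
      rw [coe_unitAffine ⟨by linarith [s.2.1], by linarith⟩, zero_add]
    have e₂ : ∀ s : unitInterval, 1 / 2 ≤ (s : ℝ) → (unitAffine (-1) 2 s : ℝ) = -1 + 2 * s :=
      fun s hs => coe_unitAffine ⟨by linarith, by linarith [s.2.2]⟩
    have k₁ := hα.2.2.tendsto_reparam (γ := fun s => α (unitAffine 0 2 s) *
      β (unitAffine (-1) 2 s)) (X := X) (continuous_unitAffine_right 0 2) hS₁ two_ne_zero
      (fun s hs t ht => by rw [e₁ s hs, e₁ t ht]; ring) 1
      (fun s hs => by
        have hs' : (s : ℝ) ≤ 1 / 2 := hs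
        simp only [one_mul]
        rw [unitAffine_of_le (a := -1) (by linarith), hβ.2.1, mul_one])
      (fun t ht => by
        rw [rescale_apply, smul_smul, unitAffine_of_eq (t := t) (by rw [e₁ t ht]; ring)]
        norm_num) t
    have k₂ := hβ.2.2.tendsto_reparam (γ := fun s => α (unitAffine 0 2 s) *
      β (unitAffine (-1) 2 s)) (X := X) (continuous_unitAffine_right (-1) 2) hS₂ two_ne_zero
      (fun s hs t ht => by rw [e₂ s hs, e₂ t ht]; ring) (α 1)
      (fun s hs => by
        have hs' : 1 / 2 ≤ (s : ℝ) := hs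
        rw [unitAffine_of_ge (a := 0) (by linarith)])
      (fun t ht => by
        rw [rescale_apply, smul_smul, unitAffine_of_eq (t := t) (by rw [e₂ t ht]; ring)]
        norm_num) t
    have hU : ({t}ᶜ : Set unitInterval) =
        ({s : unitInterval | (s : ℝ) ≤ 1 / 2} \ {t}) ∪ ({s : unitInterval | 1 / 2 ≤ (s : ℝ)} \ {t}) := by
      ext s
      simp only [mem_compl_iff, mem_union, Set.mem_sdiff, mem_ofPred_eq]
      have := le_total (s : ℝ) (1 / 2)
      tauto
    rw [HasCurveDerivAt, hU, nhdsWithin_union]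
    exact k₁.sup k₂

/-- The initial pieces of an evolution are evolutions, when rescaled to `[0,1]`. -/
theorem IsEvolution.restrict [IsTopologicalGroup H] {X : C(unitInterval, E)} {γ : unitInterval → H}
    (hγ : IsEvolution X γ) (t : unitInterval) :
    IsEvolution (rescale E 0 t X) fun s => γ (unitAffine 0 t s) := by
  refine ⟨hγ.1.comp (continuous_unitAffine_right _ _), ?_, fun s => ?_⟩
  · beta_reduce
    rw [unitAffine_of_le (by simp), hγ.2.1]
  · by_cases ht : (t : ℝ) = 0
    · have h0 : ∀ s, unitAffine 0 t s = 0 := fun s => unitAffine_of_le (by simp [ht])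
      have h1 : rescale E 0 t X s = 0 := by rw [rescale_apply, ht, zero_smul]
      simp only [h0, h1]
      simp [HasCurveDerivAt]
    · have k := hγ.2.2.tendsto_reparam (γ := fun s => γ (unitAffine 0 t s))
        (X := rescale E 0 t X) (continuous_unitAffine_right 0 t) isClosed_univ ht
        (fun s _ r _ => by
          rw [coe_unitAffine (mul_mem_Icc t s), coe_unitAffine (mul_mem_Icc t r)]; ring) 1
        (fun s _ => (one_mul _).symm) (fun r _ => rfl) s
      rwa [← compl_eq_univ_sdiff] at k

variable [FiniteDimensional ℝ E] [IsTopologicalGroup H] [LieGroup 𝓘(ℝ, E) ∞ H]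

/-- The evolution of a continuous curve `X` in the Lie algebra. It is the constant `1` if `X` has no
evolution, which does not occur, see `isEvolution_evolution`. -/
noncomputable def evolution (E : Type*) [NormedAddCommGroup E] [NormedSpace ℝ E]
    (H : Type*) [Group H] [TopologicalSpace H] [ChartedSpace E H]
    (X : C(unitInterval, E)) : unitInterval → H :=
  open Classical in if h : ∃ γ : unitInterval → H, IsEvolution X γ then h.choose else fun _ => 1

theorem IsEvolution.evolution_eq [T2Space H] {X : C(unitInterval, E)} {γ : unitInterval → H}
    (hγ : IsEvolution X γ) : evolution E H X = γ := by
  have h : ∃ γ : unitInterval → H, IsEvolution X γ := ⟨γ, hγ⟩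
  rw [evolution, dif_pos h]
  exact h.choose_spec.unique hγ

/-- Evolutions exist and depend smoothly on the curve on balls of arbitrary radius: a curve in the ball
of radius `2ρ` is composed of two halves whose rescalings lie in the ball of radius `ρ`. -/
theorem exists_evolution_of_norm_lt (E : Type*) [NormedAddCommGroup E] [NormedSpace ℝ E]
    [FiniteDimensional ℝ E] (H : Type*) [Group H] [TopologicalSpace H] [ChartedSpace E H]
    [IsTopologicalGroup H] [LieGroup 𝓘(ℝ, E) ∞ H] [T2Space H] :
    ∃ r > 0, ∀ k : ℕ, (∀ X ∈ Metric.ball (0 : C(unitInterval, E)) (2 ^ k * r),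
      IsEvolution X (evolution E H X)) ∧
      ContMDiffOn 𝓘(ℝ, C(unitInterval, E)) 𝓘(ℝ, E) ∞ (fun X => evolution E H X 1)
        (Metric.ball 0 (2 ^ k * r)) := by
  obtain ⟨r, hr, σ, h1, h2⟩ := exists_local_evolution E H
  refine ⟨r, hr, fun k => ?_⟩
  induction k with
  | zero =>
    rw [pow_zero, one_mul]
    refine ⟨fun X hX => ?_, h2.congr fun X hX => ?_⟩
    · rw [(h1 X hX).evolution_eq]
      exact h1 X hX
    · rw [(h1 X hX).evolution_eq]
  | succ k ih =>
    obtain ⟨k1, k2⟩ := ih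
    have hm : ∀ a, MapsTo (rescale E a (1 / 2)) (Metric.ball 0 (2 ^ (k + 1) * r))
        (Metric.ball 0 (2 ^ k * r)) := fun a X hX => by
      rw [mem_ball_zero_iff] at hX ⊢
      refine (norm_rescale_le a _ X).trans_lt ?_
      rw [abs_of_pos (by norm_num), pow_succ] at *
      linarith
    have hg : ∀ X ∈ Metric.ball (0 : C(unitInterval, E)) (2 ^ (k + 1) * r), _ := fun X hX =>
      (k1 _ (hm 0 hX)).glue (k1 _ (hm (1 / 2) hX))
    refine ⟨fun X hX => ?_, ?_⟩
    · rw [(hg X hX).evolution_eq]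
      exact hg X hX
    · have h3 : ∀ a, ContMDiffOn 𝓘(ℝ, C(unitInterval, E)) 𝓘(ℝ, E) ∞
          (fun X => evolution E H (rescale E a (1 / 2) X) 1)
          (Metric.ball 0 (2 ^ (k + 1) * r)) := fun a =>
        k2.comp (rescale E a (1 / 2)).contDiff.contMDiff.contMDiffOn (hm a)
      refine ((h3 0).mul (h3 (1 / 2))).congr fun X hX => ?_
      rw [(hg X hX).evolution_eq]
      beta_reduce
      rw [unitAffine_of_ge (a := 0) (by norm_num), unitAffine_of_ge (a := -1) (by norm_num)]
      rfl

variable [T2Space H]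

theorem isEvolution_evolution (X : C(unitInterval, E)) : IsEvolution X (evolution E H X) := by
  obtain ⟨r, hr, h⟩ := exists_evolution_of_norm_lt E H
  obtain ⟨k, hk⟩ := pow_unbounded_of_one_lt (‖X‖ / r) one_lt_two
  exact (h k).1 X (mem_ball_zero_iff.2 ((div_lt_iff₀ hr).1 hk))

/-- The end point of the evolution depends smoothly on the curve in the Lie algebra. -/
theorem contMDiff_evolution_one :
    ContMDiff 𝓘(ℝ, C(unitInterval, E)) 𝓘(ℝ, E) ∞ fun X => evolution E H X 1 := by
  obtain ⟨r, hr, h⟩ := exists_evolution_of_norm_lt E H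
  intro X
  obtain ⟨k, hk⟩ := pow_unbounded_of_one_lt (‖X‖ / r) one_lt_two
  exact (h k).2.contMDiffAt (Metric.isOpen_ball.mem_nhds
    (mem_ball_zero_iff.2 ((div_lt_iff₀ hr).1 hk)))

/-- All values of an evolution are end points of evolutions of rescaled curves. -/
theorem evolution_rescale (X : C(unitInterval, E)) (t : unitInterval) :
    evolution E H (rescale E 0 t X) 1 = evolution E H X t := by
  rw [((isEvolution_evolution X).restrict t).evolution_eq]
  beta_reduce
  rw [unitAffine_of_eq (t := t) (by simp)]

omit [T2Space H] in
/-- A curve in `H` with smooth left logarithmic derivative is smooth in every chart. -/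
theorem HasLeftLogDeriv.curveContDiffOn {γ : unitInterval → H} {X : unitInterval → E}
    (hγ : Continuous γ) (hX : HasLeftLogDeriv E γ X) (hXs : ∀ n, CurveContDiffOn n X univ)
    {e : OpenPartialHomeomorph H E} (he : e ∈ atlas E H) (n : ℕ) :
    CurveContDiffOn n (fun t => e (γ t)) (γ ⁻¹' e.source) := by
  set φ := chartAt E (1 : H)
  have hφ1 : φ 1 ∈ φ.target := chartAt_one_mem_target
  let F : E × E → H := fun p => e.symm p.1 * φ.symm p.2
  have hF : ContMDiffOn 𝓘(ℝ, E × E) 𝓘(ℝ, E) ∞ F (e.target ×ˢ φ.target) :=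
    (ContMDiffOn.comp_fst_atlas_symm contDiffOn_fst he fun p hp => hp.1).mul
      (ContMDiffOn.comp_fst_atlas_symm contDiffOn_snd (chart_mem_atlas E 1) fun p hp => hp.2)
  have ho := hF.continuousOn.isOpen_inter_preimage (e.open_target.prod φ.open_target) e.open_source
  have hF' := hF.contDiffOn_chart he
  have hmem : ∀ y ∈ e.target, (y, φ 1) ∈ (e.target ×ˢ φ.target) ∩ F ⁻¹' e.source := fun y hy =>
    ⟨⟨hy, hφ1⟩, by simpa [F, φ] using e.map_target hy⟩
  -- the velocity of `γ` in the chart is `N (e (γ t)) (X t)`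
  let N : E → E →L[ℝ] E := fun y => fderiv ℝ (fun z => e (F (y, z))) (φ 1)
  have hN : ContDiffOn ℝ ∞ N e.target := ContDiffOn.partial_fderiv ho hF' contDiffOn_const hmem
  have hd : ∀ t ∈ γ ⁻¹' e.source, HasCurveDerivAt (fun s => e (γ s)) t (N (e (γ t)) (X t)) := by
    intro t ht
    have h1 : HasFDerivAt (fun z => e (F (e (γ t), z))) (N (e (γ t))) (φ 1) :=
      (((hF'.contDiffAt (ho.mem_nhds (hmem _ (e.map_source ht)))).differentiableAt
        (by simp)).comp (φ 1) (f := fun z => (e (γ t), z))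
        (hasFDerivAt_prodMk_right _ _).differentiableAt).hasFDerivAt
    have h0 : φ ((γ t)⁻¹ * γ t) = φ 1 := by simp
    rw [← h0] at h1
    have h2 := HasFDerivAt.comp_hasCurveDerivAt (c := fun s => φ ((γ t)⁻¹ * γ s)) h1 (hX t)
    obtain ⟨s, hs, hso, hts⟩ := mem_nhds_iff.1 (eventually_inv_mul_mem_source (E := E) hγ t)
    refine h2.congr hso hts fun r hr => ?_
    simp only [F]
    rw [φ.left_inv (hs hr), e.left_inv ht]
    congr 1
    group
  induction n with
  | zero => exact e.continuousOn.comp hγ.continuousOn fun t ht => ht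
  | succ n ih =>
    refine ⟨ih.continuousOn, _, hd, ?_⟩
    have h1 : ContDiffOn ℝ ∞ (fun p : E × E => N p.1 p.2) (e.target ×ˢ univ) :=
      (hN.comp contDiffOn_fst fun p hp => hp.1).clm_apply contDiffOn_snd
    exact (ContDiffOn.lcSmoothOn (e.open_target.prod isOpen_univ) h1 n).comp_curve
      (e.open_target.prod isOpen_univ) (ih.prodMk ((hXs n).mono (subset_univ _)))
      fun t ht => ⟨e.map_source ht, mem_univ _⟩

end GlobalEvolution

/-! ### Maps into spaces of curves, and primitives -/

section CurveMap

variable {Z : Type*} [AddCommGroup Z] [Module ℝ Z] [TopologicalSpace Z]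
  [IsTopologicalAddGroup Z] [ContinuousSMul ℝ Z] [LocallyConvexSpace ℝ Z]

/-- The difference quotients of a `C^1` map, extended to `t = 0` by the directional derivative,
depend continuously on all parameters. -/
theorem continuous_slope_of_directional {Q : Type*} [AddCommGroup Q] [Module ℝ Q]
    [TopologicalSpace Q] [IsTopologicalAddGroup Q] [ContinuousSMul ℝ Q] {g : Q → Z} {dg : Q × Q → Z}
    (hgc : Continuous g) (hg : ∀ x h : Q,
      Tendsto (fun t : ℝ => t⁻¹ • (g (x + t • h) - g x)) (𝓝[≠] 0) (𝓝 (dg (x, h))))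
    (hdg : Continuous dg) {S : Type*} [TopologicalSpace S] {y k : S → Q} (hy : Continuous y)
    (hk : Continuous k) : Continuous fun p : ℝ × S => open Classical in
      if p.1 = 0 then dg (y p.2, k p.2) else p.1⁻¹ • (g (y p.2 + p.1 • k p.2) - g (y p.2)) := by
  rw [continuous_iff_continuousAt]
  rintro ⟨t₀, s₀⟩
  by_cases ht₀ : t₀ = 0
  · subst ht₀
    rw [ContinuousAt, if_pos rfl]
    refine tendsto_of_forall_closed_convex fun C hC hconv hcl => ?_
    have key : ∀ᶠ p : ℝ × S in 𝓝 ((0 : ℝ), s₀), ∀ r ∈ Icc (0 : ℝ) 1,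
        dg (y p.2 + (r * p.1) • k p.2, k p.2) ∈ C := by
      refine isCompact_Icc.eventually_forall_of_forall_eventually fun r _ => ?_
      have hc : ContinuousAt (fun z : (ℝ × S) × ℝ => dg (y z.1.2 + (z.2 * z.1.1) • k z.1.2, k z.1.2))
          (((0 : ℝ), s₀), r) := by fun_prop
      refine hc.eventually_mem ?_
      simpa using hC
    filter_upwards [key] with p hp
    by_cases hp0 : p.1 = 0
    · rw [if_pos hp0]
      simpa using hp 0 (by simp)
    · rw [if_neg hp0]
      have := sub_mem_of_forall_slope_tendsto (c := fun r => p.1⁻¹ • g (y p.2 + (r * p.1) • k p.2))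
        (c' := fun r => dg (y p.2 + (r * p.1) • k p.2, k p.2)) hconv hcl ?_ hp
      · simpa [smul_sub] using this
      · intro r hr
        have h2 := (tendsto_slope_of_directional (dg := dg) hp0
          (hg (y p.2 + (r * p.1) • k p.2) (k p.2))).const_smul p.1⁻¹
        rw [smul_smul, inv_mul_cancel₀ hp0, one_smul] at h2
        refine h2.congr fun s => ?_
        rw [smul_comm, ← smul_sub]
        congr 4
        rw [add_mul, add_smul, smul_smul, add_assoc]
  · have h1 : ContinuousAt (fun p : ℝ × S => p.1⁻¹ • (g (y p.2 + p.1 • k p.2) - g (y p.2)))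
        (t₀, s₀) := by
      refine ContinuousAt.smul (continuousAt_fst.inv₀ ht₀) (Continuous.continuousAt ?_)
      fun_prop
    refine h1.congr ?_
    filter_upwards [continuousAt_fst.eventually_ne ht₀] with p hp
    rw [if_neg hp]

theorem continuous_curveMap {Q P Z : Type*} [TopologicalSpace Q] [TopologicalSpace P]
    [TopologicalSpace Z] {g : Q → Z} (hg : Continuous g) {T : unitInterval → P → Q}
    (hT : Continuous fun p : unitInterval × P => T p.1 p.2) {Φ : P → C(unitInterval, Z)}
    (hΦ : ∀ x s, Φ x s = g (T s x)) : Continuous Φ := by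
  refine ContinuousMap.continuous_of_continuous_uncurry _ ?_
  have h1 : Function.uncurry (fun x s => Φ x s) = fun p => g (T p.2 p.1) :=
    funext fun p => hΦ p.1 p.2
  rw [h1]
  exact hg.comp (hT.comp continuous_swap)

/-- If `g` is of class `C^n` and the `T_s` are linear maps depending continuously on `s ∈ [0,1]`,
then the map `x ↦ (s ↦ g (T_s x))` with values in a space of continuous curves is of class `C^n`. -/
theorem LCContDiffOn.curveMap {Q : Type u} [AddCommGroup Q] [Module ℝ Q]
    [TopologicalSpace Q] [IsTopologicalAddGroup Q] [ContinuousSMul ℝ Q]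
    {P : Type v} [AddCommGroup P] [Module ℝ P] [TopologicalSpace P]
    {n : ℕ} {g : Q → Z} (hg : LCContDiffOn n g univ) (T : unitInterval → P →ₗ[ℝ] Q)
    (hT : Continuous fun p : unitInterval × P => T p.1 p.2) {Φ : P → C(unitInterval, Z)}
    (hΦ : ∀ x s, Φ x s = g (T s x)) : LCContDiffOn n Φ univ := by
  induction n generalizing P Q with
  | zero => exact (continuous_curveMap (continuousOn_univ.1 hg) hT hΦ).continuousOn
  | succ n ih =>
    obtain ⟨h1, dg, h2, h3⟩ := hg
    have h1' := continuousOn_univ.1 h1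
    have h3' : Continuous dg := by
      have := h3.continuousOn
      rwa [univ_prod_univ, continuousOn_univ] at this
    have hTx : ∀ x, Continuous fun s => T s x := fun x =>
      hT.comp (continuous_id.prodMk continuous_const)
    let dΦ : P × P → C(unitInterval, Z) := fun p =>
      ⟨fun s => dg (T s p.1, T s p.2), h3'.comp ((hTx p.1).prodMk (hTx p.2))⟩
    refine ⟨(continuous_curveMap h1' hT hΦ).continuousOn, dΦ, fun x _ k => ?_, ?_⟩
    · -- by joint continuity in `t` and `s`, the difference quotients converge uniformly in `s`
      let q : C(ℝ × unitInterval, Z) := ⟨_, continuous_slope_of_directional h1'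
        (fun x h => h2 x (mem_univ _) h) h3' (hTx x) (hTx k)⟩
      have hq := (q.curry.continuous.tendsto 0).mono_left (nhdsWithin_le_nhds (s := {0}ᶜ))
      have hq0 : q.curry 0 = dΦ (x, k) := by
        ext s
        exact if_pos rfl
      rw [hq0] at hq
      refine hq.congr' ?_
      filter_upwards [self_mem_nhdsWithin] with t ht
      ext s
      refine (if_neg ht).trans ?_
      simp [hΦ]
    · rw [univ_prod_univ] at h3 ⊢
      let T' : unitInterval → P × P →ₗ[ℝ] Q × Q := fun s => (T s).prodMap (T s)
      have hT' : Continuous fun p : unitInterval × (P × P) => T' p.1 p.2 :=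
        (hT.comp (continuous_fst.prodMk (continuous_fst.comp continuous_snd))).prodMk
          (hT.comp (continuous_fst.prodMk (continuous_snd.comp continuous_snd)))
      exact ih h3 T' hT' fun _ _ => rfl

end CurveMap

namespace SmoothFun

variable {E : Type*} [NormedAddCommGroup E] [NormedSpace ℝ E] [FiniteDimensional ℝ E]
  {H : Type*} [Group H] [TopologicalSpace H] [ChartedSpace E H]
  [LieGroup 𝓘(ℝ, E) ∞ H] [IsTopologicalGroup H] [LocallyCompactSpace H]

/-- The reparametrization of a continuous curve by `s ↦ a + b s`. -/
noncomputable def reparam (c : C(unitInterval, SmoothFun E H)) (a b : ℝ) :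
    C(unitInterval, SmoothFun E H) :=
  c.comp ⟨unitAffine a b, continuous_unitAffine_right a b⟩

/-- The primitive `t ↦ ∫₀ᵗ c` of a continuous curve of smooth functions. -/
noncomputable def primitive (c : C(unitInterval, SmoothFun E H)) (t : unitInterval) :
    SmoothFun E H :=
  (t : ℝ) • integralCLM (reparam c 0 t)

theorem primitive_zero (c : C(unitInterval, SmoothFun E H)) : primitive c 0 = 0 := by
  simp [primitive]

theorem primitive_one (c : C(unitInterval, SmoothFun E H)) : primitive c 1 = integralCLM c := by
  have h1 : reparam c 0 1 = c := by
    ext1 s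
    exact congrArg c (unitAffine_of_eq (by simp))
  simp [primitive, h1]

/-- The scaled integral of a reparametrized curve is the integral of the curve over `[a, a + b]`. -/
theorem smul_integralCLM_reparam_nil_apply (c : C(unitInterval, SmoothFun E H)) (a b : ℝ) (x : H) :
    (b • integralCLM (reparam c a b)).1 [] x =
      ∫ s in a..a + b, (c (projIcc 0 1 zero_le_one s)).1 [] x := by
  have h1 : (integralCLM (reparam c a b)).1 [] x =
      ∫ s : unitInterval, (c (projIcc 0 1 zero_le_one (a + b * s))).1 [] x :=
    integralCLM_apply _ _ _
  have h2 := integral_unitInterval fun s => (c (projIcc 0 1 zero_le_one (a + b * s))).1 [] x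
  have h3 := intervalIntegral.smul_integral_comp_add_mul (a := 0) (b := 1)
    (fun s => (c (projIcc 0 1 zero_le_one s)).1 [] x) b a
  rw [mul_zero, add_zero, mul_one, ← h2, ← h1] at h3
  exact h3

theorem hasCurveDerivAt_primitive (c : C(unitInterval, SmoothFun E H)) (t : unitInterval) :
    HasCurveDerivAt (primitive c) t (c t) := by
  let f : C(ℝ × unitInterval, SmoothFun E H) :=
    ⟨fun p => c (unitAffine t p.1 p.2), c.continuous.comp (continuous_unitAffine t)⟩
  have h1 : Tendsto (fun s : unitInterval => integralCLM (reparam c t ((s : ℝ) - t))) (𝓝[≠] t)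
      (𝓝 (integralCLM (reparam c t 0))) :=
    ((integralCLM.continuous.comp f.curry.continuous).tendsto 0).comp
      ((tendsto_unitInterval_sub t).mono_right nhdsWithin_le_nhds)
  have h2 : reparam c t 0 = ContinuousMap.const _ (c t) := by
    ext1 s
    exact congrArg c (unitAffine_of_eq (by simp))
  rw [h2, integralCLM_const] at h1
  refine h1.congr' ?_
  filter_upwards [(tendsto_unitInterval_sub t).eventually self_mem_nhdsWithin] with s hs
  have hs' : (s : ℝ) - t ≠ 0 := hs
  rw [eq_inv_smul_iff₀ hs']
  ext x
  have hint : ∀ a b, IntervalIntegrable (fun s => (c (projIcc 0 1 zero_le_one s)).1 [] x)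
      MeasureTheory.volume a b := fun a b => (continuous_eval (c.continuous.comp continuous_projIcc)
        continuous_const []).intervalIntegrable a b
  have e1 := smul_integralCLM_reparam_nil_apply c t ((s : ℝ) - t) x
  have e2 := smul_integralCLM_reparam_nil_apply c 0 s x
  have e3 := smul_integralCLM_reparam_nil_apply c 0 t x
  rw [add_sub_cancel] at e1
  rw [zero_add] at e2 e3
  rw [e1, ← intervalIntegral.integral_interval_sub_left (hint 0 s) (hint 0 t), ← e2, ← e3]
  rfl

theorem continuous_primitive (c : C(unitInterval, SmoothFun E H)) : Continuous (primitive c) := by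
  let f : C(ℝ × unitInterval, SmoothFun E H) :=
    ⟨fun p => c (unitAffine 0 p.1 p.2), c.continuous.comp (continuous_unitAffine 0)⟩
  exact continuous_subtype_val.smul
    ((integralCLM.continuous.comp f.curry.continuous).comp continuous_subtype_val)

end SmoothFun

/-! ### Regularity of the semidirect product -/

section Regular

variable {E : Type u} [NormedAddCommGroup E] [NormedSpace ℝ E] [FiniteDimensional ℝ E]
  {H : Type u} [Group H] [TopologicalSpace H] [ChartedSpace E H]
  [IsTopologicalGroup H] [LieGroup 𝓘(ℝ, E) ∞ H] [LocallyCompactSpace H] [T2Space H]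

/-- Acting on a smooth function by the end point of the evolution of `X` is smooth in both arguments. -/
theorem lcContDiffOn_evolution_translate (n : ℕ) :
    LCContDiffOn n (fun p : C(unitInterval, E) × SmoothFun E H =>
      SmoothFun.translate (evolution E H p.1 1) p.2) univ := by
  refine LCContDiffOn.of_locally isOpen_univ fun p _ => ?_
  set e := chartAt E (evolution E H p.1 1)
  have hU : IsOpen ((fun X : C(unitInterval, E) => evolution E H X 1) ⁻¹' e.source) :=
    e.open_source.preimage contMDiff_evolution_one.continuous
  have hU' := hU.preimage (continuous_fst : Continuous
    (Prod.fst : C(unitInterval, E) × SmoothFun E H → _))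
  refine ⟨_, hU', mem_chart_source E _, ?_⟩
  rw [univ_inter]
  have h1 := (contMDiff_evolution_one (E := E) (H := H)).contMDiffOn (s := univ)
    |>.contDiffOn_chart (chart_mem_atlas E (evolution E H p.1 1))
  rw [univ_inter] at h1
  have h2 := (ContDiffOn.lcSmoothOn hU h1 n).comp_clm
    (ContinuousLinearMap.fst ℝ C(unitInterval, E) (SmoothFun E H))
    (U' := Prod.fst ⁻¹' ((fun X => evolution E H X 1) ⁻¹' e.source)) fun _ hx => hx
  refine (LCContDiffOn.translate (chart_mem_atlas E _) h2
    ((ContinuousLinearMap.snd ℝ C(unitInterval, E) (SmoothFun E H)).lcContDiffOn n _)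
    fun x hx => e.map_source hx).congr hU' fun x hx => ?_
  simp only [ContinuousLinearMap.coe_snd', ContinuousLinearMap.coe_fst']
  rw [OpenPartialHomeomorph.left_inv _ hx]

namespace SmoothSemidirect

/-- The component in `T₁H` of a curve in the Lie algebra of the semidirect product. -/
noncomputable def sndCurve :
    C(unitInterval, SmoothFun E H × E) →L[ℝ] C(unitInterval, E) :=
  ContinuousLinearMap.compLeftContinuous ℝ unitInterval (ContinuousLinearMap.snd ℝ (SmoothFun E H) E)

/-- The integrand `s ↦ ρ(γ(s)) η(s)` for the function component of the evolution of `(η, X)`, where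
`γ` is the evolution of `X`. -/
noncomputable def transportedCurve (ζ : C(unitInterval, SmoothFun E H × E)) :
    C(unitInterval, SmoothFun E H) :=
  ⟨fun s => SmoothFun.translate (evolution E H (sndCurve ζ) s) (ζ s).1,
    SmoothFun.continuous_translate.comp ((isEvolution_evolution (H := H) (sndCurve ζ)).1.prodMk
      (continuous_fst.comp ζ.continuous))⟩

/-- The value at `s` of the transported curve is obtained by the smooth map `(X, v) ↦ ρ(γ_X(1)) v`
from arguments that depend linearly on `(η, X)`, namely the rescaling of `X` to `[0, s]` and `η(s)`. -/
theorem lcContDiffOn_transportedCurve (n : ℕ) : LCContDiffOn n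
    (transportedCurve : C(unitInterval, SmoothFun E H × E) → C(unitInterval, SmoothFun E H))
    univ := by
  let T : unitInterval → C(unitInterval, SmoothFun E H × E) →ₗ[ℝ]
      C(unitInterval, E) × SmoothFun E H := fun s =>
    { toFun := fun ζ => (rescale E 0 s (sndCurve ζ), (ζ s).1)
      map_add' := fun ζ ζ' => by simp
      map_smul' := fun r ζ => by simp }
  refine (lcContDiffOn_evolution_translate (E := E) (H := H) n).curveMap T ?_ fun ζ s => ?_
  · refine Continuous.prodMk ((continuous_rescale 0).comp
      ((continuous_subtype_val.comp continuous_fst).prodMk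
        (sndCurve.continuous.comp continuous_snd))) (continuous_fst.comp ?_)
    exact continuous_snd.eval continuous_fst
  · change _ = SmoothFun.translate (evolution E H (rescale E 0 s (sndCurve ζ)) 1) (ζ s).1
    rw [evolution_rescale]
    rfl

/-- The evolution of the curve `(η, X)` in the Lie algebra of the semidirect product is
`t ↦ (∫₀ᵗ ρ(γ(s)) η(s) ds, γ(t))`, where `γ` is the evolution of `X`. -/
noncomputable def evol (ζ : C(unitInterval, SmoothFun E H × E)) (t : unitInterval) :
    SmoothSemidirect E H :=
  (SmoothFun.primitive (transportedCurve ζ) t, evolution E H (sndCurve ζ) t)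

theorem hasLeftLogDeriv_evol (ζ : C(unitInterval, SmoothFun E H × E)) :
    HasLeftLogDeriv (SmoothFun E H × E) (evol ζ) ζ := by
  intro t
  set γ := evolution E H (sndCurve ζ)
  have hγ := isEvolution_evolution (H := H) (sndCurve ζ)
  have h1 := (SmoothFun.hasCurveDerivAt_primitive (transportedCurve ζ) t).clm_comp
    (SmoothFun.translateCLM (γ t)⁻¹)
  have h2 : SmoothFun.translateCLM (γ t)⁻¹ (transportedCurve ζ t) = (ζ t).1 := by
    change SmoothFun.translate (γ t)⁻¹ (SmoothFun.translate (γ t) (ζ t).1) = _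
    rw [← SmoothFun.translate_mul, inv_mul_cancel, SmoothFun.translate_one]
  rw [h2] at h1
  have h3 : HasCurveDerivAt (fun s => -SmoothFun.translate (γ t)⁻¹
      (SmoothFun.primitive (transportedCurve ζ) t) + SmoothFun.translate (γ t)⁻¹
      (SmoothFun.primitive (transportedCurve ζ) s)) t (ζ t).1 :=
    Tendsto.congr (fun s => by rw [add_sub_add_left_eq_sub]; rfl) h1
  exact h3.prodMk (hγ.2.2 t)

theorem curveContDiffOn_of_mem_smoothCurve {F : Type*} [AddCommGroup F] [Module ℝ F]
    [TopologicalSpace F] [IsTopologicalAddGroup F] [ContinuousSMul ℝ F] (ξ : SmoothCurve F)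
    (n m : ℕ) : CurveContDiffOn n (ξ.1 m) univ := by
  induction n generalizing m with
  | zero => exact (ξ.1 m).continuous.continuousOn
  | succ n ih => exact ⟨(ξ.1 m).continuous.continuousOn, ξ.1 (m + 1), fun t _ => ξ.2 m t, ih _⟩

theorem isSmoothPath_evol (ξ : SmoothCurve (SmoothFun E H × E)) :
    IsSmoothPath (SmoothFun E H × E) (evol (ξ.1 0)) := by
  set ζ := ξ.1 0
  set γ := evolution E H (sndCurve ζ)
  have hγ := isEvolution_evolution (H := H) (sndCurve ζ)
  have hζ := fun n => curveContDiffOn_of_mem_smoothCurve ξ n 0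
  have hX : ∀ n, CurveContDiffOn n (fun t => (ζ t).2) univ := fun n =>
    ((ContinuousLinearMap.snd ℝ (SmoothFun E H) E).lcContDiffOn n univ).comp_curve isOpen_univ
      (hζ n) (mapsTo_univ _ _)
  have hη : ∀ n, CurveContDiffOn n (fun t => (ζ t).1) univ := fun n =>
    ((ContinuousLinearMap.fst ℝ (SmoothFun E H) E).lcContDiffOn n univ).comp_curve isOpen_univ
      (hζ n) (mapsTo_univ _ _)
  refine ⟨(SmoothFun.continuous_primitive _).prodMk hγ.1, ?_⟩
  rintro _ ⟨c, hc, rfl⟩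
  have hs : IsOpen (γ ⁻¹' c.source) := c.open_source.preimage hγ.1
  have hs' : evol ζ ⁻¹' ((OpenPartialHomeomorph.refl (SmoothFun E H)).prod c).source =
      γ ⁻¹' c.source := by
    ext t
    exact ⟨fun h => h.2, fun h => ⟨mem_univ _, h⟩⟩
  rw [hs']
  have k1 := fun n => hγ.2.2.curveContDiffOn hγ.1 hX hc n
  have k2 : ∀ n, CurveContDiffOn n (transportedCurve ζ) (γ ⁻¹' c.source) := fun n =>
    ((SmoothFun.lcContDiffOn_translate hc n).comp_curve (c.open_target.prod isOpen_univ)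
      ((k1 n).prodMk ((hη n).mono (subset_univ _))) fun t ht =>
        ⟨c.map_source ht, mem_univ _⟩).congr hs fun t ht => by
          simp only
          rw [c.left_inv ht]
          rfl
  have k3 : ∀ n, CurveContDiffOn n (SmoothFun.primitive (transportedCurve ζ)) (γ ⁻¹' c.source) := by
    intro n
    exact CurveContDiffOn.of_succ ⟨(SmoothFun.continuous_primitive _).continuousOn, _,
      fun t _ => SmoothFun.hasCurveDerivAt_primitive _ t, k2 n⟩
  exact CurveContDiffOn.smoothCurveOn hs fun n => (k3 n).prodMk (k1 n)

/-- The evolution map of the semidirect product is smooth. -/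
theorem lcSmooth_evol_one : LCSmooth (SmoothCurve (SmoothFun E H × E)) (SmoothFun E H × E)
    fun ξ : SmoothCurve (SmoothFun E H × E) => evol (H := H) (ξ.1 0) 1 := by
  let L : SmoothCurve (SmoothFun E H × E) →L[ℝ] C(unitInterval, SmoothFun E H × E) :=
    (ContinuousLinearMap.proj 0).comp (SmoothCurve (SmoothFun E H × E)).subtypeL
  have h1 : ∀ n, LCContDiffOn n (fun ζ : C(unitInterval, SmoothFun E H × E) =>
      SmoothFun.primitive (transportedCurve ζ) 1) univ := fun n => by
    simp only [SmoothFun.primitive_one]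
    exact (lcContDiffOn_transportedCurve n).clm_comp SmoothFun.integralCLM
  have hev : Continuous fun X : C(unitInterval, E) => evolution E H X 1 :=
    contMDiff_evolution_one.continuous
  constructor
  · have h2 : Continuous fun ξ : SmoothCurve (SmoothFun E H × E) =>
        SmoothFun.primitive (transportedCurve (H := H) (L ξ)) 1 :=
      (continuousOn_univ.1 (h1 0)).comp L.continuous
    exact h2.prodMk (hev.comp (sndCurve.continuous.comp L.continuous))
  · rintro e he _ ⟨c, hc, rfl⟩ n
    obtain rfl : e = OpenPartialHomeomorph.refl _ := he
    have hU : IsOpen ((fun X : C(unitInterval, E) => evolution E H X 1) ⁻¹' c.source) :=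
      c.open_source.preimage hev
    have h3 := (contMDiff_evolution_one (E := E) (H := H)).contMDiffOn (s := univ)
      |>.contDiffOn_chart hc
    rw [univ_inter] at h3
    have k1 := (h1 n).comp_clm L (U' := {ξ | evolution E H (sndCurve (L ξ)) 1 ∈ c.source})
      (mapsTo_univ _ _)
    have k2 := (ContDiffOn.lcSmoothOn hU h3 n).comp_clm (sndCurve.comp L)
      (U' := {ξ | evolution E H (sndCurve (L ξ)) 1 ∈ c.source}) fun _ hx => hx
    refine (k1.prodMk k2).mono ?_
    rintro ξ ⟨_, _, h⟩
    exact h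

/-- The semidirect product `C^∞(H) ⋊ H` is a regular Lie group. -/
theorem isRegularLieGroup :
    IsRegularLieGroup (SmoothFun E H × E) (SmoothSemidirect E H) := by
  refine ⟨fun ξ => evol (ξ.1 0) 1, lcSmooth_evol_one, fun ξ => ⟨evol (ξ.1 0), isSmoothPath_evol ξ,
    ?_, hasLeftLogDeriv_evol _, rfl⟩⟩
  exact Prod.ext (SmoothFun.primitive_zero _) (isEvolution_evolution _).2.1

end SmoothSemidirect

end Regular

/-! ### Metrizability, and density of the range -/

/-- On a `σ`-compact group the space of smooth functions is metrizable. -/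
instance SmoothFun.metrizableSpace {E : Type*} [NormedAddCommGroup E] [NormedSpace ℝ E]
    [FiniteDimensional ℝ E] {H : Type*} [Group H] [TopologicalSpace H] [ChartedSpace E H]
    [LocallyCompactSpace H] [SigmaCompactSpace H] :
    TopologicalSpace.MetrizableSpace (SmoothFun E H) := by
  have : (uniformity C(H, ℝ)).IsCountablyGenerated := inferInstance
  have : TopologicalSpace.MetrizableSpace C(H, ℝ) := inferInstance
  have : TopologicalSpace.MetrizableSpace (List (Fin (Module.finrank ℝ E)) → C(H, ℝ)) :=
    inferInstance
  exact Topology.IsEmbedding.subtypeVal.metrizableSpace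

theorem mainTheorem4
    {E E' : Type u}
    [NormedAddCommGroup E] [NormedSpace ℝ E] [FiniteDimensional ℝ E]
    [NormedAddCommGroup E'] [NormedSpace ℝ E'] [FiniteDimensional ℝ E']
    {G : Type u} [Group G] [TopologicalSpace G] [T2Space G] [ChartedSpace E G]
    [LieGroup 𝓘(ℝ, E) ∞ G]
    {H : Type u} [Group H] [TopologicalSpace H] [T2Space H] [ChartedSpace E' H]
    [LieGroup 𝓘(ℝ, E') ∞ H]
    (f : G →* H) (hf : ContMDiff 𝓘(ℝ, E) 𝓘(ℝ, E') ∞ f) :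
    (IsEpiLCLieGroup E' f → DenseRange f) ∧
    (SecondCountableTopology G → IsEpiRegularFrechetLieGroup E' f → DenseRange f) := by
  have : IsTopologicalGroup G := topologicalGroup_of_lieGroup 𝓘(ℝ, E) ∞
  have : IsTopologicalGroup H := topologicalGroup_of_lieGroup 𝓘(ℝ, E') ∞
  have : LocallyCompactSpace G := ChartedSpace.locallyCompactSpace E G
  have : LocallyCompactSpace H := ChartedSpace.locallyCompactSpace E' H
  refine ⟨fun h => h.denseRange, fun hG h => ?_⟩
  have : SigmaCompactSpace H := h.sigmaCompactSpace hf.continuous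
  exact denseRange_of_conjInl (E := E') f fun v hv => h (SmoothFun E' H × E')
    (SmoothSemidirect E' H) SmoothSemidirect.isRegularLieGroup _ _
    (SmoothSemidirect.lcSmooth_conjInl v) (SmoothSemidirect.lcSmooth_conjInl 0) hv
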